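/- **Setting.** Consider $\min_{x\in\mathbb R^n} f(x)+g(x)+h_1(p_1(x))+h_2(p_2(x))$, where $g:\mathbb R^n\to\mathbb R\cup\{+\infty\}$ is proper, convex and closed; $f:\mathbb R^n\to\mathbb R\cup\{+\infty\}$ is convex, and finite and differentiable on an open set containing $\mathrm{dom}(g)$; $h_1:\mathbb R^{d_1}\to\mathbb R$ is convex and $L_{h_1}$-Lipschitz; $h_2$ is the indicator function of a nonempty closed convex set $\mathcal K\subset\mathbb R^{d_2}$; $p_1:\mathbb R^n\to\mathbb R^{d_1}$ and $p_2:\mathbb R^n\to\mathbb R^{d_2}$ are differentiable; and for all $x,y$, all $u_i,v_i$ and all $\alpha\in(0,1)$, $$h_1\big(p_1(\alpha x+(1-\alpha)y)-\alpha u_1-(1-\alpha)v_1\big)\le\alpha h_1(p_1(x)-u_1)+(1-\alpha)h_1(p_1(y)-v_1),$$ $$p_2(x)-u_2\in\mathcal K,\ p_2(y)-v_2\in\mathcal K\ \Longrightarrow\ p_2(\alpha x+(1-\alpha)y)-\alpha u_2-(1-\alpha)v_2\in\mathcal K.$$ No boundedness of $\mathrm{dom}(g)$ is assumed. Put $F=f+g+h_1\circ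 p_1$, $p=(p_1;p_2)$, $h(u_1;u_2)=h_1(u_1)+h_2(u_2)$, with Fenchel conjugate $h^*$; for $\lambda\in\mathbb R^{d_1+d_2}$ write $\lambda=(\lambda_1;\lambda_2)$. Let $L(x;\lambda)=f(x)+g(x)+\langle\lambda,p(x)\rangle-h^*(\lambda)$ and $D(\lambda)=\inf_xL(x;\lambda)$. Assume that $x^\star\in\mathrm{dom}(g)$ with $p_2(x^\star)\in\mathcal K$ solves the primal problem, that $\lambda^\star\in\mathrm{dom}(h^*)$ maximizes $D$, and that $F(x^\star)=L(x^\star;\lambda^\star)=D(\lambda^\star)$. Let $F^\star$ be the optimal value of the primal problem. For $\beta>0$ let $h(u;\lambda,\beta)$ and $\Lambda(u;\lambda,\beta)$ be the maximum and the maximizer over $v$ of $\langle v,u\rangle-h^*(v)-\frac\beta2\|v-\lambda\|^2$. All norms are Euclidean. **Algorithm IPALM($\mathcal A$).** Let $\beta_0,\epsilon_0>0$, $\rho\in(1/2,1)$, $\eta\in(0,1)$, an integer $m_0\ge1$, $x^{-1}\in\mathrm{dom}(g)$, $\lambda^0\in\mathrm{dom}(h^*)$ be given, and put $\beta_s=\beta_0\rho^s$,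 $\epsilon_s=\epsilon_0\eta^s$. Let $$H_s(x)=f(x)+g(x)+h(p(x);\lambda^s,\beta_s)+\tfrac{\beta_s}2\|x-x^{s-1}\|^2,\qquad H_s^\star=\min_xH_s(x).$$ Let $\mathcal A(x,k,H_s)$ be the (possibly random) output of the inner solver after $k$ iterations on $\min H_s$ from $x$. Starting with $x^0=\mathcal A(x^{-1},m_0,H_0)$, where $\epsilon_0$ satisfies $\mathbb E[H_0(x^0)-H_0^\star]\le\epsilon_0$, for $s=0,1,2,\dots$ set $\lambda^{s+1}=\Lambda(p(x^s);\lambda^s,\beta_s)$, let $m_{s+1}$ be the smallest integer with $2\epsilon_s+M_s\le2^{\lfloor m_{s+1}/K_{s+1}\rfloor}\epsilon_{s+1}/2$, where $$M_s=\beta_s\|\lambda^{s+1}-\lambda^s\|^2+\tfrac{\beta_s-\beta_{s+1}}2\|\Lambda(p(x^s);\lambda^{s+1},\beta_{s+1})-\lambda^{s+1}\|^2+\tfrac{\beta_s^2}{2\beta_{s+1}-\beta_s}\|x^{s-1}-x^s\|^2$$ $$\qquad+\|\lambda^{s+1}-\lambda^s\|\sqrt{\big((\beta_s+\beta_{s+1})L_{h_1}+\|\beta_s\lambda^s_1-\beta_{s+1}\lambda_1^{s+1}\|\big)^2+\|\beta_s\lambda_2^s-\beta_{s+1}\lambda_2^{s+1}\|^2},$$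 and set $x^{s+1}=\mathcal A(x^s,m_{s+1},H_{s+1})$. With $\mathcal F_{s-1}$ the $\sigma$-algebra generated by $x^t,\lambda^t$, $0\le t\le s-1$, the inner solver is assumed linearly convergent: for every $s\ge0$ there is a constant $K_s\ge1$ such that, almost surely, for all $x\in\mathrm{dom}(g)$ and $k\ge0$, $$\mathbb E[H_s(\mathcal A(x,k,H_s))-H_s^\star\mid\mathcal F_{s-1}]\le2^{-\lfloor k/K_s\rfloor}(H_s(x)-H_s^\star).$$ **Theorem.** Suppose $\eta<\rho$, and that $K_s\le\omega/\beta_s^\ell+\varsigma$ for all $s\ge1$, with constants $\varsigma\ge0$, $\omega>0$, $\ell>0$. Then for every $0<\epsilon\le\epsilon_0$ there is an index $s$ such that $$|\mathbb E[F(x^s)-F^\star]|\le\epsilon,\qquad\mathbb E[\mathrm{dist}(p_2(x^s),\mathcal K)]\le\epsilon,$$ and the expected total number of inner iterations up to $x^s$ satisfies $$\sum_{t=0}^s\mathbb E[m_t]\le m_0+\frac{c_3}{\epsilon^\ell}\ln\frac{c_1}{\epsilon\rho},$$ where $$c_0=2\Big(\|(x^{-1},\lambda^0)-(x^\star,\lambda^\star)\|+\tfrac{2\sqrt{\epsilon_0/\beta_0}}{1-\sqrt{\eta/\rho}}\Big)^2+2\|\lambda^\star\|^2+2\|x^\star\|^2,$$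 $$c_1=\max\big(\epsilon_0+2L_{h_1}^2\beta_0+c_0\beta_0,\ \beta_0\|\lambda_2^\star\|\sqrt{c_0},\ \beta_0\sqrt{c_0}\big),$$ $$c_2=\log_2\Big(\tfrac4\eta+\tfrac{2\beta_0\left((11+2\rho^{-2})(L_{h_1}^2+4c_0)+4(2\rho-1)^{-1}c_0\right)}{\epsilon_0\eta}\Big)+1,$$ $$c_3=\frac{1+\log_2(\rho/\eta)+c_2}{\ln(1/\rho)}\Big(\frac{\varsigma c_1^\ell}{\rho^\ell\,\ell\ln(1/\rho)}+\frac{\omega c_1^\ell}{\beta_0^\ell(1-\rho^\ell)}\Big).$$ -/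

import Mathlib

open MeasureTheory ProbabilityTheory Set
open scoped ENNReal NNReal RealInnerProductSpace

noncomputable section

namespace IPALM

/-- `ℝ^k` with its Euclidean norm. -/
abbrev Euc (k : ℕ) : Type := EuclideanSpace ℝ (Fin k)

/-- `ℝ^(d₁+d₂)`: vectors `(u₁; u₂)` with the Euclidean norm `√(‖u₁‖² + ‖u₂‖²)`. The blocks of `u`
are `u.fst` and `u.snd`. -/
abbrev Dual (d₁ d₂ : ℕ) : Type := WithLp 2 (Euc d₁ × Euc d₂)

/-! ### Extended-valued convex functions -/

/-- Effective domain of an extended-valued function. -/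
def dom {V : Type*} (φ : V → EReal) : Set V := {v | φ v ≠ ⊤}

/-- Convexity of an extended-valued function: its epigraph is convex. -/
def ConvexExt {V : Type*} [AddCommGroup V] [Module ℝ V] (φ : V → EReal) : Prop :=
  Convex ℝ {q : V × ℝ | φ q.1 ≤ (q.2 : EReal)}

/-- Fenchel conjugate `φ*(v) = sup_u ⟨v, u⟩ - φ(u)`. -/
def conj {V : Type*} [NormedAddCommGroup V] [InnerProductSpace ℝ V] (φ : V → EReal) (v : V) :
    EReal :=
  ⨆ u : V, ((⟪v, u⟫ : ℝ) : EReal) - φ u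

/-! ### The composite problem `min f(x) + g(x) + h₁(p₁(x)) + h₂(p₂(x))`, `h₂ = indicator of 𝒦` -/

/-- The data of the composite problem. -/
structure Problem (n d₁ d₂ : ℕ) where
  f : Euc n → EReal
  g : Euc n → EReal
  h₁ : Euc d₁ → ℝ
  𝒦 : Set (Euc d₂)
  p₁ : Euc n → Euc d₁
  p₂ : Euc n → Euc d₂
  /-- Lipschitz constant of `h₁`. -/
  Lh₁ : ℝ≥0

variable {n d₁ d₂ : ℕ}

namespace Problem

/-- The standing assumptions on the data (strong duality is stated separately, together with the
primal and dual solutions). -/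
structure Standing (P : Problem n d₁ d₂) : Prop where
  /-- `g` is proper, convex and closed. -/
  g_ne_bot : ∀ x, P.g x ≠ ⊥
  g_dom : (dom P.g).Nonempty
  g_convex : ConvexExt P.g
  g_closed : LowerSemicontinuous P.g
  /-- `f : ℝⁿ → ℝ ∪ {+∞}` is convex, and differentiable on an open set containing `dom g`. -/
  f_ne_bot : ∀ x, P.f x ≠ ⊥
  f_convex : ConvexExt P.f
  f_diff : ∃ U : Set (Euc n), IsOpen U ∧ dom P.g ⊆ U ∧ (∀ x ∈ U, P.f x ≠ ⊤) ∧
    DifferentiableOn ℝ (fun x => (P.f x).toReal) U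
  /-- `h₁` is convex and Lipschitz continuous. -/
  h₁_convex : ConvexOn ℝ univ P.h₁
  h₁_lipschitz : LipschitzWith P.Lh₁ P.h₁
  /-- `𝒦` is a nonempty closed convex set. -/
  K_nonempty : P.𝒦.Nonempty
  K_closed : IsClosed P.𝒦
  K_convex : Convex ℝ P.𝒦
  p₁_diff : Differentiable ℝ P.p₁
  p₂_diff : Differentiable ℝ P.p₂
  comp₁ : ∀ (x y : Euc n) (u v : Euc d₁) (α : ℝ), 0 < α → α < 1 →
    P.h₁ (P.p₁ (α • x + (1 - α) • y) - α • u - (1 - α) • v)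
      ≤ α * P.h₁ (P.p₁ x - u) + (1 - α) * P.h₁ (P.p₁ y - v)
  comp₂ : ∀ (x y : Euc n) (u v : Euc d₂) (α : ℝ), 0 < α → α < 1 →
    P.p₂ x - u ∈ P.𝒦 → P.p₂ y - v ∈ P.𝒦 →
      P.p₂ (α • x + (1 - α) • y) - α • u - (1 - α) • v ∈ P.𝒦

variable (P : Problem n d₁ d₂)

open Classical in
/-- `h(u) = h₁(u₁) + h₂(u₂)`, with `h₂` the indicator function of `𝒦`. -/
def h (u : Dual d₁ d₂) : EReal :=
  (P.h₁ u.fst : EReal) + (if u.snd ∈ P.𝒦 then 0 else ⊤)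

/-- `h*`. -/
def hStar : Dual d₁ d₂ → EReal := conj P.h

/-- `p(x) = (p₁(x); p₂(x))`. -/
def p (x : Euc n) : Dual d₁ d₂ := WithLp.toLp 2 (P.p₁ x, P.p₂ x)

/-- `F(x) = f(x) + g(x) + h₁(p₁(x))`. -/
def F (x : Euc n) : EReal := P.f x + P.g x + (P.h₁ (P.p₁ x) : EReal)

/-- The primal objective `f(x) + g(x) + h(p(x))`. -/
def primal (x : Euc n) : EReal := P.f x + P.g x + P.h (P.p x)

/-- The optimal value of the primal problem. -/
def optVal : EReal := ⨅ x, P.primal x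

/-- The Lagrangian `L(x; λ) = f(x) + g(x) + ⟨λ, p(x)⟩ - h*(λ)`. -/
def lagrangian (x : Euc n) (l : Dual d₁ d₂) : EReal :=
  P.f x + P.g x + ((⟪l, P.p x⟫ : ℝ) : EReal) - P.hStar l

/-- The dual function `D(λ) = inf_x L(x; λ)`. -/
def dualFn (l : Dual d₁ d₂) : EReal := ⨅ x, P.lagrangian x l

/-- `x⋆` solves the primal problem, `λ⋆` solves the dual problem, and strong duality holds. -/
structure OptimalPair (xs : Euc n) (ls : Dual d₁ d₂) : Prop where
  mem_dom_g : xs ∈ dom P.g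
  mem_dom_hStar : ls ∈ dom P.hStar
  feasible : P.p₂ xs ∈ P.𝒦
  primal_opt : ∀ x, P.primal xs ≤ P.primal x
  dual_opt : ∀ l, P.dualFn l ≤ P.dualFn ls
  strong_left : P.F xs = P.lagrangian xs ls
  strong_right : P.lagrangian xs ls = P.dualFn ls

/-! ### Smoothing and inner problems -/

/-- The function `v ↦ ⟨v, u⟩ - h*(v) - (β/2)‖v - λ‖²`. -/
def smoothObj (u l : Dual d₁ d₂) (β : ℝ) (v : Dual d₁ d₂) : EReal :=
  ((⟪v, u⟫ - β / 2 * ‖v - l‖ ^ 2 : ℝ) : EReal) - P.hStar v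

/-- `h(u; λ, β) = max_v ⟨v, u⟩ - h*(v) - (β/2)‖v - λ‖²`. -/
def hSmooth (u l : Dual d₁ d₂) (β : ℝ) : EReal := ⨆ v, P.smoothObj u l β v

/-- `Λ(u; λ, β) = argmax_v ⟨v, u⟩ - h*(v) - (β/2)‖v - λ‖²` (for `β > 0` the maximizer exists and is
unique under the standing assumptions). -/
def Lam (u l : Dual d₁ d₂) (β : ℝ) : Dual d₁ d₂ :=
  Classical.epsilon fun v => IsMaxOn (P.smoothObj u l β) univ v

end Problem

/-- The parameters `(y, λ, β)` of an inner problem `min_x L(x; y, λ, β)`. -/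
structure Inner (n d₁ d₂ : ℕ) where
  y : Euc n
  l : Dual d₁ d₂
  β : ℝ

namespace Problem

variable (P : Problem n d₁ d₂)

/-- The objective of the inner problem with parameters `(y, λ, β)`:
`L(x; y, λ, β) = f(x) + g(x) + h(p(x); λ, β) + (β/2)‖x - y‖²`. -/
def H (I : Inner n d₁ d₂) (x : Euc n) : EReal :=
  P.f x + P.g x + P.hSmooth (P.p x) I.l I.β + ((I.β / 2 * ‖x - I.y‖ ^ 2 : ℝ) : EReal)

/-- `H⋆ = min_x H(x)`. -/
def HStar (I : Inner n d₁ d₂) : EReal := ⨅ x, P.H I x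

/-- The optimality gap `H(x) - H⋆ ∈ [0, ∞]`. -/
def gap (I : Inner n d₁ d₂) (x : Euc n) : ℝ≥0∞ := (P.H I x - P.HStar I).toENNReal

end Problem

/-! ### Inner solvers -/

/-- A (possibly randomized) inner solver: `A x k I` is the law of the output after `k` iterations
on the inner problem with parameters `I`, started at `x`. Deterministic solvers are Dirac laws. -/
abbrev Solver (n d₁ d₂ : ℕ) : Type :=
  Euc n → ℕ → Inner n d₁ d₂ → ProbabilityMeasure (Euc n)

/-- Linear convergence of the solver on one inner problem, with constant `K`: for all `x ∈ dom g`
and all `k`, `E[H(A(x, k, H)) - H⋆] ≤ 2^(-⌊k/K⌋) (H(x) - H⋆)`. -/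
def LinearRate (P : Problem n d₁ d₂) (A : Solver n d₁ d₂) (I : Inner n d₁ d₂) (K : ℝ) : Prop :=
  ∀ x ∈ dom P.g, ∀ k : ℕ,
    ∫⁻ z, P.gap I z ∂(A x k I : Measure (Euc n))
      ≤ (2⁻¹ : ℝ≥0∞) ^ ⌊(k : ℝ) / K⌋₊ * P.gap I x

/-! ### The algorithm -/

/-- Parameters and deterministic starting points of the algorithm. -/
structure Params (n d₁ d₂ : ℕ) where
  β₀ : ℝ
  ρ : ℝ
  η : ℝ
  ε₀ : ℝ
  m₀ : ℕ
  /-- the starting point `x^{-1}` -/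
  xinit : Euc n
  /-- the starting multiplier `λ^0` -/
  linit : Dual d₁ d₂

namespace Params

variable (q : Params n d₁ d₂)

/-- `β_s = β₀ ρ^s`. -/
def β (s : ℕ) : ℝ := q.β₀ * q.ρ ^ s

/-- `ε_s = ε₀ η^s`. -/
def ε (s : ℕ) : ℝ := q.ε₀ * q.η ^ s

/-- Admissible parameters. -/
structure Valid (P : Problem n d₁ d₂) : Prop where
  β₀_pos : 0 < q.β₀
  ρ_gt : 1 / 2 < q.ρ
  ρ_lt : q.ρ < 1
  η_pos : 0 < q.η
  η_lt : q.η < 1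
  ε₀_pos : 0 < q.ε₀
  m₀_pos : 0 < q.m₀
  xinit_mem : q.xinit ∈ dom P.g
  linit_mem : q.linit ∈ dom P.hStar

/-- `prev x s = x^{s-1}`, with `x^{-1}` the starting point. -/
def prev {Ω : Type*} (x : ℕ → Ω → Euc n) : ℕ → Ω → Euc n
  | 0 => fun _ => q.xinit
  | s + 1 => x s

/-- The inner problem `H_s = L(·; x^{s-1}, λ^s, β_s)` along a trajectory. -/
def inner {Ω : Type*} (x : ℕ → Ω → Euc n) (l : ℕ → Ω → Dual d₁ d₂) (s : ℕ) (ω : Ω) :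
    Inner n d₁ d₂ :=
  ⟨q.prev x s ω, l s ω, q.β s⟩

end Params

/-- The quantity `M_s`, as a function of `β_s, β_{s+1}`, `x^{s-1}, x^s`, `λ^s, λ^{s+1}`. -/
def Mterm (P : Problem n d₁ d₂) (b b' : ℝ) (x₀ x : Euc n) (l l' : Dual d₁ d₂) : ℝ :=
  b * ‖l' - l‖ ^ 2
    + (b - b') / 2 * ‖P.Lam (P.p x) l' b' - l'‖ ^ 2
    + b ^ 2 / (2 * b' - b) * ‖x₀ - x‖ ^ 2
    + ‖l' - l‖ * √(((b + b') * P.Lh₁ + ‖b • l.fst - b' • l'.fst‖) ^ 2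
        + ‖b • l.snd - b' • l'.snd‖ ^ 2)

/-- `past x l s` is the σ-algebra `F_{s-1}` generated by `x^t, λ^t` for `0 ≤ t ≤ s-1`
(trivial for `s = 0`). -/
@[reducible] def past {Ω : Type*} (x : ℕ → Ω → Euc n) (l : ℕ → Ω → Dual d₁ d₂) (s : ℕ) : MeasurableSpace Ω :=
  ⨆ t ∈ Finset.range s,
    (MeasurableSpace.comap (x t) inferInstance ⊔ MeasurableSpace.comap (l t) inferInstance)

/-- The random sequences `x^s`, `λ^s`, `m_s` (`s ≥ 0`) are generated by the inexact proximal
augmented Lagrangian method with inner solver `A`, whose constants are `K_s`. -/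
structure IsRun (P : Problem n d₁ d₂) (A : Solver n d₁ d₂) (K : ℕ → ℝ) (q : Params n d₁ d₂)
    {Ω : Type*} [MeasurableSpace Ω] (μ : Measure Ω)
    (x : ℕ → Ω → Euc n) (l : ℕ → Ω → Dual d₁ d₂) (m : ℕ → Ω → ℕ) : Prop where
  measurable_x : ∀ s, Measurable (x s)
  measurable_l : ∀ s, Measurable (l s)
  l_zero : ∀ ω, l 0 ω = q.linit
  m_zero : ∀ ω, m 0 ω = q.m₀
  /-- `λ^{s+1} = Λ(p(x^s); λ^s, β_s)` -/
  l_succ : ∀ s ω, l (s + 1) ω = P.Lam (P.p (x s ω)) (l s ω) (q.β s)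
  /-- `m_{s+1}` is the smallest integer `m` with `2 ε_s + M_s ≤ 2^⌊m / K_{s+1}⌋ ε_{s+1} / 2`. -/
  m_succ : ∀ s ω, IsLeast
    {k : ℕ | 2 * q.ε s
        + Mterm P (q.β s) (q.β (s + 1)) (q.prev x s ω) (x s ω) (l s ω) (l (s + 1) ω)
      ≤ 2 ^ ⌊(k : ℝ) / K (s + 1)⌋₊ * (q.ε (s + 1) / 2)} (m (s + 1) ω)
  /-- `x^s = A(x^{s-1}, m_s, H_s)`: conditionally on `F_{s-1}`, the law of `x^s` is the output law
  of the solver run for `m_s` iterations on `H_s` from `x^{s-1}`. -/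
  x_law : ∀ s, ∀ B : Set (Euc n), MeasurableSet B →
    μ⟦x s ⁻¹' B | past x l s⟧ =ᵐ[μ]
      fun ω => (A (q.prev x s ω) (m s ω) (q.inner x l s ω) : Measure (Euc n)).real B
  /-- `ε₀` bounds the initial inner optimality gap: `E[H₀(x⁰) - H₀⋆] ≤ ε₀`. -/
  init_gap : ∫⁻ ω, P.gap (q.inner x l 0 ω) (x 0 ω) ∂μ ≤ ENNReal.ofReal q.ε₀

/-! ### The constants -/

section constants

variable (P : Problem n d₁ d₂) (q : Params n d₁ d₂) (xs : Euc n) (ls : Dual d₁ d₂)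

/-- `c₀ = 2 (‖(x^{-1}, λ^0) - (x⋆, λ⋆)‖ + 2√(ε₀/β₀)/(1 - √(η/ρ)))² + 2‖λ⋆‖² + 2‖x⋆‖²`. -/
def c₀ : ℝ :=
  2 * (√(‖q.xinit - xs‖ ^ 2 + ‖q.linit - ls‖ ^ 2)
      + 2 * √(q.ε₀ / q.β₀) / (1 - √(q.η / q.ρ))) ^ 2
    + 2 * ‖ls‖ ^ 2 + 2 * ‖xs‖ ^ 2

/-- `c₁ = max(ε₀ + 2 L² β₀ + c₀ β₀, β₀ ‖λ₂⋆‖ √c₀, β₀ √c₀)`. -/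
def c₁ : ℝ :=
  max (q.ε₀ + 2 * (P.Lh₁ : ℝ) ^ 2 * q.β₀ + c₀ q xs ls * q.β₀)
    (max (q.β₀ * ‖ls.snd‖ * √(c₀ q xs ls)) (q.β₀ * √(c₀ q xs ls)))

/-- `c₂ = log₂(4/η + 2β₀((11 + 2ρ⁻²)(L² + 4c₀) + 4(2ρ-1)⁻¹c₀)/(ε₀η)) + 1`. -/
def c₂ : ℝ :=
  Real.logb 2 (4 / q.η
    + 2 * q.β₀ * ((11 + 2 * (q.ρ ^ 2)⁻¹) * ((P.Lh₁ : ℝ) ^ 2 + 4 * c₀ q xs ls)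
        + 4 * (2 * q.ρ - 1)⁻¹ * c₀ q xs ls) / (q.ε₀ * q.η)) + 1

/-- `c₃ = (1 + log₂(ρ/η) + c₂)/ln(1/ρ) · (ς c₁^ℓ/(ρ^ℓ ℓ ln(1/ρ)) + ω c₁^ℓ/(β₀^ℓ (1 - ρ^ℓ)))`. -/
def c₃ (ϖ ς ℓ : ℝ) : ℝ :=
  (1 + Real.logb 2 (q.ρ / q.η) + c₂ P q xs ls) / Real.log (1 / q.ρ)
    * (ς * c₁ P q xs ls ^ ℓ / (q.ρ ^ ℓ * ℓ * Real.log (1 / q.ρ))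
      + ϖ * c₁ P q xs ls ^ ℓ / (q.β₀ ^ ℓ * (1 - q.ρ ^ ℓ)))

end constants

/-- The random point `X` is an `ε`-optimal solution in expectation: `F(X)` is almost surely finite
and integrable with `|E[F(X) - F⋆]| ≤ ε`, and `E[dist(p₂(X), 𝒦)] ≤ ε`. -/
structure EpsOptimal (P : Problem n d₁ d₂) {Ω : Type*} [MeasurableSpace Ω] (μ : Measure Ω)
    (X : Ω → Euc n) (ε : ℝ) : Prop where
  finite : ∀ᵐ ω ∂μ, P.F (X ω) ≠ ⊤
  integrable_F : Integrable (fun ω => (P.F (X ω)).toReal) μ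
  value : |∫ ω, ((P.F (X ω)).toReal - P.optVal.toReal) ∂μ| ≤ ε
  integrable_dist : Integrable (fun ω => Metric.infDist (P.p₂ (X ω)) P.𝒦) μ
  feasible : ∫ ω, Metric.infDist (P.p₂ (X ω)) P.𝒦 ∂μ ≤ ε

end IPALM

end

/-! ### Subgradients of `h`, its conjugate and its smoothing. -/

noncomputable section

namespace IPALM

/-! The method is an inexact proximal point algorithm. Write w_s = (x^{s-1}, λ^s). By optimality,
the exact minimizer of H_s together with its multiplier is a point y_s such that β_s (w_s - y_s)
lies in the saddle operator of the Lagrangian at y_s (`Standing.isProx_of_isMinOn`). This operator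
is monotone and vanishes at w⋆ = (x⋆, λ⋆). Moreover H_s grows quadratically around y_s jointly in
the primal point and in the multiplier it induces (`IsProx.growth`), so ‖w_{s+1} - y_s‖² is at most
2/β_s times the inner gap of x^s.

The gaps are controlled by induction. `IsProx.gap_next_le` bounds the gap of x^s for H_{s+1} by
twice its gap for H_s plus M_s. The stopping rule for m_{s+1} and the linear rate of the solver,
used conditionally on the past, then bring the expected gap of x^{s+1} down to ε_{s+1}
(`IsRun.lintegral_gap_le`). Hence step s of the proximal iteration has L² error at most √(2
ε_s/β_s), which is summable because η < ρ. Resolvents do not increase the distance to w⋆, so all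
iterates stay within a fixed L² distance of it. No boundedness of dom g is needed.

Infeasibility at x^s and the lower deviation of F are at most a constant times β_s ‖w_{s+1} - w_s‖.
The upper deviation is at most the gap plus β_s times squared distances. Everything is therefore
O(ρ^s). The stated constants need one further factor ρ in the bound on the step. This comes from two
consecutive proximal steps: the second residual is at most 1/(1+ρ) times the initial distance
(`prox_two_step`), and 1/(1+ρ) ≤ √2 ρ for ρ > 1/2.

For the cost, E M_s is O(β_s), so the argument of the logarithm that determines m_{s+1} has mean
O((ρ/η)^s). Concavity of the logarithm gives E m_{s+1} ≤ K_{s+1} · O(s + 1). Summing K_t ≤ ω/β_t^ℓ +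
ς up to the largest s with ρ^{-s} ≤ c₁/ε yields a geometric sum of order ε^{-ℓ} times a logarithmic
number of outer steps. -/

/-- First-order test: a quadratic without constant term that is nonnegative on `(0, 1)` has
nonnegative slope at the origin. -/
theorem nonneg_of_forall_quadratic {a b : ℝ}
    (h : ∀ t : ℝ, 0 < t → t < 1 → 0 ≤ t * a + t ^ 2 * b) : 0 ≤ a := by
  by_contra ha
  push Not at ha
  have hb : 0 < |b| + 1 := by positivity
  have hden : 0 < |b| + 1 - a := by linarith
  have ht0 : 0 < -a / (2 * (|b| + 1 - a)) := div_pos (by linarith) (by linarith)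
  have ht1 : -a / (2 * (|b| + 1 - a)) < 1 := by
    rw [div_lt_one (by linarith)]; linarith
  have key := h _ ht0 ht1
  set t := -a / (2 * (|b| + 1 - a)) with ht
  have htd : t * (2 * (|b| + 1 - a)) = -a := by
    rw [ht]; field_simp
  have h1 : 0 ≤ a + t * b := by
    have : 0 ≤ t * (a + t * b) := by nlinarith
    exact nonneg_of_mul_nonneg_right this ht0
  have h2 : t * b ≤ t * |b| := mul_le_mul_of_nonneg_left (le_abs_self b) ht0.le
  nlinarith

theorem inner_dual {d₁ d₂ : ℕ} (v w : Dual d₁ d₂) :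
    ⟪v, w⟫ = ⟪v.fst, w.fst⟫ + ⟪v.snd, w.snd⟫ :=
  WithLp.prod_inner_apply v w

theorem norm_sq_dual {d₁ d₂ : ℕ} (v : Dual d₁ d₂) :
    ‖v‖ ^ 2 = ‖v.fst‖ ^ 2 + ‖v.snd‖ ^ 2 :=
  WithLp.prod_norm_sq_eq_of_L2 v

theorem norm_fst_dual_le {d₁ d₂ : ℕ} (v : Dual d₁ d₂) : ‖v.fst‖ ≤ ‖v‖ := by
  have := norm_sq_dual v
  exact abs_le_of_sq_le_sq' (by nlinarith [sq_nonneg ‖v.snd‖]) (norm_nonneg v) |>.2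

theorem norm_snd_dual_le {d₁ d₂ : ℕ} (v : Dual d₁ d₂) : ‖v.snd‖ ≤ ‖v‖ := by
  have := norm_sq_dual v
  exact abs_le_of_sq_le_sq' (by nlinarith [sq_nonneg ‖v.fst‖]) (norm_nonneg v) |>.2

namespace Problem

variable {n d₁ d₂ : ℕ} {P : Problem n d₁ d₂}

/-- `v` is a subgradient of `h` at `w`. -/
structure IsSubgrad (P : Problem n d₁ d₂) (v w : Dual d₁ d₂) : Prop where
  mem : w.snd ∈ P.𝒦
  le : ∀ u : Dual d₁ d₂, u.snd ∈ P.𝒦 → P.h₁ w.fst + ⟪v, u - w⟫ ≤ P.h₁ u.fst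

theorem h_of_mem {u : Dual d₁ d₂} (hu : u.snd ∈ P.𝒦) : P.h u = (P.h₁ u.fst : EReal) := by
  simp [h, hu]

theorem h_of_notMem {u : Dual d₁ d₂} (hu : u.snd ∉ P.𝒦) : P.h u = ⊤ := by
  simp [h, hu]

theorem le_hStar (v : Dual d₁ d₂) {u : Dual d₁ d₂} (hu : u.snd ∈ P.𝒦) :
    ((⟪v, u⟫ - P.h₁ u.fst : ℝ) : EReal) ≤ P.hStar v := by
  refine le_trans ?_ (le_iSup _ u)
  rw [h_of_mem hu, EReal.coe_sub]

theorem hStar_le {v : Dual d₁ d₂} {c : ℝ}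
    (H : ∀ u : Dual d₁ d₂, u.snd ∈ P.𝒦 → ⟪v, u⟫ - P.h₁ u.fst ≤ c) : P.hStar v ≤ c := by
  refine iSup_le fun u => ?_
  by_cases hu : u.snd ∈ P.𝒦
  · rw [h_of_mem hu, ← EReal.coe_sub]
    exact_mod_cast H u hu
  · rw [h_of_notMem hu, EReal.sub_top]
    exact bot_le

theorem Standing.exists_mem (hP : P.Standing) : ∃ u : Dual d₁ d₂, u.snd ∈ P.𝒦 := by
  obtain ⟨k, hk⟩ := hP.K_nonempty
  exact ⟨WithLp.toLp 2 (0, k), hk⟩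

theorem Standing.hStar_ne_bot (hP : P.Standing) (v : Dual d₁ d₂) : P.hStar v ≠ ⊥ := by
  obtain ⟨u, hu⟩ := hP.exists_mem
  intro hb
  have := le_hStar v hu
  rw [hb, le_bot_iff] at this
  exact EReal.coe_ne_bot _ this

/-- Real values of the conjugate on its domain. -/
def hsr (P : Problem n d₁ d₂) (v : Dual d₁ d₂) : ℝ := (P.hStar v).toReal

theorem Standing.coe_hsr (hP : P.Standing) {v : Dual d₁ d₂} (hv : v ∈ dom P.hStar) :
    ((P.hsr v : ℝ) : EReal) = P.hStar v :=
  EReal.coe_toReal hv (hP.hStar_ne_bot v)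

theorem Standing.fenchel (hP : P.Standing) {v : Dual d₁ d₂} (hv : v ∈ dom P.hStar)
    {u : Dual d₁ d₂} (hu : u.snd ∈ P.𝒦) : ⟪v, u⟫ - P.h₁ u.fst ≤ P.hsr v := by
  have := le_hStar v hu
  rw [← hP.coe_hsr hv] at this
  exact_mod_cast this

namespace IsSubgrad

variable {v w v' w' : Dual d₁ d₂}

theorem hStar_eq (hs : P.IsSubgrad v w) : P.hStar v = ((⟪v, w⟫ - P.h₁ w.fst : ℝ) : EReal) := by
  refine le_antisymm (hStar_le fun u hu => ?_) (le_hStar v hs.mem)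
  have := hs.le u hu
  rw [inner_sub_right] at this
  linarith

theorem mem_dom (hs : P.IsSubgrad v w) : v ∈ dom P.hStar := by
  change P.hStar v ≠ ⊤
  rw [hs.hStar_eq]
  exact EReal.coe_ne_top _

theorem hsr_eq (hs : P.IsSubgrad v w) : P.hsr v = ⟪v, w⟫ - P.h₁ w.fst := by
  rw [hsr, hs.hStar_eq, EReal.toReal_coe]

theorem inner_nonneg (hs : P.IsSubgrad v w) (hs' : P.IsSubgrad v' w') :
    0 ≤ ⟪v - v', w - w'⟫ := by
  have h1 := hs.le w' hs'.mem
  have h2 := hs'.le w hs.mem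
  have e : ⟪v - v', w - w'⟫ = -⟪v, w' - w⟫ - ⟪v', w - w'⟫ := by
    simp only [inner_sub_left, inner_sub_right]; ring
  rw [e]; linarith

/-- The first block is unconstrained, so `w` may be moved by `v.fst` there. The subgradient
inequality and the Lipschitz bound then give ‖v₁‖² ≤ L‖v₁‖. -/
theorem norm_fst_le (hs : P.IsSubgrad v w) (hP : P.Standing) : ‖v.fst‖ ≤ P.Lh₁ := by
  have h1 := hs.le (WithLp.toLp 2 (w.fst + v.fst, w.snd)) hs.mem
  rw [inner_dual] at h1
  change P.h₁ w.fst + (⟪v.fst, w.fst + v.fst - w.fst⟫ + ⟪v.snd, w.snd - w.snd⟫)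
    ≤ P.h₁ (w.fst + v.fst) at h1
  rw [sub_self, inner_zero_right, add_zero, add_sub_cancel_left, real_inner_self_eq_norm_sq] at h1
  have h2 := hP.h₁_lipschitz.dist_le_mul (w.fst + v.fst) w.fst
  rw [Real.dist_eq, dist_eq_norm, add_sub_cancel_left] at h2
  have h3 := (abs_le.1 h2).2
  by_contra hlt
  push Not at hlt
  have : 0 < ‖v.fst‖ := lt_of_le_of_lt P.Lh₁.2 hlt
  nlinarith

end IsSubgrad

theorem continuous_fst_dual : Continuous fun u : Dual d₁ d₂ => u.fst :=
  continuous_fst.comp (WithLp.prod_continuous_ofLp 2 _ _)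

theorem continuous_snd_dual : Continuous fun u : Dual d₁ d₂ => u.snd :=
  continuous_snd.comp (WithLp.prod_continuous_ofLp 2 _ _)

/-- The proximal point of `h` at `c`: a minimizer of `h₁` plus a quadratic over the closed set of
feasible second blocks. It exists because a Lipschitz function loses at most linearly, and its
first-order condition is the asserted inclusion. -/
theorem Standing.exists_prox (hP : P.Standing) (c : Dual d₁ d₂) {β : ℝ} (hβ : 0 < β) :
    ∃ w, P.IsSubgrad (β⁻¹ • (c - w)) w := by
  set S : Set (Dual d₁ d₂) := {u | u.snd ∈ P.𝒦} with hS
  have hScl : IsClosed S := hP.K_closed.preimage continuous_snd_dual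
  obtain ⟨w0, hw0⟩ := hP.exists_mem
  set ψ : Dual d₁ d₂ → ℝ := fun u => P.h₁ u.fst + (2 * β)⁻¹ * ‖u - c‖ ^ 2 with hψ
  have hψc : Continuous ψ := by
    have := hP.h₁_lipschitz.continuous.comp (continuous_fst_dual (d₂ := d₂))
    exact this.add (by fun_prop)
  obtain ⟨w, hw, hmin⟩ := hψc.continuousOn.exists_isMinOn' (s := S) hScl hw0 (by
    set A := |ψ w0 - P.h₁ c.fst|
    -- Beyond this radius the quadratic term exceeds the linear loss `L‖u - c‖` and also the offset
    -- `A` of the reference point; the bound `1` lets `A` be absorbed into `A‖u - c‖`.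
    set R := max 1 (2 * β * (P.Lh₁ + A))
    have : (Metric.closedBall c R)ᶜ ∈ Filter.cocompact (Dual d₁ d₂) :=
      (isCompact_closedBall c R).compl_mem_cocompact
    filter_upwards [Filter.mem_inf_of_left this] with u hu
    have hu' : R < ‖u - c‖ := by
      simpa [dist_eq_norm] using hu
    have h1 : 1 ≤ ‖u - c‖ := (le_max_left _ _).trans hu'.le
    have h2 : 2 * β * (P.Lh₁ + A) ≤ ‖u - c‖ := (le_max_right _ _).trans hu'.le
    have h3 : (P.Lh₁ + A) ≤ (2 * β)⁻¹ * ‖u - c‖ := by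
      rw [inv_mul_eq_div, le_div_iff₀ (by positivity)]; linarith
    have h4 := hP.h₁_lipschitz.dist_le_mul u.fst c.fst
    rw [Real.dist_eq, dist_eq_norm] at h4
    have h5 := (abs_le.1 h4).1
    have h6 : ‖u.fst - c.fst‖ ≤ ‖u - c‖ := norm_fst_dual_le (u - c)
    have h7 : (P.Lh₁ : ℝ) * ‖u.fst - c.fst‖ ≤ P.Lh₁ * ‖u - c‖ :=
      mul_le_mul_of_nonneg_left h6 P.Lh₁.2
    have h8 : ψ w0 - P.h₁ c.fst ≤ A := le_abs_self _
    have hA : 0 ≤ A := abs_nonneg _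
    have h9 : (P.Lh₁ + A) * ‖u - c‖ ≤ (2 * β)⁻¹ * ‖u - c‖ * ‖u - c‖ :=
      mul_le_mul_of_nonneg_right h3 (norm_nonneg _)
    change ψ w0 ≤ P.h₁ u.fst + (2 * β)⁻¹ * ‖u - c‖ ^ 2
    nlinarith)
  refine ⟨w, hw, fun u hu => ?_⟩
  have key : 0 ≤ (P.h₁ u.fst - P.h₁ w.fst + β⁻¹ * ⟪w - c, u - w⟫) := by
    refine nonneg_of_forall_quadratic (b := (2 * β)⁻¹ * ‖u - w‖ ^ 2) fun t ht0 ht1 => ?_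
    have hmem : w + t • (u - w) ∈ S := by
      have := hP.K_convex hw hu (by linarith : (0 : ℝ) ≤ 1 - t) ht0.le (by ring)
      change (w + t • (u - w)).snd ∈ P.𝒦
      convert this using 1
      change w.snd + t • (u.snd - w.snd) = _
      module
    have h1 : ψ w ≤ ψ (w + t • (u - w)) := hmin hmem
    have h2 : P.h₁ (w + t • (u - w)).fst ≤ (1 - t) * P.h₁ w.fst + t * P.h₁ u.fst := by
      have := hP.h₁_convex.2 (mem_univ w.fst) (mem_univ u.fst)
        (by linarith : (0 : ℝ) ≤ 1 - t) ht0.le (by ring)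
      have e : (w + t • (u - w)).fst = (1 - t) • w.fst + t • u.fst := by
        change w.fst + t • (u.fst - w.fst) = _
        module
      rw [e]
      exact this
    have h3 : ‖w + t • (u - w) - c‖ ^ 2
        = ‖w - c‖ ^ 2 + 2 * t * ⟪w - c, u - w⟫ + t ^ 2 * ‖u - w‖ ^ 2 := by
      rw [show w + t • (u - w) - c = (w - c) + t • (u - w) by abel, norm_add_sq_real,
        inner_smul_right, norm_smul, mul_pow, Real.norm_eq_abs, sq_abs]
      ring
    simp only [hψ] at h1
    rw [h3] at h1
    have hb : (2 * β)⁻¹ * 2 = β⁻¹ := by field_simp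
    have : (2 * β)⁻¹ * (‖w - c‖ ^ 2 + 2 * t * ⟪w - c, u - w⟫ + t ^ 2 * ‖u - w‖ ^ 2)
        = (2 * β)⁻¹ * ‖w - c‖ ^ 2 + t * (β⁻¹ * ⟪w - c, u - w⟫)
          + t ^ 2 * ((2 * β)⁻¹ * ‖u - w‖ ^ 2) := by
      rw [← hb]; ring
    rw [this] at h1
    nlinarith
  have e : ⟪β⁻¹ • (c - w), u - w⟫ = -(β⁻¹ * ⟪w - c, u - w⟫) := by
    rw [real_inner_smul_left, ← neg_sub w c, inner_neg_left, mul_neg]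
  rw [e]; linarith

/-- Any point `v` with `u - β (v - l) ∈ ∂h*(v)` maximizes the smoothing objective, with quadratic
growth. -/
theorem IsSubgrad.growth (hP : P.Standing) {u l v : Dual d₁ d₂} {β : ℝ}
    (hs : P.IsSubgrad v (u - β • (v - l))) {v' : Dual d₁ d₂} (hv' : v' ∈ dom P.hStar) :
    ⟪v', u⟫ - P.hsr v' - β / 2 * ‖v' - l‖ ^ 2 + β / 2 * ‖v' - v‖ ^ 2
      ≤ ⟪v, u⟫ - P.hsr v - β / 2 * ‖v - l‖ ^ 2 := by
  have h1 := hP.fenchel hv' hs.mem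
  have h2 := hs.hsr_eq
  have e1 : ‖v' - l‖ ^ 2 = ‖v' - v‖ ^ 2 + 2 * ⟪v' - v, v - l⟫ + ‖v - l‖ ^ 2 := by
    rw [← norm_add_sq_real, sub_add_sub_cancel]
  rw [inner_sub_right, inner_smul_right] at h1 h2
  rw [e1, inner_sub_left]
  nlinarith

/-- Moreau decomposition: if `w` is the proximal point of `h` at `u + β l`, then `v = β⁻¹(u + β l -
w)` satisfies `w = u - β(v - l)`. -/
theorem Standing.exists_isSubgrad (hP : P.Standing) (u l : Dual d₁ d₂) {β : ℝ} (hβ : 0 < β) :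
    ∃ v, P.IsSubgrad v (u - β • (v - l)) := by
  obtain ⟨w, hw⟩ := hP.exists_prox (u + β • l) hβ
  refine ⟨β⁻¹ • (u + β • l - w), ?_⟩
  convert hw using 1
  rw [smul_sub, smul_smul, mul_inv_cancel₀ hβ.ne', one_smul]
  abel

theorem Standing.smoothObj_coe (hP : P.Standing) (u l : Dual d₁ d₂) (β : ℝ) {v : Dual d₁ d₂}
    (hv : v ∈ dom P.hStar) :
    P.smoothObj u l β v = ((⟪v, u⟫ - P.hsr v - β / 2 * ‖v - l‖ ^ 2 : ℝ) : EReal) := by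
  rw [smoothObj, ← hP.coe_hsr hv, ← EReal.coe_sub]
  congr 1; ring

theorem smoothObj_of_notMem (u l : Dual d₁ d₂) (β : ℝ) {v : Dual d₁ d₂}
    (hv : v ∉ dom P.hStar) : P.smoothObj u l β v = ⊥ := by
  have : P.hStar v = ⊤ := by simpa [dom] using hv
  rw [smoothObj, this, EReal.sub_top]

theorem IsSubgrad.isMaxOn (hP : P.Standing) {u l v : Dual d₁ d₂} {β : ℝ} (hβ : 0 < β)
    (hs : P.IsSubgrad v (u - β • (v - l))) : IsMaxOn (P.smoothObj u l β) univ v := by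
  intro v' _
  change P.smoothObj u l β v' ≤ P.smoothObj u l β v
  by_cases hv' : v' ∈ dom P.hStar
  · rw [hP.smoothObj_coe u l β hv', hP.smoothObj_coe u l β hs.mem_dom]
    have := hs.growth hP hv'
    have : 0 ≤ β / 2 * ‖v' - v‖ ^ 2 := by positivity
    exact_mod_cast (by linarith)
  · rw [smoothObj_of_notMem u l β hv']; exact bot_le

/-- `Lam` picks some maximizer, and quadratic growth around the maximizer built from the proximal
point leaves only one. From here on `Lam` is used only through this inclusion. -/
theorem Standing.lam_spec (hP : P.Standing) (u l : Dual d₁ d₂) {β : ℝ} (hβ : 0 < β) :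
    P.IsSubgrad (P.Lam u l β) (u - β • (P.Lam u l β - l)) := by
  obtain ⟨v, hv⟩ := hP.exists_isSubgrad u l hβ
  have hmax : IsMaxOn (P.smoothObj u l β) univ (P.Lam u l β) :=
    Classical.epsilon_spec (p := fun v => IsMaxOn (P.smoothObj u l β) univ v)
      ⟨v, hv.isMaxOn hP hβ⟩
  have hle : P.smoothObj u l β v ≤ P.smoothObj u l β (P.Lam u l β) := hmax (mem_univ v)
  have hd : P.Lam u l β ∈ dom P.hStar := by
    by_contra hn
    rw [smoothObj_of_notMem u l β hn, hP.smoothObj_coe u l β hv.mem_dom, le_bot_iff] at hle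
    exact EReal.coe_ne_bot _ hle
  rw [hP.smoothObj_coe u l β hv.mem_dom, hP.smoothObj_coe u l β hd] at hle
  have h1 := EReal.coe_le_coe_iff.1 hle
  have h2 := hv.growth hP hd
  have h3 : β / 2 * ‖P.Lam u l β - v‖ ^ 2 ≤ 0 := by linarith
  have h4 : ‖P.Lam u l β - v‖ ^ 2 ≤ 0 := by
    by_contra hn
    push Not at hn
    have : 0 < β / 2 * ‖P.Lam u l β - v‖ ^ 2 := by positivity
    linarith
  have h5 : P.Lam u l β = v := by
    have := sq_nonneg ‖P.Lam u l β - v‖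
    rw [← sub_eq_zero, ← norm_eq_zero]
    exact pow_eq_zero_iff (two_ne_zero) |>.1 (le_antisymm h4 this)
  rw [h5]; exact hv

/-- Real value of the smoothed function. -/
def hsm (P : Problem n d₁ d₂) (u l : Dual d₁ d₂) (β : ℝ) : ℝ :=
  ⟪P.Lam u l β, u⟫ - P.hsr (P.Lam u l β) - β / 2 * ‖P.Lam u l β - l‖ ^ 2

theorem Standing.hSmooth_eq (hP : P.Standing) (u l : Dual d₁ d₂) {β : ℝ} (hβ : 0 < β) :
    P.hSmooth u l β = ((P.hsm u l β : ℝ) : EReal) := by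
  have hs := hP.lam_spec u l hβ
  rw [hsm, ← hP.smoothObj_coe u l β hs.mem_dom]
  exact le_antisymm (iSup_le fun v => hs.isMaxOn hP hβ (mem_univ v)) (le_iSup _ _)

theorem Standing.hsm_growth (hP : P.Standing) (u l : Dual d₁ d₂) {β : ℝ} (hβ : 0 < β)
    {v : Dual d₁ d₂} (hv : v ∈ dom P.hStar) :
    ⟪v, u⟫ - P.hsr v - β / 2 * ‖v - l‖ ^ 2 + β / 2 * ‖v - P.Lam u l β‖ ^ 2 ≤ P.hsm u l β :=
  (hP.lam_spec u l hβ).growth hP hv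

theorem Standing.hsm_ge (hP : P.Standing) (u l : Dual d₁ d₂) {β : ℝ} (hβ : 0 < β)
    {v : Dual d₁ d₂} (hv : v ∈ dom P.hStar) :
    ⟪v, u⟫ - P.hsr v - β / 2 * ‖v - l‖ ^ 2 ≤ P.hsm u l β := by
  have := hP.hsm_growth u l hβ hv
  have : 0 ≤ β / 2 * ‖v - P.Lam u l β‖ ^ 2 := by positivity
  linarith

/-- The smoothed value through the prox point `u - β (Λ - l)`. -/
theorem Standing.hsm_eq (hP : P.Standing) (u l : Dual d₁ d₂) {β : ℝ} (hβ : 0 < β) :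
    P.hsm u l β = P.h₁ (u - β • (P.Lam u l β - l)).fst
      + β / 2 * ‖P.Lam u l β‖ ^ 2 - β / 2 * ‖l‖ ^ 2 := by
  have hs := (hP.lam_spec u l hβ).hsr_eq
  rw [hsm, hs, inner_sub_right, inner_smul_right, inner_sub_right, real_inner_self_eq_norm_sq,
    norm_sub_sq_real]
  ring

theorem Standing.hsm_le (hP : P.Standing) {u : Dual d₁ d₂} (hu : u.snd ∈ P.𝒦) (l : Dual d₁ d₂)
    {β : ℝ} (hβ : 0 < β) : P.hsm u l β ≤ P.h₁ u.fst := by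
  have hs := hP.fenchel (hP.lam_spec u l hβ).mem_dom hu
  have : 0 ≤ β / 2 * ‖P.Lam u l β - l‖ ^ 2 := by positivity
  rw [hsm]; linarith

/-- Monotonicity of ∂h makes the resolvent Lipschitz. The resulting continuity of `Lam` serves
twice: in the limit that yields the inner optimality condition, and for measurability. -/
theorem Standing.lam_sub_le (hP : P.Standing) (u l u' l' : Dual d₁ d₂) {β : ℝ} (hβ : 0 < β) :
    β * ‖P.Lam u l β - P.Lam u' l' β‖ ≤ ‖(u + β • l) - (u' + β • l')‖ := by
  have h := (hP.lam_spec u l hβ).inner_nonneg (hP.lam_spec u' l' hβ)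
  set v := P.Lam u l β
  set v' := P.Lam u' l' β
  have e : u - β • (v - l) - (u' - β • (v' - l'))
      = ((u + β • l) - (u' + β • l')) - β • (v - v') := by module
  rw [e, inner_sub_right, inner_smul_right, real_inner_self_eq_norm_sq] at h
  have hc := real_inner_le_norm (v - v') ((u + β • l) - (u' + β • l'))
  rcases eq_or_lt_of_le (norm_nonneg (v - v')) with h0 | h0
  · rw [← h0]; simp
  · nlinarith

theorem Standing.continuous_lam (hP : P.Standing) {β : ℝ} (hβ : 0 < β) :
    Continuous fun z : Dual d₁ d₂ × Dual d₁ d₂ => P.Lam z.1 z.2 β := by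
  rw [continuous_iff_continuousAt]
  intro z
  have h1 : Filter.Tendsto (fun y : Dual d₁ d₂ × Dual d₁ d₂ =>
      β⁻¹ * ‖(y.1 + β • y.2) - (z.1 + β • z.2)‖) (nhds z) (nhds 0) := by
    have : Continuous fun y : Dual d₁ d₂ × Dual d₁ d₂ =>
      β⁻¹ * ‖(y.1 + β • y.2) - (z.1 + β • z.2)‖ := by fun_prop
    have h := this.tendsto z
    simpa using h
  refine tendsto_iff_norm_sub_tendsto_zero.2 (squeeze_zero (fun _ => norm_nonneg _) (fun y => ?_) h1)
  rw [inv_mul_eq_div, le_div_iff₀ hβ, mul_comm]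
  exact hP.lam_sub_le y.1 y.2 z.1 z.2 hβ

theorem Standing.continuous_hsm (hP : P.Standing) {β : ℝ} (hβ : 0 < β) :
    Continuous fun z : Dual d₁ d₂ × Dual d₁ d₂ => P.hsm z.1 z.2 β := by
  have e : (fun z : Dual d₁ d₂ × Dual d₁ d₂ => P.hsm z.1 z.2 β) = fun z =>
      P.h₁ (z.1 - β • (P.Lam z.1 z.2 β - z.2)).fst
      + β / 2 * ‖P.Lam z.1 z.2 β‖ ^ 2 - β / 2 * ‖z.2‖ ^ 2 :=
    funext fun z => hP.hsm_eq z.1 z.2 hβ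
  rw [e]
  have hL := hP.continuous_lam hβ
  have h1 : Continuous fun z : Dual d₁ d₂ × Dual d₁ d₂ =>
      P.h₁ (z.1 - β • (P.Lam z.1 z.2 β - z.2)).fst :=
    hP.h₁_lipschitz.continuous.comp (continuous_fst_dual.comp
      (continuous_fst.sub ((hL.sub continuous_snd).const_smul β)))
  exact (h1.add ((hL.norm.pow 2).const_mul _)).sub ((continuous_snd.norm.pow 2).const_mul _)

end Problem
end IPALM

end

/-! ### Convexity of the Lagrangian and lower semicontinuity of the inner objective. -/

noncomputable section

namespace IPALM

theorem ConvexExt.le {V : Type*} [AddCommGroup V] [Module ℝ V] {φ : V → EReal}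
    (hφ : ConvexExt φ) {x y : V} {a b s t : ℝ} (hx : φ x ≤ a) (hy : φ y ≤ b)
    (hs : 0 ≤ s) (ht : 0 ≤ t) (hst : s + t = 1) : φ (s • x + t • y) ≤ ((s * a + t * b : ℝ) : EReal) := by
  have h := hφ (x := (x, a)) (y := (y, b)) hx hy hs ht hst
  exact h

/-- A convex function that is finite and continuous near some point, and nowhere `⊥`, is locally
bounded below. -/
theorem ConvexExt.eventually_ge {V : Type*} [NormedAddCommGroup V] [NormedSpace ℝ V] {φ : V → EReal}
    (hφ : ConvexExt φ) (hbot : ∀ x, φ x ≠ ⊥) {x₀ : V} {M : ℝ}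
    (hM : ∀ᶠ z in nhds x₀, φ z ≤ M) (x : V) : ∃ c : ℝ, ∀ᶠ z in nhds x, (c : EReal) ≤ φ z := by
  obtain ⟨r, hr, hball⟩ := Metric.eventually_nhds_iff.1 hM
  -- With this `τ`, the point `x₀ - τ(z - x₀)` stays in the ball where `φ ≤ M` for every `z` within
  -- distance 1 of `x`. Since `x₀` is a convex combination of `z` and that point, convexity bounds
  -- `φ z` from below.
  set τ : ℝ := r / (2 * (‖x - x₀‖ + 1)) with hτ
  have hN : 0 < ‖x - x₀‖ + 1 := by positivity
  have hτ0 : 0 < τ := by positivity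
  have hx₀ : φ x₀ ≤ M := hball (by simpa using hr)
  have hf0 : ((φ x₀).toReal : EReal) = φ x₀ :=
    EReal.coe_toReal (ne_top_of_le_ne_top (EReal.coe_ne_top M) hx₀) (hbot x₀)
  refine ⟨((1 + τ) * (φ x₀).toReal - M) / τ, ?_⟩
  filter_upwards [Metric.ball_mem_nhds x one_pos] with z hz
  by_cases hzt : φ z = ⊤
  · rw [hzt]; exact le_top
  have hza : ((φ z).toReal : EReal) = φ z := EReal.coe_toReal hzt (hbot z)
  have hz' : φ (x₀ - τ • (z - x₀)) ≤ M := by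
    apply hball
    rw [dist_eq_norm, show x₀ - τ • (z - x₀) - x₀ = -(τ • (z - x₀)) by abel, norm_neg, norm_smul,
      Real.norm_of_nonneg hτ0.le]
    have h1 : ‖z - x₀‖ ≤ ‖x - x₀‖ + 1 := by
      have : ‖z - x‖ < 1 := by simpa [dist_eq_norm] using hz
      calc ‖z - x₀‖ = ‖(z - x) + (x - x₀)‖ := by rw [sub_add_sub_cancel]
        _ ≤ ‖z - x‖ + ‖x - x₀‖ := norm_add_le _ _
        _ ≤ _ := by linarith
    calc τ * ‖z - x₀‖ ≤ τ * (‖x - x₀‖ + 1) := by gcongr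
      _ = r / 2 := by rw [hτ]; field_simp
      _ < r := by linarith
  have h := hφ.le (s := τ / (1 + τ)) (t := 1 / (1 + τ)) hza.ge hz' (by positivity) (by positivity)
    (by field_simp; ring)
  have e : (τ / (1 + τ)) • z + (1 / (1 + τ)) • (x₀ - τ • (z - x₀)) = x₀ := by
    have h1 : (1 + τ) ≠ 0 := by positivity
    rw [div_eq_mul_inv, one_div]
    have : x₀ = ((1 + τ)⁻¹ * (1 + τ)) • x₀ := by rw [inv_mul_cancel₀ h1, one_smul]
    conv_rhs => rw [this]
    module
  rw [e, ← hf0] at h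
  have h2 := EReal.coe_le_coe_iff.1 h
  rw [← hza]
  refine EReal.coe_le_coe_iff.2 ?_
  rw [div_le_iff₀ hτ0]
  have h3 : τ / (1 + τ) * (φ z).toReal + 1 / (1 + τ) * M = (τ * (φ z).toReal + M) / (1 + τ) := by
    ring
  rw [h3, le_div_iff₀ (by positivity)] at h2
  linarith

theorem lowerSemicontinuous_add_coe {X : Type*} [TopologicalSpace X] {Φ : X → EReal} {c : X → ℝ}
    (hΦ : LowerSemicontinuous Φ) (hc : Continuous c) :
    LowerSemicontinuous fun x => Φ x + (c x : EReal) :=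
  hΦ.add' (continuous_coe_real_ereal.comp hc).lowerSemicontinuous fun _ =>
    EReal.continuousAt_add (Or.inr (EReal.coe_ne_bot _)) (Or.inr (EReal.coe_ne_top _))

namespace Problem

variable {n d₁ d₂ : ℕ} {P : Problem n d₁ d₂}

/-- Real values of `f + g` on `dom g`. -/
def phi (P : Problem n d₁ d₂) (x : Euc n) : ℝ := (P.f x + P.g x).toReal

namespace Standing

variable (hP : P.Standing)
include hP

theorem f_ne_top {x : Euc n} (hx : x ∈ dom P.g) : P.f x ≠ ⊤ := by
  obtain ⟨U, _, hU, hf, _⟩ := hP.f_diff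
  exact hf x (hU hx)

theorem coe_f {x : Euc n} (hx : x ∈ dom P.g) : ((P.f x).toReal : EReal) = P.f x :=
  EReal.coe_toReal (hP.f_ne_top hx) (hP.f_ne_bot x)

theorem coe_g {x : Euc n} (hx : x ∈ dom P.g) : ((P.g x).toReal : EReal) = P.g x :=
  EReal.coe_toReal hx (hP.g_ne_bot x)

theorem phi_eq {x : Euc n} (hx : x ∈ dom P.g) : P.phi x = (P.f x).toReal + (P.g x).toReal :=
  EReal.toReal_add (hP.f_ne_top hx) (hP.f_ne_bot x) hx (hP.g_ne_bot x)

theorem coe_phi {x : Euc n} (hx : x ∈ dom P.g) : ((P.phi x : ℝ) : EReal) = P.f x + P.g x := by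
  rw [hP.phi_eq hx, EReal.coe_add, hP.coe_f hx, hP.coe_g hx]

theorem f_add_g_of_notMem {x : Euc n} (hx : x ∉ dom P.g) : P.f x + P.g x = ⊤ := by
  have : P.g x = ⊤ := by simpa [dom] using hx
  rw [this, EReal.add_top_of_ne_bot (hP.f_ne_bot x)]

theorem convex_dom : Convex ℝ (dom P.g) := by
  intro x hx y hy s t hs ht hst
  have := hP.g_convex.le (hP.coe_g hx).ge (hP.coe_g hy).ge hs ht hst
  exact ne_top_of_le_ne_top (EReal.coe_ne_top _) this

theorem convexOn_phi : ConvexOn ℝ (dom P.g) P.phi := by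
  refine ⟨hP.convex_dom, fun x hx y hy s t hs ht hst => ?_⟩
  have hz := hP.convex_dom hx hy hs ht hst
  have h1 := hP.g_convex.le (hP.coe_g hx).ge (hP.coe_g hy).ge hs ht hst
  have h2 := hP.f_convex.le (hP.coe_f hx).ge (hP.coe_f hy).ge hs ht hst
  rw [← hP.coe_g hz, EReal.coe_le_coe_iff] at h1
  rw [← hP.coe_f hz, EReal.coe_le_coe_iff] at h2
  rw [hP.phi_eq hx, hP.phi_eq hy, hP.phi_eq hz]
  simp only [smul_eq_mul]
  linarith

/-- The defect of convexity of `p` is a recession direction of `h`. -/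
theorem recession (x y : Euc n) {α : ℝ} (h0 : 0 < α) (h1 : α < 1) {a : Dual d₁ d₂}
    (ha : a.snd ∈ P.𝒦) (k : ℕ) :
    (a - (k : ℝ) • (α • P.p x + (1 - α) • P.p y - P.p (α • x + (1 - α) • y))).snd ∈ P.𝒦 ∧
    P.h₁ (a - (k : ℝ) • (α • P.p x + (1 - α) • P.p y - P.p (α • x + (1 - α) • y))).fst
      ≤ P.h₁ a.fst := by
  induction k with
  | zero => simpa using ha
  | succ k ih =>
    set d := α • P.p x + (1 - α) • P.p y - P.p (α • x + (1 - α) • y) with hd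
    set b := a - (k : ℝ) • d with hb
    have e : a - ((k + 1 : ℕ) : ℝ) • d = b - d := by
      rw [hb]; push_cast; module
    rw [e]
    constructor
    -- The shifts are chosen so that both arguments of the hypothesis equal the block of `b`; its
    -- conclusion is then exactly about `b - d`.
    · have := hP.comp₂ x y (P.p₂ x - b.snd) (P.p₂ y - b.snd) α h0 h1
        (by rw [sub_sub_cancel]; exact ih.1) (by rw [sub_sub_cancel]; exact ih.1)
      convert this using 1
      change b.snd - (α • P.p₂ x + (1 - α) • P.p₂ y - P.p₂ (α • x + (1 - α) • y)) = _
      module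
    · have := hP.comp₁ x y (P.p₁ x - b.fst) (P.p₁ y - b.fst) α h0 h1
      rw [sub_sub_cancel, sub_sub_cancel] at this
      have e2 : (b - d).fst = P.p₁ (α • x + (1 - α) • y) - α • (P.p₁ x - b.fst)
          - (1 - α) • (P.p₁ y - b.fst) := by
        change b.fst - (α • P.p₁ x + (1 - α) • P.p₁ y - P.p₁ (α • x + (1 - α) • y)) = _
        module
      rw [e2]
      linarith [ih.2]

/-- Each `v` in the domain of h* must be nonnegative on the defect `d`. Otherwise ⟨v, a - k d⟩ tends
to infinity with `k` while `h(a - k d)` stays below `h(a)`, against Fenchel's inequality. So the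
composition hypotheses make ⟨v, p(·)⟩ convex, although `p` itself carries no order. -/
theorem inner_p_le {v : Dual d₁ d₂} (hv : v ∈ dom P.hStar) (x y : Euc n) {α : ℝ} (h0 : 0 < α)
    (h1 : α < 1) : ⟪v, P.p (α • x + (1 - α) • y)⟫ ≤ α * ⟪v, P.p x⟫ + (1 - α) * ⟪v, P.p y⟫ := by
  obtain ⟨a, ha⟩ := hP.exists_mem
  set d := α • P.p x + (1 - α) • P.p y - P.p (α • x + (1 - α) • y) with hd
  have key : 0 ≤ ⟪v, d⟫ := by
    by_contra hneg
    push Not at hneg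
    obtain ⟨k, hk⟩ := exists_nat_gt ((P.hsr v - ⟪v, a⟫ + P.h₁ a.fst) / (-⟪v, d⟫))
    obtain ⟨hm, hle⟩ := hP.recession x y h0 h1 ha k
    have := hP.fenchel hv hm
    rw [← hd] at this hle
    rw [inner_sub_right, inner_smul_right] at this
    rw [div_lt_iff₀ (by linarith)] at hk
    linarith
  rw [hd, inner_sub_right, inner_add_right, inner_smul_right, inner_smul_right] at key
  linarith

theorem convexOn_lagr {v : Dual d₁ d₂} (hv : v ∈ dom P.hStar) :
    ConvexOn ℝ (dom P.g) fun x => P.phi x + ⟪v, P.p x⟫ := by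
  refine hP.convexOn_phi.add (convexOn_iff_forall_pos.2 ⟨hP.convex_dom, ?_⟩)
  intro x _ y _ s t hs ht hst
  have ht' : t = 1 - s := by linarith
  subst ht'
  exact hP.inner_p_le hv x y hs (by linarith)

theorem continuous_p : Continuous P.p := by
  have := (WithLp.prod_continuous_toLp 2 (Euc d₁) (Euc d₂)).comp
    (hP.p₁_diff.continuous.prodMk hP.p₂_diff.continuous)
  exact this

theorem f_continuousAt {x : Euc n} (hx : x ∈ dom P.g) : ContinuousAt P.f x := by
  obtain ⟨U, hUo, hU, hf, hd⟩ := hP.f_diff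
  have h1 : ContinuousAt (fun x => (P.f x).toReal) x :=
    (hd.differentiableAt (hUo.mem_nhds (hU hx))).continuousAt
  have h2 : ContinuousAt (fun x => ((P.f x).toReal : EReal)) x :=
    continuous_coe_real_ereal.continuousAt.comp h1
  refine h2.congr ?_
  filter_upwards [hUo.mem_nhds (hU hx)] with z hz
  exact EReal.coe_toReal (hf z hz) (hP.f_ne_bot z)

/-- Outside dom g nothing says that `f` is closed. There `g` tends to infinity, and it suffices that
the convex `f`, being bounded above near a point of dom g, is locally bounded below. -/
theorem lowerSemicontinuous_f_add_g : LowerSemicontinuous fun x => P.f x + P.g x := by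
  intro x
  by_cases hx : x ∈ dom P.g
  · refine (hP.f_continuousAt hx).lowerSemicontinuousAt.add' (hP.g_closed x) ?_
    exact EReal.continuousAt_add (Or.inl (hP.f_ne_top hx)) (Or.inl (hP.f_ne_bot x))
  · intro y hy
    obtain ⟨x₀, hx₀⟩ := hP.g_dom
    have hev : ∀ᶠ z in nhds x₀, P.f z ≤ (((P.f x₀).toReal + 1 : ℝ) : EReal) := by
      have h1 : P.f x₀ < (((P.f x₀).toReal + 1 : ℝ) : EReal) := by
        conv_lhs => rw [← hP.coe_f hx₀]
        exact EReal.coe_lt_coe_iff.2 (by linarith)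
      exact ((hP.f_continuousAt hx₀).eventually (gt_mem_nhds h1)).mono fun _ h => h.le
    obtain ⟨c, hc⟩ := hP.f_convex.eventually_ge hP.f_ne_bot hev x
    have hy' : y < ⊤ := hy.trans_le le_top
    obtain ⟨r, hyr, _⟩ := EReal.lt_iff_exists_real_btwn.1 hy'
    have hg : ((r - c : ℝ) : EReal) < P.g x := by
      have : P.g x = ⊤ := by simpa [dom] using hx
      rw [this]; exact EReal.coe_lt_top _
    filter_upwards [hc, hP.g_closed x _ hg] with z h1 h2
    refine hyr.trans_le ?_
    calc (r : EReal) = ((c : ℝ) : EReal) + ((r - c : ℝ) : EReal) := by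
          rw [← EReal.coe_add]; congr 1; ring
      _ ≤ _ := add_le_add h1 h2.le

end Standing

/-- Real values of the inner objective on `dom g`. -/
def Hr (P : Problem n d₁ d₂) (I : Inner n d₁ d₂) (x : Euc n) : ℝ :=
  P.phi x + P.hsm (P.p x) I.l I.β + I.β / 2 * ‖x - I.y‖ ^ 2

namespace Standing

variable (hP : P.Standing)
include hP

theorem H_eq {I : Inner n d₁ d₂} (hβ : 0 < I.β) (x : Euc n) :
    P.H I x = (P.f x + P.g x)
      + ((P.hsm (P.p x) I.l I.β + I.β / 2 * ‖x - I.y‖ ^ 2 : ℝ) : EReal) := by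
  rw [H, hP.hSmooth_eq _ _ hβ, add_assoc, ← EReal.coe_add]

theorem H_coe {I : Inner n d₁ d₂} (hβ : 0 < I.β) {x : Euc n} (hx : x ∈ dom P.g) :
    P.H I x = ((P.Hr I x : ℝ) : EReal) := by
  rw [hP.H_eq hβ, ← hP.coe_phi hx, ← EReal.coe_add, Hr, add_assoc]

theorem H_of_notMem {I : Inner n d₁ d₂} (hβ : 0 < I.β) {x : Euc n} (hx : x ∉ dom P.g) :
    P.H I x = ⊤ := by
  rw [hP.H_eq hβ, hP.f_add_g_of_notMem hx, EReal.top_add_coe]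

theorem continuous_hsm_p (l : Dual d₁ d₂) {β : ℝ} (hβ : 0 < β) :
    Continuous fun x : Euc n => P.hsm (P.p x) l β := by
  have h := Continuous.comp (hP.continuous_hsm hβ) (hP.continuous_p.prodMk (continuous_const (y := l)))
  exact h

theorem lowerSemicontinuous_H {I : Inner n d₁ d₂} (hβ : 0 < I.β) :
    LowerSemicontinuous (P.H I) := by
  have e : P.H I = fun x => (P.f x + P.g x)
      + ((P.hsm (P.p x) I.l I.β + I.β / 2 * ‖x - I.y‖ ^ 2 : ℝ) : EReal) :=
    funext fun x => hP.H_eq hβ x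
  rw [e]
  have h2 : Continuous fun x : Euc n => I.β / 2 * ‖x - I.y‖ ^ 2 := by fun_prop
  have h3 := Continuous.add (hP.continuous_hsm_p I.l hβ) h2
  have h4 := lowerSemicontinuous_add_coe hP.lowerSemicontinuous_f_add_g h3
  exact h4

end Standing

end Problem
end IPALM

end

/-! ### The saddle operator, and exact inner solutions as its proximal points. -/

noncomputable section

namespace IPALM

/-- The primal-dual space `ℝⁿ × ℝ^(d₁+d₂)` with its Euclidean norm. -/
abbrev PD (n d₁ d₂ : ℕ) : Type := WithLp 2 (Euc n × Dual d₁ d₂)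

section PD

variable {n d₁ d₂ : ℕ}

theorem inner_pd (v w : PD n d₁ d₂) : ⟪v, w⟫ = ⟪v.fst, w.fst⟫ + ⟪v.snd, w.snd⟫ :=
  WithLp.prod_inner_apply v w

theorem norm_sq_pd (v : PD n d₁ d₂) : ‖v‖ ^ 2 = ‖v.fst‖ ^ 2 + ‖v.snd‖ ^ 2 :=
  WithLp.prod_norm_sq_eq_of_L2 v

theorem norm_snd_pd_le (v : PD n d₁ d₂) : ‖v.snd‖ ≤ ‖v‖ := by
  have := norm_sq_pd v
  exact abs_le_of_sq_le_sq' (by nlinarith [sq_nonneg ‖v.fst‖]) (norm_nonneg v) |>.2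

end PD

/-! ### Proximal steps of a monotone operator -/

section Hilbert

variable {W : Type*} [NormedAddCommGroup W] [InnerProductSpace ℝ W]

theorem prox_firm {w y z : W} {β : ℝ} (hβ : 0 < β) (h : 0 ≤ ⟪β • (w - y), y - z⟫) :
    ‖y - z‖ ^ 2 + ‖w - y‖ ^ 2 ≤ ‖w - z‖ ^ 2 := by
  rw [real_inner_smul_left] at h
  have h' : 0 ≤ ⟪w - y, y - z⟫ := nonneg_of_mul_nonneg_right h hβ
  rw [← sub_add_sub_cancel w y z, norm_add_sq_real]
  linarith

/-- The hypothesis says that the cross term in the expansion of ‖w - w'‖² along residuals and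
resolvents is nonnegative. -/
theorem prox_residual_nonexpansive {w y w' y' : W} {β : ℝ} (hβ : 0 < β)
    (h : 0 ≤ ⟪β • (w - y) - β • (w' - y'), y - y'⟫) :
    ‖(w - y) - (w' - y')‖ ≤ ‖w - w'‖ := by
  rw [← smul_sub, real_inner_smul_left] at h
  have h' : 0 ≤ ⟪(w - y) - (w' - y'), y - y'⟫ := nonneg_of_mul_nonneg_right h hβ
  have e : w - w' = ((w - y) - (w' - y')) + (y - y') := by abel
  have h2 : ‖w - w'‖ ^ 2 = ‖(w - y) - (w' - y')‖ ^ 2 + 2 * ⟪(w - y) - (w' - y'), y - y'⟫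
      + ‖y - y'‖ ^ 2 := by rw [e, norm_add_sq_real]
  exact abs_le_of_sq_le_sq' (by nlinarith [sq_nonneg ‖y - y'‖]) (norm_nonneg _) |>.2

/-- Two consecutive proximal steps with parameters `β` and `ρ β`: the residual of the second step
is at most `(1 + ρ)⁻¹` times the initial distance to a zero of the operator. -/
theorem prox_two_step {w y₁ y₂ z : W} {β ρ : ℝ} (hβ : 0 < β) (hρ : 0 < ρ)
    (h₁ : 0 ≤ ⟪(ρ * β) • (y₁ - y₂), y₂ - z⟫)
    (h₂ : 0 ≤ ⟪β • (w - y₁) - (ρ * β) • (y₁ - y₂), y₁ - y₂⟫) :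
    (1 + ρ) * ‖y₁ - y₂‖ ≤ ‖w - z‖ := by
  set v := y₁ - y₂ with hv
  rw [real_inner_smul_left] at h₁
  have h1 : 0 ≤ ⟪v, y₂ - z⟫ := nonneg_of_mul_nonneg_right h₁ (by positivity)
  rw [inner_sub_left, real_inner_smul_left, real_inner_smul_left, real_inner_self_eq_norm_sq] at h₂
  have h2 : ρ * ‖v‖ ^ 2 ≤ ⟪w - y₁, v⟫ := by
    by_contra hlt
    push Not at hlt
    nlinarith
  -- Paired with `v`, the three summands contribute at least ρ‖v‖², exactly ‖v‖², and at least 0.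
  have e : w - z = (w - y₁) + v + (y₂ - z) := by rw [hv]; abel
  have h3 : (1 + ρ) * ‖v‖ ^ 2 ≤ ⟪w - z, v⟫ := by
    rw [e, inner_add_left, inner_add_left, real_inner_self_eq_norm_sq, real_inner_comm v (y₂ - z)]
    linarith
  have h4 := real_inner_le_norm (w - z) v
  rcases eq_or_lt_of_le (norm_nonneg v) with h0 | h0
  · rw [← h0]; simp
  · nlinarith

end Hilbert

namespace Problem

variable {n d₁ d₂ : ℕ} {P : Problem n d₁ d₂}

/-- `γ` belongs to the value at `w = (x, λ)` of the saddle operator of the Lagrangian. -/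
structure SaddleGrad (P : Problem n d₁ d₂) (w γ : PD n d₁ d₂) : Prop where
  mem : w.fst ∈ dom P.g
  le : ∀ z ∈ dom P.g, P.phi w.fst + ⟪w.snd, P.p w.fst⟫ + ⟪γ.fst, z - w.fst⟫
    ≤ P.phi z + ⟪w.snd, P.p z⟫
  sub : P.IsSubgrad w.snd (P.p w.fst + γ.snd)

/-- Add the two Lagrangian inequalities, each tested at the other point, to the monotonicity of ∂h
at the points `p(x) + γ₂`. The terms ⟨λ, p(x)⟩ cancel. -/
theorem SaddleGrad.mono {w γ w' γ' : PD n d₁ d₂} (h : P.SaddleGrad w γ)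
    (h' : P.SaddleGrad w' γ') : 0 ≤ ⟪γ - γ', w - w'⟫ := by
  have h1 := h.le _ h'.mem
  have h2 := h'.le _ h.mem
  have h3 := h.sub.inner_nonneg h'.sub
  rw [inner_pd]
  change 0 ≤ ⟪γ.fst - γ'.fst, w.fst - w'.fst⟫ + ⟪γ.snd - γ'.snd, w.snd - w'.snd⟫
  have e1 : ⟪γ.fst - γ'.fst, w.fst - w'.fst⟫
      = -⟪γ.fst, w'.fst - w.fst⟫ - ⟪γ'.fst, w.fst - w'.fst⟫ := by
    simp only [inner_sub_left, inner_sub_right]; ring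
  have e2 : ⟪w.snd - w'.snd, P.p w.fst + γ.snd - (P.p w'.fst + γ'.snd)⟫
      = ⟪w.snd, P.p w.fst⟫ - ⟪w.snd, P.p w'.fst⟫ - ⟪w'.snd, P.p w.fst⟫ + ⟪w'.snd, P.p w'.fst⟫
        + ⟪γ.snd - γ'.snd, w.snd - w'.snd⟫ := by
    rw [show P.p w.fst + γ.snd - (P.p w'.fst + γ'.snd)
      = (P.p w.fst - P.p w'.fst) + (γ.snd - γ'.snd) by abel, inner_add_right,
      real_inner_comm (w.snd - w'.snd) (γ.snd - γ'.snd)]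
    simp only [inner_sub_left, inner_sub_right]; ring
  rw [e2] at h3
  rw [e1]
  linarith

namespace OptimalPair

variable {xs : Euc n} {ls : Dual d₁ d₂}

theorem lagr_le (ho : P.OptimalPair xs ls) (hP : P.Standing) {z : Euc n} (hz : z ∈ dom P.g) :
    P.phi xs + ⟪ls, P.p xs⟫ ≤ P.phi z + ⟪ls, P.p z⟫ := by
  have h : P.lagrangian xs ls ≤ P.lagrangian z ls := by
    rw [ho.strong_right]; exact iInf_le _ z
  rw [lagrangian, lagrangian, ← hP.coe_phi hz, ← hP.coe_phi ho.mem_dom_g,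
    ← hP.coe_hsr ho.mem_dom_hStar] at h
  have h' : P.phi xs + ⟪ls, P.p xs⟫ - P.hsr ls ≤ P.phi z + ⟪ls, P.p z⟫ - P.hsr ls := by
    exact_mod_cast h
  linarith

/-- F(x⋆) = L(x⋆; λ⋆) is equality in Fenchel's inequality at `p(x⋆)`, which makes λ⋆ a subgradient
of `h` there. -/
theorem hsr_eq (ho : P.OptimalPair xs ls) (hP : P.Standing) :
    P.hsr ls = ⟪ls, P.p xs⟫ - P.h₁ (P.p₁ xs) := by
  have h := ho.strong_left
  rw [F, lagrangian, ← hP.coe_phi ho.mem_dom_g, ← hP.coe_hsr ho.mem_dom_hStar] at h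
  have h' : P.phi xs + P.h₁ (P.p₁ xs) = P.phi xs + ⟪ls, P.p xs⟫ - P.hsr ls := by
    exact_mod_cast h
  linarith

theorem isSubgrad (ho : P.OptimalPair xs ls) (hP : P.Standing) : P.IsSubgrad ls (P.p xs) := by
  refine ⟨ho.feasible, fun u hu => ?_⟩
  have h1 := hP.fenchel ho.mem_dom_hStar hu
  rw [ho.hsr_eq hP] at h1
  rw [inner_sub_right]
  change P.h₁ (P.p₁ xs) + _ ≤ _
  linarith

theorem saddleGrad (ho : P.OptimalPair xs ls) (hP : P.Standing) :
    P.SaddleGrad (WithLp.toLp 2 (xs, ls)) 0 where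
  mem := ho.mem_dom_g
  le z hz := by
    have := ho.lagr_le hP hz
    change P.phi xs + ⟪ls, P.p xs⟫ + ⟪(0 : Euc n), z - xs⟫ ≤ P.phi z + ⟪ls, P.p z⟫
    rw [inner_zero_left, add_zero]
    exact this
  sub := by
    change P.IsSubgrad ls (P.p xs + 0)
    rw [add_zero]
    exact ho.isSubgrad hP

theorem optVal_eq (ho : P.OptimalPair xs ls) (hP : P.Standing) :
    P.optVal.toReal = P.phi xs + P.h₁ (P.p₁ xs) := by
  have h1 : P.optVal = P.primal xs :=
    le_antisymm (iInf_le _ xs) (le_iInf fun x => ho.primal_opt x)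
  rw [h1, primal, h_of_mem (u := P.p xs) ho.feasible, ← hP.coe_phi ho.mem_dom_g, ← EReal.coe_add,
    EReal.toReal_coe]
  rfl

end OptimalPair

/-- The exact solution of an inner problem, with its multiplier: a proximal point of the saddle
operator. -/
structure IsProx (P : Problem n d₁ d₂) (I : Inner n d₁ d₂) (y : PD n d₁ d₂) : Prop where
  grad : P.SaddleGrad y (I.β • (WithLp.toLp 2 (I.y, I.l) - y))
  isMin : IsMinOn (P.H I) univ y.fst
  snd_eq : y.snd = P.Lam (P.p y.fst) I.l I.β

/-- Coercivity comes from the dual solution. Using λ⋆ in the maximum that defines the smoothing, and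
then minimality of x⋆ for L(·; λ⋆), bounds the objective below by `m` plus the proximal term. A
minimizer over a large ball is therefore global. -/
theorem Standing.exists_isMinOn_H (hP : P.Standing) {xs : Euc n} {ls : Dual d₁ d₂}
    (ho : P.OptimalPair xs ls) (I : Inner n d₁ d₂) (hβ : 0 < I.β) :
    ∃ x ∈ dom P.g, IsMinOn (P.H I) univ x := by
  set m := P.phi xs + ⟪ls, P.p xs⟫ - P.hsr ls - I.β / 2 * ‖ls - I.l‖ ^ 2 with hm
  have hlow : ∀ z ∈ dom P.g, m + I.β / 2 * ‖z - I.y‖ ^ 2 ≤ P.Hr I z := by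
    intro z hz
    have h1 := ho.lagr_le hP hz
    have h2 := hP.hsm_ge (P.p z) I.l hβ ho.mem_dom_hStar
    rw [Hr]; linarith
  set A := |P.Hr I xs - m|
  -- The ball contains x⋆; outside it the proximal term already exceeds the value at x⋆ minus the
  -- lower bound `m`.
  set R := max ‖xs - I.y‖ (1 + 2 * A / I.β)
  have hA : 0 ≤ A := abs_nonneg _
  have hxs : xs ∈ Metric.closedBall I.y R := by
    rw [Metric.mem_closedBall, dist_eq_norm]
    exact le_max_left _ _
  obtain ⟨x, hxR, hx⟩ := (hP.lowerSemicontinuous_H hβ).lowerSemicontinuousOn _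
    |>.exists_isMinOn (s := Metric.closedBall I.y R)
      ⟨xs, hxs⟩ (isCompact_closedBall _ _)
  have hle : P.H I x ≤ P.H I xs := hx hxs
  have hmem : x ∈ dom P.g := by
    by_contra hn
    rw [hP.H_of_notMem hβ hn, hP.H_coe hβ ho.mem_dom_g, top_le_iff] at hle
    exact EReal.coe_ne_top _ hle
  refine ⟨x, hmem, fun z _ => ?_⟩
  change P.H I x ≤ P.H I z
  by_cases hz : z ∈ Metric.closedBall I.y R
  · exact hx hz
  by_cases hzd : z ∈ dom P.g
  · refine hle.trans ?_
    rw [hP.H_coe hβ ho.mem_dom_g, hP.H_coe hβ hzd, EReal.coe_le_coe_iff]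
    have hzR : R < ‖z - I.y‖ := by simpa [dist_eq_norm] using hz
    have h1 : 1 + 2 * A / I.β < ‖z - I.y‖ := (le_max_right _ _).trans_lt hzR
    have h2 : 0 ≤ 2 * A / I.β := by positivity
    have h3 : 2 * A / I.β ≤ ‖z - I.y‖ ^ 2 := by nlinarith
    have h4 : A ≤ I.β / 2 * ‖z - I.y‖ ^ 2 := by
      rw [div_le_iff₀ hβ] at h3; linarith
    have h5 := hlow z hzd
    have h6 : P.Hr I xs - m ≤ A := le_abs_self _
    linarith
  · rw [hP.H_of_notMem hβ hzd]; exact le_top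

/-- An envelope argument without differentiating the smoothing. Along the segment `c t` from `x` to
`z`, the maximizer `V t` at `c t` gives the exact objective there and a lower bound at `x`.
Convexity of the Lagrangian at the fixed multiplier `V t`, division by `t` and continuity of `Lam`
give the inclusion as `t` tends to 0. -/
theorem Standing.isProx_of_isMinOn (hP : P.Standing) (I : Inner n d₁ d₂) (hβ : 0 < I.β)
    {x : Euc n} (hx : x ∈ dom P.g) (hmin : IsMinOn (P.H I) univ x) :
    P.IsProx I (WithLp.toLp 2 (x, P.Lam (P.p x) I.l I.β)) := by
  set v := P.Lam (P.p x) I.l I.β with hv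
  refine ⟨⟨hx, fun z hz => ?_, ?_⟩, hmin, rfl⟩
  · change P.phi x + ⟪v, P.p x⟫ + ⟪I.β • (I.y - x), z - x⟫ ≤ P.phi z + ⟪v, P.p z⟫
    set c : ℝ → Euc n := fun t => t • z + (1 - t) • x with hc
    set V : ℝ → Dual d₁ d₂ := fun t => P.Lam (P.p (c t)) I.l I.β with hV
    have hcc : Continuous c := by fun_prop
    have hVc : Continuous V := by
      have h := Continuous.comp (hP.continuous_lam hβ)
        ((hP.continuous_p.comp hcc).prodMk (continuous_const (y := I.l)))
      exact h
    have hV0 : V 0 = v := by simp [hV, hc, hv]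
    have key : ∀ t : ℝ, 0 < t → t < 1 →
        0 ≤ P.phi z + ⟪V t, P.p z⟫ - (P.phi x + ⟪V t, P.p x⟫) + I.β * ⟪x - I.y, z - x⟫
          + t * (I.β / 2 * ‖z - x‖ ^ 2) := by
      intro t ht0 ht1
      have hct : c t ∈ dom P.g := hP.convex_dom hz hx ht0.le (by linarith) (by ring)
      have h1 : P.Hr I x ≤ P.Hr I (c t) := by
        have : P.H I x ≤ P.H I (c t) := hmin (mem_univ (c t))
        rwa [hP.H_coe hβ hx, hP.H_coe hβ hct, EReal.coe_le_coe_iff] at this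
      have hdV : V t ∈ dom P.hStar := (hP.lam_spec (P.p (c t)) I.l hβ).mem_dom
      -- `V t` is admissible, though possibly not optimal, in the maximum at `x`.
      have h2 := hP.hsm_ge (P.p x) I.l hβ hdV
      have h3 : P.hsm (P.p (c t)) I.l I.β
          = ⟪V t, P.p (c t)⟫ - P.hsr (V t) - I.β / 2 * ‖V t - I.l‖ ^ 2 := rfl
      have h4 := (hP.convexOn_lagr hdV).2 hz hx ht0.le (by linarith : (0 : ℝ) ≤ 1 - t) (by ring)
      simp only [smul_eq_mul] at h4
      change P.phi (c t) + ⟪V t, P.p (c t)⟫ ≤ _ at h4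
      have h5 : ‖c t - I.y‖ ^ 2
          = ‖x - I.y‖ ^ 2 + 2 * t * ⟪x - I.y, z - x⟫ + t ^ 2 * ‖z - x‖ ^ 2 := by
        rw [show c t - I.y = (x - I.y) + t • (z - x) by simp only [hc]; module, norm_add_sq_real,
          inner_smul_right, norm_smul, mul_pow, Real.norm_eq_abs, sq_abs]
        ring
      rw [Hr, Hr, h3, h5] at h1
      have h6 : 0 ≤ t * (P.phi z + ⟪V t, P.p z⟫ - (P.phi x + ⟪V t, P.p x⟫)
          + I.β * ⟪x - I.y, z - x⟫ + t * (I.β / 2 * ‖z - x‖ ^ 2)) := by nlinarith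
      exact nonneg_of_mul_nonneg_right h6 ht0
    have hlim : Filter.Tendsto (fun t : ℝ =>
        P.phi z + ⟪V t, P.p z⟫ - (P.phi x + ⟪V t, P.p x⟫) + I.β * ⟪x - I.y, z - x⟫
          + t * (I.β / 2 * ‖z - x‖ ^ 2)) (nhdsWithin 0 (Ioi 0))
        (nhds (P.phi z + ⟪V 0, P.p z⟫ - (P.phi x + ⟪V 0, P.p x⟫) + I.β * ⟪x - I.y, z - x⟫
          + 0 * (I.β / 2 * ‖z - x‖ ^ 2))) := by
      apply Filter.Tendsto.mono_left _ nhdsWithin_le_nhds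
      apply Continuous.tendsto (f := fun t : ℝ =>
        P.phi z + ⟪V t, P.p z⟫ - (P.phi x + ⟪V t, P.p x⟫) + I.β * ⟪x - I.y, z - x⟫
          + t * (I.β / 2 * ‖z - x‖ ^ 2))
      fun_prop
    have hge := ge_of_tendsto hlim (by
      filter_upwards [Ioo_mem_nhdsGT (zero_lt_one' ℝ)] with t ht
      exact key t ht.1 ht.2)
    rw [hV0] at hge
    have e : ⟪I.β • (I.y - x), z - x⟫ = -(I.β * ⟪x - I.y, z - x⟫) := by
      rw [real_inner_smul_left, ← neg_sub x I.y, inner_neg_left, mul_neg]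
    rw [e]; linarith
  · change P.IsSubgrad v (P.p x + I.β • (I.l - v))
    have h := hP.lam_spec (P.p x) I.l hβ
    rw [← hv] at h
    convert h using 1
    module

theorem Standing.exists_isProx (hP : P.Standing) {xs : Euc n} {ls : Dual d₁ d₂}
    (ho : P.OptimalPair xs ls) (I : Inner n d₁ d₂) (hβ : 0 < I.β) : ∃ y, P.IsProx I y := by
  obtain ⟨x, hx, hmin⟩ := hP.exists_isMinOn_H ho I hβ
  exact ⟨_, hP.isProx_of_isMinOn I hβ hx hmin⟩

namespace IsProx

variable {I : Inner n d₁ d₂} {y : PD n d₁ d₂}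

theorem HStar_eq (h : P.IsProx I y) (hP : P.Standing) (hβ : 0 < I.β) :
    P.HStar I = ((P.Hr I y.fst : ℝ) : EReal) := by
  rw [← hP.H_coe hβ h.grad.mem]
  exact le_antisymm (iInf_le _ _) (le_iInf fun x => h.isMin (mem_univ x))

/-- Quadratic growth of the inner objective, in the primal and the dual variable. -/
theorem growth (h : P.IsProx I y) (hP : P.Standing) (hβ : 0 < I.β) {z : Euc n}
    (hz : z ∈ dom P.g) :
    P.Hr I y.fst + I.β / 2 * (‖z - y.fst‖ ^ 2 + ‖P.Lam (P.p z) I.l I.β - y.snd‖ ^ 2)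
      ≤ P.Hr I z := by
  have h1 := h.grad.le z hz
  have hd : y.snd ∈ dom P.hStar := h.grad.sub.mem_dom
  have h2 := hP.hsm_growth (P.p z) I.l hβ hd
  have h3 : P.hsm (P.p y.fst) I.l I.β
      = ⟪y.snd, P.p y.fst⟫ - P.hsr y.snd - I.β / 2 * ‖y.snd - I.l‖ ^ 2 := by
    rw [hsm, ← h.snd_eq]
  change P.phi y.fst + ⟪y.snd, P.p y.fst⟫ + ⟪I.β • (I.y - y.fst), z - y.fst⟫ ≤ _ at h1
  rw [real_inner_smul_left] at h1
  have h4 : ‖z - I.y‖ ^ 2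
      = ‖y.fst - I.y‖ ^ 2 - 2 * ⟪I.y - y.fst, z - y.fst⟫ + ‖z - y.fst‖ ^ 2 := by
    rw [show z - I.y = (y.fst - I.y) + (z - y.fst) by abel, norm_add_sq_real,
      ← neg_sub I.y y.fst, inner_neg_left, norm_neg]
    ring
  rw [norm_sub_rev (P.Lam (P.p z) I.l I.β)]
  rw [Hr, Hr, h3, h4]
  nlinarith

end IsProx

end Problem
end IPALM

end

/-! ### Deterministic estimates for one outer step. -/

noncomputable section

namespace IPALM

theorem norm_sub_sq_le_two {W : Type*} [NormedAddCommGroup W] [InnerProductSpace ℝ W] (a b c : W) :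
    ‖a - b‖ ^ 2 ≤ 2 * ‖a - c‖ ^ 2 + 2 * ‖b - c‖ ^ 2 := by
  have h := parallelogram_law_with_norm ℝ (a - c) (b - c)
  rw [sub_sub_sub_cancel_right] at h
  nlinarith [sq_nonneg ‖a - c + (b - c)‖]

namespace Problem

variable {n d₁ d₂ : ℕ} {P : Problem n d₁ d₂}

namespace IsProx

variable {I : Inner n d₁ d₂} {y : PD n d₁ d₂}

theorem gap_eq (h : P.IsProx I y) (hP : P.Standing) (hβ : 0 < I.β) {x : Euc n}
    (hx : x ∈ dom P.g) : P.gap I x = ENNReal.ofReal (P.Hr I x - P.Hr I y.fst) := by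
  rw [gap, h.HStar_eq hP hβ, hP.H_coe hβ hx, ← EReal.coe_sub, EReal.toENNReal_of_ne_top
    (EReal.coe_ne_top _), EReal.toReal_coe]

theorem gap_of_notMem (h : P.IsProx I y) (hP : P.Standing) (hβ : 0 < I.β) {x : Euc n}
    (hx : x ∉ dom P.g) : P.gap I x = ⊤ := by
  rw [gap, h.HStar_eq hP hβ, hP.H_of_notMem hβ hx, EReal.top_sub_coe, EReal.toENNReal_top]

theorem mem_of_gap_ne_top (h : P.IsProx I y) (hP : P.Standing) (hβ : 0 < I.β) {x : Euc n}
    (hx : P.gap I x ≠ ⊤) : x ∈ dom P.g := by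
  by_contra hn
  exact hx (h.gap_of_notMem hP hβ hn)

theorem toReal_gap (h : P.IsProx I y) (hP : P.Standing) (hβ : 0 < I.β) {x : Euc n}
    (hx : x ∈ dom P.g) : (P.gap I x).toReal = P.Hr I x - P.Hr I y.fst := by
  rw [h.gap_eq hP hβ hx, ENNReal.toReal_ofReal]
  have := h.growth hP hβ hx
  have : 0 ≤ I.β / 2 * (‖x - y.fst‖ ^ 2 + ‖P.Lam (P.p x) I.l I.β - y.snd‖ ^ 2) := by positivity
  linarith

/-- An inexact solution of the inner problem is an inexact proximal point. -/
theorem norm_sub_le (h : P.IsProx I y) (hP : P.Standing) (hβ : 0 < I.β) {x : Euc n}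
    (hx : x ∈ dom P.g) : ‖WithLp.toLp 2 (x, P.Lam (P.p x) I.l I.β) - y‖
      ≤ √(2 * (P.gap I x).toReal / I.β) := by
  have h1 := h.growth hP hβ hx
  refine Real.le_sqrt_of_sq_le ?_
  rw [h.toReal_gap hP hβ hx, norm_sq_pd, le_div_iff₀ hβ]
  change (‖x - y.fst‖ ^ 2 + ‖P.Lam (P.p x) I.l I.β - y.snd‖ ^ 2) * I.β ≤ _
  linarith

end IsProx

theorem IsSubgrad.inner_snd_le {v w : Dual d₁ d₂} (hs : P.IsSubgrad v w) {k : Euc d₂}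
    (hk : k ∈ P.𝒦) : ⟪v.snd, k - w.snd⟫ ≤ 0 := by
  have h1 := hs.le (WithLp.toLp 2 (w.fst, k)) hk
  rw [inner_dual] at h1
  change P.h₁ w.fst + (⟪v.fst, w.fst - w.fst⟫ + ⟪v.snd, k - w.snd⟫) ≤ P.h₁ w.fst at h1
  rw [sub_self, inner_zero_right] at h1
  linarith

namespace Standing

variable (hP : P.Standing)
include hP

/-- The second blocks of the two multipliers are normals to 𝒦, and normals form a cone. Hence `β v₂`
and `β' v₂'` are still normals and monotonicity applies in spite of the different weights. For the
first block this scaling fails, and the Lipschitz bound on subgradients replaces it. -/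
theorem norm_residual_snd_le (u l l' : Dual d₁ d₂) {β β' : ℝ} (hβ : 0 < β) (hβ' : 0 < β') :
    ‖(β' • (P.Lam u l' β' - l') - β • (P.Lam u l β - l)).snd‖ ≤ ‖β • l.snd - β' • l'.snd‖ := by
  have hs := hP.lam_spec u l hβ
  have hs' := hP.lam_spec u l' hβ'
  set v := P.Lam u l β
  set v' := P.Lam u l' β'
  have h1 := hs.inner_snd_le hs'.mem
  have h2 := hs'.inner_snd_le hs.mem
  set e := (β' • (v' - l') - β • (v - l)).snd with he
  have e1 : (u - β' • (v' - l')).snd - (u - β • (v - l)).snd = -e := by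
    change (u.snd - β' • (v'.snd - l'.snd)) - (u.snd - β • (v.snd - l.snd))
      = -(β' • (v'.snd - l'.snd) - β • (v.snd - l.snd))
    abel
  have e2 : (u - β • (v - l)).snd - (u - β' • (v' - l')).snd = e := by
    rw [← neg_sub, e1, neg_neg]
  rw [e1, inner_neg_right] at h1
  rw [e2] at h2
  have h3 : 0 ≤ ⟪β • v.snd - β' • v'.snd, e⟫ := by
    rw [inner_sub_left, real_inner_smul_left, real_inner_smul_left]
    nlinarith
  have e3 : β • v.snd - β' • v'.snd = (β • l.snd - β' • l'.snd) - e := by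
    rw [he]
    change _ = _ - (β' • (v'.snd - l'.snd) - β • (v.snd - l.snd))
    module
  rw [e3, inner_sub_left, real_inner_self_eq_norm_sq] at h3
  have h4 := real_inner_le_norm (β • l.snd - β' • l'.snd) e
  rcases eq_or_lt_of_le (norm_nonneg e) with h0 | h0
  · rw [← h0]; positivity
  · nlinarith

theorem norm_residual_fst_le (u l l' : Dual d₁ d₂) {β β' : ℝ} (hβ : 0 < β) (hβ' : 0 < β') :
    ‖(β' • (P.Lam u l' β' - l') - β • (P.Lam u l β - l)).fst‖
      ≤ (β + β') * P.Lh₁ + ‖β • l.fst - β' • l'.fst‖ := by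
  have hs := (hP.lam_spec u l hβ).norm_fst_le hP
  have hs' := (hP.lam_spec u l' hβ').norm_fst_le hP
  set v := P.Lam u l β
  set v' := P.Lam u l' β'
  have e : (β' • (v' - l') - β • (v - l)).fst
      = (β' • v'.fst - β • v.fst) + (β • l.fst - β' • l'.fst) := by
    change β' • (v'.fst - l'.fst) - β • (v.fst - l.fst) = _
    module
  rw [e]
  refine (norm_add_le _ _).trans (add_le_add_left ?_ _)
  refine (norm_sub_le _ _).trans ?_
  rw [norm_smul, norm_smul, Real.norm_of_nonneg hβ.le, Real.norm_of_nonneg hβ'.le]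
  nlinarith

theorem norm_residual_le (u l l' : Dual d₁ d₂) {β β' : ℝ} (hβ : 0 < β) (hβ' : 0 < β') :
    ‖β' • (P.Lam u l' β' - l') - β • (P.Lam u l β - l)‖
      ≤ √(((β + β') * P.Lh₁ + ‖β • l.fst - β' • l'.fst‖) ^ 2
        + ‖β • l.snd - β' • l'.snd‖ ^ 2) := by
  refine Real.le_sqrt_of_sq_le ?_
  rw [norm_sq_dual]
  have h1 := hP.norm_residual_fst_le u l l' hβ hβ'
  have h2 := hP.norm_residual_snd_le u l l' hβ hβ'
  gcongr

/-- Comparison of the smoothed functions for two sets of parameters. -/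
theorem hsm_sub_le (u l l' : Dual d₁ d₂) {β β' : ℝ} (hβ' : 0 < β') (hββ : β' ≤ β) :
    P.hsm u l β - P.hsm u l' β'
      ≤ ‖l' - l‖ * √(((β + β') * P.Lh₁ + ‖β • l.fst - β' • l'.fst‖) ^ 2
        + ‖β • l.snd - β' • l'.snd‖ ^ 2) + β / 4 * ‖P.Lam u l β - l'‖ ^ 2 := by
  have hβ : 0 < β := hβ'.trans_le hββ
  have h1 := hP.hsm_growth u l' hβ' (hP.lam_spec u l hβ).mem_dom
  have h2 := hP.norm_residual_le u l l' hβ hβ'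
  rw [hsm]
  set v := P.Lam u l β
  set v' := P.Lam u l' β'
  set S := √(((β + β') * P.Lh₁ + ‖β • l.fst - β' • l'.fst‖) ^ 2
        + ‖β • l.snd - β' • l'.snd‖ ^ 2)
  set a := v - l with ha
  set a' := v' - l' with ha'
  have e1 : ‖v - l'‖ ^ 2 = ‖v - v'‖ ^ 2 + 2 * ⟪v - v', a'⟫ + ‖a'‖ ^ 2 := by
    rw [ha', ← norm_add_sq_real, sub_add_sub_cancel]
  have e2 : ⟪v - v', a'⟫ = ⟪a, a'⟫ - ‖a'‖ ^ 2 + ⟪l - l', a'⟫ := by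
    rw [show v - v' = a - a' + (l - l') by rw [ha, ha']; abel, inner_add_left, inner_sub_left,
      real_inner_self_eq_norm_sq]
  -- Replacing `β' a'` by `β a` costs the difference of residuals, which the square root in `M_s`
  -- bounds.
  have e3 : β' * ⟪l - l', a'⟫ = ⟪l - l', β' • a' - β • a⟫ + β * ⟪l - l', a⟫ := by
    rw [inner_sub_right (l - l') (β' • a'), inner_smul_right, inner_smul_right]; ring
  have e4 : ⟪l - l', a⟫ = ⟪l - l', v - l'⟫ - ‖l' - l‖ ^ 2 := by
    rw [show a = (v - l') - (l - l') by rw [ha]; abel, inner_sub_right,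
      real_inner_self_eq_norm_sq, norm_sub_rev l' l]
  have h3 : ⟪l - l', β' • a' - β • a⟫ ≤ ‖l' - l‖ * S := by
    refine (real_inner_le_norm _ _).trans ?_
    rw [norm_sub_rev l l']
    exact mul_le_mul_of_nonneg_left h2 (norm_nonneg _)
  -- The Young weights make the first term cancel against `-‖l' - l‖ ^ 2` in `e4`, leaving only a
  -- quarter of ‖v - l'‖².
  have h4 : ⟪l - l', v - l'⟫ ≤ ‖l' - l‖ ^ 2 + ‖v - l'‖ ^ 2 / 4 := by
    have := real_inner_le_norm (l - l') (v - l')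
    rw [norm_sub_rev l l'] at this
    nlinarith [sq_nonneg (‖l' - l‖ - ‖v - l'‖ / 2)]
  have h5 : β' * ⟪a, a'⟫ ≤ β' / 2 * ‖a'‖ ^ 2 + β / 2 * ‖a‖ ^ 2 := by
    have h6 := real_inner_le_norm a a'
    have h7 : ⟪a, a'⟫ ≤ ‖a‖ ^ 2 / 2 + ‖a'‖ ^ 2 / 2 := by
      nlinarith [sq_nonneg (‖a‖ - ‖a'‖)]
    have h8 : β' * ⟪a, a'⟫ ≤ β' * (‖a‖ ^ 2 / 2 + ‖a'‖ ^ 2 / 2) :=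
      mul_le_mul_of_nonneg_left h7 hβ'.le
    have h9 : β' * ‖a‖ ^ 2 ≤ β * ‖a‖ ^ 2 := mul_le_mul_of_nonneg_right hββ (sq_nonneg _)
    linarith
  have h10 : β * ⟪l - l', a⟫ ≤ β / 4 * ‖v - l'‖ ^ 2 := by
    rw [e4]
    have := mul_le_mul_of_nonneg_left h4 hβ.le
    linarith
  have h11 : β' / 2 * ‖v - l'‖ ^ 2 - β' / 2 * ‖v - v'‖ ^ 2
      = β' * ⟪a, a'⟫ - β' / 2 * ‖a'‖ ^ 2 + β' * ⟪l - l', a'⟫ := by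
    rw [e1, e2]; ring
  rw [e3] at h11
  linarith

/-- The maximizer of the new smoothing is a competitor in the old one. Its quadratic growth around
the old maximizer `l'` leaves only the coefficient (β - β')/2 on ‖v - l'‖². -/
theorem hsm_next_le (u l : Dual d₁ d₂) {β β' : ℝ} (hβ : 0 < β) (hβ' : 0 < β') :
    P.hsm u (P.Lam u l β) β' - P.hsm u l β ≤ β * ‖P.Lam u l β - l‖ ^ 2
      + (β - β') / 2 * ‖P.Lam u (P.Lam u l β) β' - P.Lam u l β‖ ^ 2 := by
  set l' := P.Lam u l β with hl'
  have h1 := hP.hsm_growth u l hβ (hP.lam_spec u l' hβ').mem_dom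
  rw [← hl'] at h1
  rw [hsm]
  set v := P.Lam u l' β'
  have h2 : ‖v - l‖ ^ 2 ≤ 2 * ‖v - l'‖ ^ 2 + 2 * ‖l' - l‖ ^ 2 := by
    have := norm_sub_sq_le_two v l l'
    rwa [norm_sub_rev l l'] at this
  have h3 := mul_le_mul_of_nonneg_left h2 hβ.le
  linarith

theorem norm_lam_next_le (u l : Dual d₁ d₂) {β β' : ℝ} (hβ : 0 < β) (hβ' : 0 < β') :
    β' * ‖P.Lam u (P.Lam u l β) β' - P.Lam u l β‖ ≤ β * ‖P.Lam u l β - l‖ := by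
  set l' := P.Lam u l β with hl'
  have h := (hP.lam_spec u l' hβ').inner_nonneg (hP.lam_spec u l hβ)
  rw [← hl'] at h
  set v := P.Lam u l' β'
  rw [sub_sub_sub_cancel_left, inner_sub_right, inner_smul_right, inner_smul_right,
    real_inner_self_eq_norm_sq] at h
  have h1 := real_inner_le_norm (v - l') (l' - l)
  rcases eq_or_lt_of_le (norm_nonneg (v - l')) with h0 | h0
  · rw [← h0]; simp; positivity
  · have : β * ⟪v - l', l' - l⟫ ≤ β * (‖v - l'‖ * ‖l' - l‖) :=
      mul_le_mul_of_nonneg_left h1 hβ.le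
    have h2 : ‖v - l'‖ * (β' * ‖v - l'‖) ≤ ‖v - l'‖ * (β * ‖l' - l‖) := by linarith
    exact le_of_mul_le_mul_left h2 h0

end Standing

/-- The optimality gap of a point for the next inner problem. -/
theorem IsProx.gap_next_le {I : Inner n d₁ d₂} {y y' : PD n d₁ d₂} {x : Euc n} {β' : ℝ}
    (h : P.IsProx I y) (hP : P.Standing) (hβ' : 0 < β') (hββ : β' ≤ I.β) (hβ2 : I.β < 2 * β')
    (hx : x ∈ dom P.g)
    (h' : P.IsProx ⟨x, P.Lam (P.p x) I.l I.β, β'⟩ y') :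
    (P.gap ⟨x, P.Lam (P.p x) I.l I.β, β'⟩ x).toReal
      ≤ 2 * (P.gap I x).toReal
        + Mterm P I.β β' I.y x I.l (P.Lam (P.p x) I.l I.β) := by
  have hβ : 0 < I.β := hβ'.trans_le hββ
  rw [h'.toReal_gap hP hβ' hx, h.toReal_gap hP hβ hx]
  set l' := P.Lam (P.p x) I.l I.β with hl'
  set z := y'.fst with hz
  have ha := hP.hsm_next_le (P.p x) I.l hβ hβ'
  rw [← hl'] at ha
  have hgz := h.growth hP hβ h'.grad.mem
  have hgx := h.growth hP hβ hx
  rw [← hl'] at hgx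
  rw [← hz] at hgz
  have hd := hP.hsm_sub_le (P.p z) I.l l' hβ' hββ
  set v := P.Lam (P.p z) I.l I.β
  -- Growth of the old objective at both `z` and `x`, with the parallelogram law, gives H(x) - H(z)
  -- ≤ 2 gap - β/4 (‖z - x‖² + ‖v - l'‖²). This explains the factor 2: the second negative term
  -- absorbs the excess in `hd`, the first is used in `he`.
  have hq1 := norm_sub_sq_le_two z x y.fst
  have hq2 := norm_sub_sq_le_two v l' y.snd
  have hx1 : P.Hr ⟨x, l', β'⟩ x = P.phi x + P.hsm (P.p x) l' β' := by
    simp [Hr]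
  have hx2 : P.Hr I x = P.phi x + P.hsm (P.p x) I.l I.β + I.β / 2 * ‖x - I.y‖ ^ 2 := rfl
  have hz1 : P.Hr ⟨x, l', β'⟩ z = P.phi z + P.hsm (P.p z) l' β' + β' / 2 * ‖z - x‖ ^ 2 := rfl
  have hz2 : P.Hr I z = P.phi z + P.hsm (P.p z) I.l I.β + I.β / 2 * ‖z - I.y‖ ^ 2 := rfl
  -- Moving the proximal centre from `I.y` to `x` leaves the coefficient (2β' - β)/4 on ‖z - x‖² to
  -- absorb the cross term. Its positivity is the condition ρ > 1/2.
  have he : -(I.β ^ 2 / (2 * β' - I.β) * ‖I.y - x‖ ^ 2) - I.β / 2 * ‖x - I.y‖ ^ 2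
      ≤ (β' / 2 + I.β / 4) * ‖z - x‖ ^ 2 - I.β / 2 * ‖z - I.y‖ ^ 2 := by
    have hδ : 0 < 2 * β' - I.β := by linarith
    have e1 : ‖z - I.y‖ ^ 2 = ‖z - x‖ ^ 2 + 2 * ⟪z - x, x - I.y⟫ + ‖x - I.y‖ ^ 2 := by
      rw [← norm_add_sq_real, sub_add_sub_cancel]
    have h1 := real_inner_le_norm (z - x) (x - I.y)
    have h2 : I.β * (‖z - x‖ * ‖x - I.y‖)
        ≤ (2 * β' - I.β) / 4 * ‖z - x‖ ^ 2 + I.β ^ 2 / (2 * β' - I.β) * ‖x - I.y‖ ^ 2 := by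
      have h3 : 0 ≤ ((2 * β' - I.β) / 2 * ‖z - x‖ - I.β * ‖x - I.y‖) ^ 2 / (2 * β' - I.β) := by
        positivity
      have h4 : ((2 * β' - I.β) / 2 * ‖z - x‖ - I.β * ‖x - I.y‖) ^ 2 / (2 * β' - I.β)
          = (2 * β' - I.β) / 4 * ‖z - x‖ ^ 2 - I.β * (‖z - x‖ * ‖x - I.y‖)
            + I.β ^ 2 / (2 * β' - I.β) * ‖x - I.y‖ ^ 2 := by
        field_simp
        ring
      linarith
    have h5 := mul_le_mul_of_nonneg_left h1 hβ.le
    rw [norm_sub_rev I.y x, e1]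
    linarith
  have hM : Mterm P I.β β' I.y x I.l l' = I.β * ‖l' - I.l‖ ^ 2
    + (I.β - β') / 2 * ‖P.Lam (P.p x) l' β' - l'‖ ^ 2
    + I.β ^ 2 / (2 * β' - I.β) * ‖I.y - x‖ ^ 2
    + ‖l' - I.l‖ * √(((I.β + β') * P.Lh₁ + ‖I.β • I.l.fst - β' • l'.fst‖) ^ 2
        + ‖I.β • I.l.snd - β' • l'.snd‖ ^ 2) := rfl
  rw [hM]
  have hq1' := mul_le_mul_of_nonneg_left hq1 hβ.le
  have hq2' := mul_le_mul_of_nonneg_left hq2 hβ.le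
  linarith

theorem Mterm_nonneg {b b' : ℝ} (hb : 0 ≤ b) (hbb : b' ≤ b) (h2 : b < 2 * b') (x₀ x : Euc n)
    (l l' : Dual d₁ d₂) : 0 ≤ Mterm P b b' x₀ x l l' := by
  have h1 : 0 ≤ b - b' := by linarith
  have h3 : 0 ≤ 2 * b' - b := by linarith
  unfold Mterm
  positivity

/-- Bound on `M_s` by the squared step and the multipliers. -/
theorem Standing.Mterm_le (hP : P.Standing) {b ρ : ℝ} (hb : 0 < b) (hρ : 1 / 2 < ρ) (hρ1 : ρ < 1)
    (x₀ x : Euc n) (l : Dual d₁ d₂) :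
    Mterm P b (b * ρ) x₀ x l (P.Lam (P.p x) l b) ≤
      b * ((2 + (ρ ^ 2)⁻¹ + (2 * ρ - 1)⁻¹) * (‖x - x₀‖ ^ 2 + ‖P.Lam (P.p x) l b - l‖ ^ 2)
        + 6 * P.Lh₁ ^ 2 + 2 * ‖l‖ ^ 2 + 2 * ‖P.Lam (P.p x) l b‖ ^ 2) := by
  have hρ0 : 0 < ρ := by linarith
  have h1 := hP.norm_lam_next_le (P.p x) l hb (mul_pos hb hρ0)
  set l' := P.Lam (P.p x) l b
  set v := P.Lam (P.p x) l' (b * ρ)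
  have hv : ρ * ‖v - l'‖ ≤ ‖l' - l‖ := by
    rw [mul_assoc] at h1
    exact le_of_mul_le_mul_left h1 hb
  have hv2 : ‖v - l'‖ ^ 2 ≤ (ρ ^ 2)⁻¹ * ‖l' - l‖ ^ 2 := by
    rw [inv_mul_eq_div, le_div_iff₀ (by positivity)]
    have := mul_self_le_mul_self (by positivity) hv
    nlinarith
  have hσ : 0 < 2 * ρ - 1 := by linarith
  set L : ℝ := (P.Lh₁ : ℝ)
  have hL : 0 ≤ L := P.Lh₁.2
  have hr : √(((b + b * ρ) * L + ‖b • l.fst - (b * ρ) • l'.fst‖) ^ 2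
        + ‖b • l.snd - (b * ρ) • l'.snd‖ ^ 2) ≤ b * (2 * L + ‖l‖ + ‖l'‖) := by
    have e : b • l - (b * ρ) • l' = b • (l - ρ • l') := by module
    have hq : ‖b • l.fst - (b * ρ) • l'.fst‖ ^ 2 + ‖b • l.snd - (b * ρ) • l'.snd‖ ^ 2
        = ‖b • l - (b * ρ) • l'‖ ^ 2 := (norm_sq_dual (b • l - (b * ρ) • l')).symm
    have hN : ‖b • l - (b * ρ) • l'‖ ≤ b * (‖l‖ + ‖l'‖) := by
      rw [e, norm_smul, Real.norm_of_nonneg hb.le]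
      refine mul_le_mul_of_nonneg_left ((norm_sub_le _ _).trans ?_) hb.le
      rw [norm_smul, Real.norm_of_nonneg hρ0.le]
      nlinarith [norm_nonneg l']
    have hfst : ‖b • l.fst - (b * ρ) • l'.fst‖ ≤ ‖b • l - (b * ρ) • l'‖ :=
      norm_fst_dual_le (b • l - (b * ρ) • l')
    refine Real.sqrt_le_iff.2 ⟨by positivity, ?_⟩
    set N := ‖b • l - (b * ρ) • l'‖
    have hN0 : 0 ≤ N := norm_nonneg _
    have h2 : ((b + b * ρ) * L + ‖b • l.fst - (b * ρ) • l'.fst‖) ^ 2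
        + ‖b • l.snd - (b * ρ) • l'.snd‖ ^ 2 ≤ ((b + b * ρ) * L + N) ^ 2 := by
      have : (b + b * ρ) * L * ‖b • l.fst - (b * ρ) • l'.fst‖ ≤ (b + b * ρ) * L * N :=
        mul_le_mul_of_nonneg_left hfst (by positivity)
      nlinarith
    refine h2.trans (pow_le_pow_left₀ (by positivity) ?_ 2)
    have : b * ρ * L ≤ b * 1 * L := by gcongr
    nlinarith
  have h4 : ‖l' - l‖ * √(((b + b * ρ) * L + ‖b • l.fst - (b * ρ) • l'.fst‖) ^ 2
        + ‖b • l.snd - (b * ρ) • l'.snd‖ ^ 2)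
      ≤ b * (‖l' - l‖ ^ 2 + 6 * L ^ 2 + 2 * ‖l‖ ^ 2 + 2 * ‖l'‖ ^ 2) := by
    refine (mul_le_mul_of_nonneg_left hr (norm_nonneg _)).trans ?_
    have h5 : ‖l' - l‖ * (2 * L + ‖l‖ + ‖l'‖)
        ≤ ‖l' - l‖ ^ 2 + 6 * L ^ 2 + 2 * ‖l‖ ^ 2 + 2 * ‖l'‖ ^ 2 := by
      nlinarith [sq_nonneg (‖l' - l‖ - (2 * L + ‖l‖ + ‖l'‖) / 2), sq_nonneg (2 * L - ‖l‖),
        sq_nonneg (2 * L - ‖l'‖), sq_nonneg (‖l‖ - ‖l'‖), sq_nonneg ‖l‖, sq_nonneg ‖l'‖]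
    calc ‖l' - l‖ * (b * (2 * L + ‖l‖ + ‖l'‖)) = b * (‖l' - l‖ * (2 * L + ‖l‖ + ‖l'‖)) := by ring
      _ ≤ _ := mul_le_mul_of_nonneg_left h5 hb.le
  have h6 : (b - b * ρ) / 2 * ‖v - l'‖ ^ 2 ≤ b * ((ρ ^ 2)⁻¹ * ‖l' - l‖ ^ 2) := by
    have h7 : (b - b * ρ) / 2 ≤ b := by nlinarith
    calc _ ≤ b * ‖v - l'‖ ^ 2 := mul_le_mul_of_nonneg_right h7 (sq_nonneg _)
      _ ≤ _ := mul_le_mul_of_nonneg_left hv2 hb.le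
  have h8 : b ^ 2 / (2 * (b * ρ) - b) * ‖x₀ - x‖ ^ 2 = b * ((2 * ρ - 1)⁻¹ * ‖x - x₀‖ ^ 2) := by
    rw [norm_sub_rev x₀ x, show 2 * (b * ρ) - b = b * (2 * ρ - 1) by ring]
    field_simp
  have hM : Mterm P b (b * ρ) x₀ x l l' = b * ‖l' - l‖ ^ 2
    + (b - b * ρ) / 2 * ‖v - l'‖ ^ 2
    + b ^ 2 / (2 * (b * ρ) - b) * ‖x₀ - x‖ ^ 2
    + ‖l' - l‖ * √(((b + b * ρ) * L + ‖b • l.fst - (b * ρ) • l'.fst‖) ^ 2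
        + ‖b • l.snd - (b * ρ) • l'.snd‖ ^ 2) := rfl
  rw [hM, h8]
  have h9 : 0 ≤ b * ((2 + (ρ ^ 2)⁻¹) * ‖x - x₀‖ ^ 2) := by positivity
  have h10 : 0 ≤ b * ((2 * ρ - 1)⁻¹ * ‖l' - l‖ ^ 2) := by positivity
  nlinarith

/-! ### Primal optimality and feasibility of a step -/

theorem Standing.F_eq (hP : P.Standing) {x : Euc n} (hx : x ∈ dom P.g) :
    P.F x = ((P.phi x + P.h₁ (P.p₁ x) : ℝ) : EReal) := by
  rw [F, ← hP.coe_phi hx, EReal.coe_add]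

/-- The point `p(x) - β(λ⁺ - λ)`, where the new multiplier is a subgradient of `h`, has its second
block in 𝒦. -/
theorem Standing.infDist_le (hP : P.Standing) (x : Euc n) (l : Dual d₁ d₂) {β : ℝ} (hβ : 0 < β) :
    Metric.infDist (P.p₂ x) P.𝒦 ≤ β * ‖P.Lam (P.p x) l β - l‖ := by
  have hs := hP.lam_spec (P.p x) l hβ
  refine (Metric.infDist_le_dist_of_mem hs.mem).trans ?_
  rw [dist_eq_norm]
  have e : P.p₂ x - (P.p x - β • (P.Lam (P.p x) l β - l)).snd
      = β • (P.Lam (P.p x) l β - l).snd := by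
    change P.p₂ x - (P.p₂ x - β • (P.Lam (P.p x) l β - l).snd) = _
    abel
  rw [e, norm_smul, Real.norm_of_nonneg hβ.le]
  exact mul_le_mul_of_nonneg_left (norm_snd_dual_le _) hβ.le

namespace OptimalPair

variable {xs : Euc n} {ls : Dual d₁ d₂}

/-- λ⋆ is a subgradient of `h` at `p(x⋆)`; test it at `p(x)` with the second block replaced by the
nearby feasible point `k`, and use that x⋆ minimizes L(·; λ⋆). -/
theorem value_ge (ho : P.OptimalPair xs ls) (hP : P.Standing) {x : Euc n} (hx : x ∈ dom P.g)
    (l : Dual d₁ d₂) {β : ℝ} (hβ : 0 < β) :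
    -(‖ls.snd‖ * (β * ‖P.Lam (P.p x) l β - l‖)) ≤ (P.F x).toReal - P.optVal.toReal := by
  rw [hP.F_eq hx, EReal.toReal_coe, ho.optVal_eq hP]
  have hs := hP.lam_spec (P.p x) l hβ
  have h1 := ho.lagr_le hP hx
  set k := (P.p x - β • (P.Lam (P.p x) l β - l)).snd with hk
  have h2 := (ho.isSubgrad hP).le (WithLp.toLp 2 (P.p₁ x, k)) hs.mem
  change P.h₁ (P.p₁ xs) + _ ≤ P.h₁ (P.p₁ x) at h2
  rw [inner_sub_right] at h2
  have e1 : ⟪ls, WithLp.toLp 2 (P.p₁ x, k)⟫ = ⟪ls.fst, P.p₁ x⟫ + ⟪ls.snd, k⟫ := inner_dual _ _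
  have e2 : ⟪ls, P.p x⟫ = ⟪ls.fst, P.p₁ x⟫ + ⟪ls.snd, P.p₂ x⟫ := inner_dual _ _
  have e3 : P.p₂ x - k = β • (P.Lam (P.p x) l β - l).snd := by
    change P.p₂ x - (P.p₂ x - β • (P.Lam (P.p x) l β - l).snd) = _
    abel
  have h3 : ⟪ls.snd, P.p₂ x - k⟫ ≤ ‖ls.snd‖ * (β * ‖P.Lam (P.p x) l β - l‖) := by
    refine (real_inner_le_norm _ _).trans (mul_le_mul_of_nonneg_left ?_ (norm_nonneg _))
    rw [e3, norm_smul, Real.norm_of_nonneg hβ.le]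
    exact mul_le_mul_of_nonneg_left (norm_snd_dual_le _) hβ.le
  rw [inner_sub_right] at h3
  rw [e1] at h2
  rw [e2] at h1
  linarith

/-- Compare with x⋆, where feasibility puts the smoothing below `h₁`. Returning from the smoothed
value to `h₁(p₁(x))` costs a Lipschitz term, and `h10` converts the difference of squared multiplier
norms into distances to λ⋆. -/
theorem value_le (ho : P.OptimalPair xs ls) (hP : P.Standing) {I : Inner n d₁ d₂} (hβ : 0 < I.β)
    {x : Euc n} (hx : x ∈ dom P.g) :
    (P.F x).toReal - P.optVal.toReal ≤ (P.gap I x).toReal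
      + I.β * (1 / 2 * (‖I.y - xs‖ ^ 2 + ‖I.l - ls‖ ^ 2)
        + 1 / 2 * ‖P.Lam (P.p x) I.l I.β - I.l‖ ^ 2 + ‖ls‖ ^ 2 + P.Lh₁ ^ 2) := by
  obtain ⟨y, hy⟩ := hP.exists_isProx ho I hβ
  rw [hP.F_eq hx, EReal.toReal_coe, ho.optVal_eq hP, hy.toReal_gap hP hβ hx]
  have h1 := hy.growth hP hβ ho.mem_dom_g
  have h2 := hP.hsm_le (u := P.p xs) ho.feasible I.l hβ
  change _ ≤ P.h₁ (P.p₁ xs) at h2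
  have h3 := hP.hsm_eq (P.p x) I.l hβ
  set l' := P.Lam (P.p x) I.l I.β
  have h4 : P.h₁ (P.p₁ x) ≤ P.h₁ (P.p x - I.β • (l' - I.l)).fst + I.β * (P.Lh₁ * ‖l' - I.l‖) := by
    have h5 := hP.h₁_lipschitz.dist_le_mul (P.p₁ x) (P.p x - I.β • (l' - I.l)).fst
    have e : P.p₁ x - (P.p x - I.β • (l' - I.l)).fst = I.β • (l' - I.l).fst := by
      change P.p₁ x - (P.p₁ x - I.β • (l' - I.l).fst) = _
      abel
    rw [Real.dist_eq, dist_eq_norm, e, norm_smul, Real.norm_of_nonneg hβ.le] at h5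
    have h6 := (abs_le.1 h5).2
    have h7 : (P.Lh₁ : ℝ) * (I.β * ‖(l' - I.l).fst‖) ≤ P.Lh₁ * (I.β * ‖l' - I.l‖) :=
      mul_le_mul_of_nonneg_left (mul_le_mul_of_nonneg_left (norm_fst_dual_le _) hβ.le) P.Lh₁.2
    linarith
  have e1 : ‖I.l‖ ^ 2 - ‖l'‖ ^ 2 = -(2 * ⟪l' - I.l, I.l - ls⟫) - 2 * ⟪l' - I.l, ls⟫
      - ‖l' - I.l‖ ^ 2 := by
    have : ‖l'‖ ^ 2 = ‖l' - I.l‖ ^ 2 + 2 * ⟪l' - I.l, I.l⟫ + ‖I.l‖ ^ 2 := by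
      rw [← norm_add_sq_real, sub_add_cancel]
    rw [this, inner_sub_right]; ring
  have h8 := abs_le.1 (abs_real_inner_le_norm (l' - I.l) (I.l - ls)) |>.1
  have h9 := abs_le.1 (abs_real_inner_le_norm (l' - I.l) ls) |>.1
  set D := ‖l' - I.l‖
  set L : ℝ := (P.Lh₁ : ℝ)
  have h10 : 1 / 2 * ‖I.l‖ ^ 2 - 1 / 2 * ‖l'‖ ^ 2 + L * D
      ≤ 1 / 2 * ‖I.l - ls‖ ^ 2 + 1 / 2 * D ^ 2 + ‖ls‖ ^ 2 + L ^ 2 := by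
    nlinarith [sq_nonneg (D - ‖I.l - ls‖), sq_nonneg (D - ‖ls‖ - L), sq_nonneg (‖ls‖ - L)]
  have h11 := mul_le_mul_of_nonneg_left h10 hβ.le
  have h12 : 0 ≤ I.β / 2 * (‖xs - y.fst‖ ^ 2 + ‖P.Lam (P.p xs) I.l I.β - y.snd‖ ^ 2) := by
    positivity
  have h13 : 0 ≤ I.β / 2 * ‖x - I.y‖ ^ 2 := by positivity
  have hx2 : P.Hr I x = P.phi x + P.hsm (P.p x) I.l I.β + I.β / 2 * ‖x - I.y‖ ^ 2 := rfl
  have hxs2 : P.Hr I xs = P.phi xs + P.hsm (P.p xs) I.l I.β + I.β / 2 * ‖xs - I.y‖ ^ 2 := rfl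
  rw [norm_sub_rev I.y xs]
  linarith

end OptimalPair

end Problem
end IPALM

end

/-! ### Conditional laws, L² bounds, and measurability of the inner gap. -/

noncomputable section

namespace IPALM

/-! ### Conditional laws -/

section Freezing

/-- On a countably generated space, two families of probability measures that agree almost surely
on every measurable set agree almost surely. -/
theorem ae_measure_eq {Ω E : Type*} [MeasurableSpace Ω] [MeasurableSpace E]
    [MeasurableSpace.CountablyGenerated E] {μ : Measure Ω} {κ ν : Ω → Measure E}
    [∀ ω, IsProbabilityMeasure (κ ω)] [∀ ω, IsProbabilityMeasure (ν ω)]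
    (h : ∀ B, MeasurableSet B → ∀ᵐ ω ∂μ, κ ω B = ν ω B) : ∀ᵐ ω ∂μ, κ ω = ν ω := by
  set S := MeasurableSpace.countableGeneratingSet E
  have hS : S.Countable := MeasurableSpace.countable_countableGeneratingSet
  have hgen : MeasurableSpace.generateFrom S = ‹MeasurableSpace E› :=
    MeasurableSpace.generateFrom_countableGeneratingSet
  set D : Set (Set (Set E)) := {t | t.Finite ∧ t ⊆ S}
  have hD : D.Countable := Set.countable_ofPred_finite_subset hS
  set C : Set (Set E) := (fun t : Set (Set E) => ⋂₀ t) '' D with hCdef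
  have hC : C.Countable := hD.image _
  have hSm : ∀ s ∈ S, MeasurableSet s := fun s hs =>
    MeasurableSpace.measurableSet_countableGeneratingSet hs
  have hCm : ∀ B ∈ C, MeasurableSet B := by
    rintro _ ⟨t, ⟨htf, hts⟩, rfl⟩
    exact MeasurableSet.sInter htf.countable fun s hs => hSm s (hts hs)
  have hpi : IsPiSystem C := by
    rintro _ ⟨t, ⟨htf, hts⟩, rfl⟩ _ ⟨t', ⟨htf', hts'⟩, rfl⟩ _
    refine ⟨t ∪ t', ⟨htf.union htf', union_subset hts hts'⟩, ?_⟩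
    exact sInter_union t t'
  have hgenC : ‹MeasurableSpace E› = MeasurableSpace.generateFrom C := by
    apply le_antisymm
    · rw [← hgen]
      refine MeasurableSpace.generateFrom_mono fun s hs => ?_
      exact ⟨{s}, ⟨finite_singleton s, by simpa using hs⟩, sInter_singleton s⟩
    · exact MeasurableSpace.generateFrom_le hCm
  have hall : ∀ᵐ ω ∂μ, ∀ B ∈ C, κ ω B = ν ω B :=
    (ae_ball_iff hC).2 fun B hB => h B (hCm B hB)
  filter_upwards [hall] with ω hω
  exact ext_of_generate_finite C hgenC hpi hω (by simp)

/-- If `ν` is the conditional law of `X` given `T`, then integrals of functions of `(T, X)` can be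
computed by first integrating with respect to `ν`. -/
theorem lintegral_eq_of_condLaw {Ω B E : Type*} [mΩ : MeasurableSpace Ω] [mB : MeasurableSpace B]
    [MeasurableSpace E] [StandardBorelSpace E] [Nonempty E] {μ : Measure Ω}
    [IsProbabilityMeasure μ] {T : Ω → B} {X : Ω → E} (hT : Measurable T) (hX : Measurable X)
    {ν : Ω → ProbabilityMeasure E}
    (hν : ∀ S, MeasurableSet S →
      μ⟦X ⁻¹' S | mB.comap T⟧ =ᵐ[μ] fun ω => (ν ω : Measure E).real S)
    {G : B × E → ℝ≥0∞} (hG : Measurable G) :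
    ∫⁻ ω, G (T ω, X ω) ∂μ = ∫⁻ ω, ∫⁻ z, G (T ω, z) ∂(ν ω : Measure E) ∂μ := by
  -- The family `ν` is not assumed measurable; it is replaced by a genuine kernel that agrees with
  -- it almost surely.
  set κ := condDistrib X T μ with hκ
  have hae : ∀ᵐ ω ∂μ, κ (T ω) = (ν ω : Measure E) := by
    refine ae_measure_eq fun S hS => ?_
    filter_upwards [hν S hS, condDistrib_ae_eq_condExp (μ := μ) hT hX hS] with ω h1 h2
    rw [← h2] at h1
    simp only [measureReal_def] at h1
    exact (ENNReal.toReal_eq_toReal_iff' (measure_ne_top _ _) (measure_ne_top _ _)).1 h1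
  calc ∫⁻ ω, G (T ω, X ω) ∂μ = ∫⁻ z, G z ∂(μ.map fun ω => (T ω, X ω)) :=
        (lintegral_map hG (hT.prodMk hX)).symm
    _ = ∫⁻ z, G z ∂((μ.map T) ⊗ₘ κ) := by rw [hκ, compProd_map_condDistrib hX.aemeasurable]
    _ = ∫⁻ b, ∫⁻ z, G (b, z) ∂(κ b) ∂(μ.map T) := Measure.lintegral_compProd hG
    _ = ∫⁻ ω, ∫⁻ z, G (T ω, z) ∂(κ (T ω)) ∂μ := lintegral_map (hG.lintegral_kernel_prod_right') hT
    _ = _ := lintegral_congr_ae (by filter_upwards [hae] with ω h; rw [h])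

end Freezing

/-! ### Square-integrable bounds -/

/-- `f` is measurable, with `L²` norm at most `c`. -/
structure L2Le {Ω : Type*} [MeasurableSpace Ω] (μ : Measure Ω) (f : Ω → ℝ) (c : ℝ) : Prop where
  aesm : AEStronglyMeasurable f μ
  le : eLpNorm f 2 μ ≤ ENNReal.ofReal c

namespace L2Le

variable {Ω : Type*} [MeasurableSpace Ω] {μ : Measure Ω} {f g : Ω → ℝ} {c d : ℝ}

theorem _root_.IPALM.eLpNorm_two_sq (μ : Measure Ω) (f : Ω → ℝ) :
    eLpNorm f 2 μ ^ 2 = ∫⁻ ω, ENNReal.ofReal (f ω ^ 2) ∂μ := by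
  have h := eLpNorm_nnreal_pow_eq_lintegral (μ := μ) (f := f) (p := 2) two_ne_zero
  simp only [NNReal.coe_ofNat, ENNReal.coe_ofNat, ENNReal.rpow_ofNat] at h
  rw [h]
  refine lintegral_congr fun ω => ?_
  rw [← ofReal_norm, ← ENNReal.ofReal_pow (norm_nonneg _), Real.norm_eq_abs, sq_abs]

theorem add (hf : L2Le μ f c) (hg : L2Le μ g d) (hc : 0 ≤ c) (hd : 0 ≤ d) :
    L2Le μ (fun ω => f ω + g ω) (c + d) := by
  refine ⟨hf.aesm.add hg.aesm, ?_⟩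
  rw [ENNReal.ofReal_add hc hd]
  exact (eLpNorm_add_le hf.aesm hg.aesm one_le_two).trans (add_le_add hf.le hg.le)

theorem mono (hf : L2Le μ f c) (hg : AEStronglyMeasurable g μ) (h : ∀ᵐ ω ∂μ, |g ω| ≤ f ω)
    (hcd : c ≤ d) : L2Le μ g d := by
  refine ⟨hg, (eLpNorm_mono_ae ?_).trans (hf.le.trans (ENNReal.ofReal_le_ofReal hcd))⟩
  filter_upwards [h] with ω hω
  rw [Real.norm_eq_abs, Real.norm_eq_abs]
  exact hω.trans (le_abs_self _)

theorem of_lintegral (hf : AEStronglyMeasurable f μ) (hc : 0 ≤ c)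
    (h : ∫⁻ ω, ENNReal.ofReal (f ω ^ 2) ∂μ ≤ ENNReal.ofReal (c ^ 2)) : L2Le μ f c := by
  refine ⟨hf, ?_⟩
  rw [← eLpNorm_two_sq, ENNReal.ofReal_pow hc] at h
  exact (ENNReal.pow_le_pow_left_iff two_ne_zero).1 h

theorem memLp (hf : L2Le μ f c) : MemLp f 2 μ :=
  ⟨hf.aesm, hf.le.trans_lt ENNReal.ofReal_lt_top⟩

theorem integrable_sq (hf : L2Le μ f c) : Integrable (fun ω => f ω ^ 2) μ :=
  hf.memLp.integrable_sq

theorem integral_sq_le (hf : L2Le μ f c) (hc : 0 ≤ c) : ∫ ω, f ω ^ 2 ∂μ ≤ c ^ 2 := by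
  rw [integral_eq_lintegral_of_nonneg_ae (Filter.Eventually.of_forall fun ω => sq_nonneg _)
    hf.integrable_sq.aestronglyMeasurable]
  refine ENNReal.toReal_le_of_le_ofReal (sq_nonneg c) ?_
  rw [← eLpNorm_two_sq, ENNReal.ofReal_pow hc]
  exact pow_le_pow_left' hf.le 2

variable [IsProbabilityMeasure μ]

theorem const (c : ℝ) : L2Le μ (fun _ => c) |c| := by
  refine ⟨aestronglyMeasurable_const, ?_⟩
  rw [eLpNorm_const c two_ne_zero (IsProbabilityMeasure.ne_zero μ), measure_univ, ENNReal.one_rpow,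
    mul_one, ← ofReal_norm, Real.norm_eq_abs]

theorem integrable (hf : L2Le μ f c) : Integrable f μ := hf.memLp.integrable one_le_two

theorem integral_le (hf : L2Le μ f c) (hc : 0 ≤ c) : ∫ ω, f ω ∂μ ≤ c := by
  -- Nonnegativity of the variance gives (E f)² ≤ E f².
  have h1 := variance_eq_sub hf.memLp
  have h0 := variance_nonneg f μ
  have h2 := hf.integral_sq_le hc
  rw [h1] at h0
  change 0 ≤ (∫ ω, f ω ^ 2 ∂μ) - (∫ ω, f ω ∂μ) ^ 2 at h0
  exact abs_le_of_sq_le_sq' (by linarith) hc |>.2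

end L2Le

namespace Problem

variable {n d₁ d₂ : ℕ} {P : Problem n d₁ d₂}

theorem Standing.measurable_H (hP : P.Standing) {β : ℝ} (hβ : 0 < β) :
    Measurable fun a : (Euc n × Dual d₁ d₂) × Euc n => P.H ⟨a.1.1, a.1.2, β⟩ a.2 := by
  have e : (fun a : (Euc n × Dual d₁ d₂) × Euc n => P.H ⟨a.1.1, a.1.2, β⟩ a.2)
      = fun a => (P.f a.2 + P.g a.2)
        + ((P.hsm (P.p a.2) a.1.2 β + β / 2 * ‖a.2 - a.1.1‖ ^ 2 : ℝ) : EReal) :=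
    funext fun a => hP.H_eq (I := ⟨a.1.1, a.1.2, β⟩) hβ a.2
  rw [e]
  have h1 : Measurable fun x => P.f x + P.g x := hP.lowerSemicontinuous_f_add_g.measurable
  have h2 : Measurable fun a : (Euc n × Dual d₁ d₂) × Euc n => P.hsm (P.p a.2) a.1.2 β := by
    have h3 : Measurable fun a : (Euc n × Dual d₁ d₂) × Euc n => (P.p a.2, a.1.2) :=
      (hP.continuous_p.measurable.comp measurable_snd).prodMk (measurable_snd.comp measurable_fst)
    have h4 := Measurable.comp (hP.continuous_hsm hβ).measurable h3
    exact h4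
  have h5 : Measurable fun a : (Euc n × Dual d₁ d₂) × Euc n => β / 2 * ‖a.2 - a.1.1‖ ^ 2 := by
    fun_prop
  have h6 := Measurable.add (h1.comp measurable_snd) (h2.add h5).coe_real_ereal
  exact h6

/-- An uncountable infimum, but each function in it is continuous in the parameters (or constantly
`⊤` off dom g), so the infimum is upper semicontinuous. -/
theorem Standing.measurable_HStar (hP : P.Standing) {β : ℝ} (hβ : 0 < β) :
    Measurable fun a : Euc n × Dual d₁ d₂ => P.HStar ⟨a.1, a.2, β⟩ := by
  have husc : UpperSemicontinuous fun a : Euc n × Dual d₁ d₂ => P.HStar ⟨a.1, a.2, β⟩ := by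
    refine upperSemicontinuous_iInf fun x => ?_
    by_cases hx : x ∈ dom P.g
    · have e : (fun a : Euc n × Dual d₁ d₂ => P.H ⟨a.1, a.2, β⟩ x)
          = fun a => ((P.phi x + P.hsm (P.p x) a.2 β + β / 2 * ‖x - a.1‖ ^ 2 : ℝ) : EReal) :=
        funext fun a => hP.H_coe (I := ⟨a.1, a.2, β⟩) hβ hx
      rw [e]
      have h1 : Continuous fun a : Euc n × Dual d₁ d₂ => P.hsm (P.p x) a.2 β := by
        have h3 : Continuous fun a : Euc n × Dual d₁ d₂ => (P.p x, a.2) := by fun_prop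
        have h4 := Continuous.comp (hP.continuous_hsm hβ) h3
        exact h4
      have h2 : Continuous fun a : Euc n × Dual d₁ d₂ => β / 2 * ‖x - a.1‖ ^ 2 := by fun_prop
      have h5 := Continuous.comp continuous_coe_real_ereal
        (Continuous.add (Continuous.add (continuous_const (y := P.phi x)) h1) h2)
      exact h5.upperSemicontinuous
    · have e : (fun a : Euc n × Dual d₁ d₂ => P.H ⟨a.1, a.2, β⟩ x) = fun _ => ⊤ :=
        funext fun a => hP.H_of_notMem (I := ⟨a.1, a.2, β⟩) hβ hx
      rw [e]
      exact upperSemicontinuous_const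
  exact husc.measurable

theorem Standing.measurable_gap (hP : P.Standing) {xs : Euc n} {ls : Dual d₁ d₂}
    (ho : P.OptimalPair xs ls) {β : ℝ} (hβ : 0 < β) :
    Measurable fun a : (Euc n × Dual d₁ d₂) × Euc n => P.gap ⟨a.1.1, a.1.2, β⟩ a.2 := by
  have e : (fun a : (Euc n × Dual d₁ d₂) × Euc n => P.gap ⟨a.1.1, a.1.2, β⟩ a.2)
      = fun a => (P.H ⟨a.1.1, a.1.2, β⟩ a.2
        + ((-(P.HStar ⟨a.1.1, a.1.2, β⟩).toReal : ℝ) : EReal)).toENNReal := by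
    funext a
    obtain ⟨y, hy⟩ := hP.exists_isProx ho ⟨a.1.1, a.1.2, β⟩ hβ
    rw [gap, hy.HStar_eq hP hβ, EReal.toReal_coe, EReal.coe_neg, sub_eq_add_neg]
  rw [e]
  have h1 : Measurable fun a : (Euc n × Dual d₁ d₂) × Euc n => P.HStar ⟨a.1.1, a.1.2, β⟩ := by
    have h := Measurable.comp (hP.measurable_HStar hβ)
      (measurable_fst : Measurable (Prod.fst : (Euc n × Dual d₁ d₂) × Euc n → _))
    exact h
  have h2 := Measurable.add (hP.measurable_H hβ) h1.ereal_toReal.neg.coe_real_ereal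
  exact h2.ereal_toENNReal

end Problem

end IPALM

end

/-! ### Expected inner gaps along the run. -/

noncomputable section

namespace IPALM

variable {n d₁ d₂ : ℕ} {P : Problem n d₁ d₂}

namespace Params.Valid

variable {q : Params n d₁ d₂} (hq : q.Valid P)
include hq

theorem ρ_pos : 0 < q.ρ := by linarith [hq.ρ_gt]

theorem β_pos (s : ℕ) : 0 < q.β s := mul_pos hq.β₀_pos (pow_pos hq.ρ_pos s)

theorem ε_pos (s : ℕ) : 0 < q.ε s := mul_pos hq.ε₀_pos (pow_pos hq.η_pos s)

theorem β_succ_le (s : ℕ) : q.β (s + 1) ≤ q.β s :=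
  mul_le_mul_of_nonneg_left (pow_le_pow_of_le_one hq.ρ_pos.le hq.ρ_lt.le (Nat.le_succ s))
    hq.β₀_pos.le

theorem β_lt_two_mul (s : ℕ) : q.β s < 2 * q.β (s + 1) := by
  have h := hq.β_pos s
  have e : q.β (s + 1) = q.β s * q.ρ := by rw [Params.β, Params.β]; ring
  rw [e]; nlinarith [hq.ρ_gt]

end Params.Valid

theorem Params.β_succ (q : Params n d₁ d₂) (s : ℕ) : q.β (s + 1) = q.β s * q.ρ := by
  rw [Params.β, Params.β]; ring

section Past

variable {Ω : Type*} [mΩ : MeasurableSpace Ω] {x : ℕ → Ω → Euc n} {l : ℕ → Ω → Dual d₁ d₂}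

theorem past_le (hx : ∀ s, Measurable (x s)) (hl : ∀ s, Measurable (l s)) (s : ℕ) :
    past x l s ≤ mΩ :=
  iSup₂_le fun t _ => sup_le (hx t).comap_le (hl t).comap_le

omit mΩ in
theorem measurable_past_x {s t : ℕ} (h : t < s) : Measurable[past x l s] (x t) := by
  rw [measurable_iff_comap_le]
  exact le_sup_left.trans (le_iSup₂_of_le (f := fun t (_ : t ∈ Finset.range s) =>
    (MeasurableSpace.comap (x t) inferInstance ⊔ MeasurableSpace.comap (l t) inferInstance))
    t (Finset.mem_range.2 h) le_rfl)

omit mΩ in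
theorem measurable_past_l {s t : ℕ} (h : t < s) : Measurable[past x l s] (l t) := by
  rw [measurable_iff_comap_le]
  exact le_sup_right.trans (le_iSup₂_of_le (f := fun t (_ : t ∈ Finset.range s) =>
    (MeasurableSpace.comap (x t) inferInstance ⊔ MeasurableSpace.comap (l t) inferInstance))
    t (Finset.mem_range.2 h) le_rfl)

end Past

/-- The iteration count depends on the random `M`, so the contraction factor cannot be averaged
separately from the gap. The pathwise bound 2g + M ≤ (g/e + 1)(2e + M) removes `M` and leaves
something affine in `g`, whose mean is at most `e'` once E g ≤ e. -/
theorem inv_two_pow_mul_gap_le {j : ℕ} {g g' : ℝ≥0∞} {e e' M : ℝ} (he : 0 < e) (he' : 0 < e')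
    (hM : 0 ≤ M) (hj : 2 * e + M ≤ 2 ^ j * (e' / 2))
    (hg : g ≠ ⊤ → g' ≤ 2 * g + ENNReal.ofReal M) :
    (2⁻¹ : ℝ≥0∞) ^ j * g' ≤ ENNReal.ofReal (e' / 2) * (g * (ENNReal.ofReal e)⁻¹ + 1) := by
  by_cases ht : g = ⊤
  · rw [ht, ENNReal.top_mul (ENNReal.inv_ne_zero.2 ENNReal.ofReal_ne_top), top_add,
      ENNReal.mul_top (by simpa using half_pos he')]
    exact le_top
  lift g to ℝ≥0 using ht
  refine (mul_le_mul_right (hg ENNReal.coe_ne_top) _).trans ?_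
  have e1 : (2⁻¹ : ℝ≥0∞) ^ j * (2 * g + ENNReal.ofReal M)
      = ENNReal.ofReal ((2⁻¹ : ℝ) ^ j * (2 * g + M)) := by
    rw [ENNReal.ofReal_mul (by positivity), ENNReal.ofReal_pow (by positivity),
      ENNReal.ofReal_add (by positivity) hM, ENNReal.ofReal_mul (by positivity),
      ENNReal.ofReal_inv_of_pos two_pos]
    simp
  have e2 : ENNReal.ofReal (e' / 2) * (g * (ENNReal.ofReal e)⁻¹ + 1)
      = ENNReal.ofReal (e' / 2 * (g * e⁻¹ + 1)) := by
    rw [ENNReal.ofReal_mul (by positivity), ENNReal.ofReal_add (by positivity) zero_le_one,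
      ENNReal.ofReal_mul (by positivity), ENNReal.ofReal_inv_of_pos he]
    simp
  rw [e1, e2]
  refine ENNReal.ofReal_le_ofReal ?_
  have hg0 : (0 : ℝ) ≤ g := g.2
  rw [inv_pow, inv_mul_eq_div, div_le_iff₀ (by positivity)]
  have h1 : 2 * (g : ℝ) + M ≤ (g * e⁻¹ + 1) * (2 * e + M) := by
    have : (g * e⁻¹ + 1) * (2 * e + M) = 2 * g + M + g * e⁻¹ * M + 2 * e := by
      field_simp
      ring
    rw [this]
    have : 0 ≤ g * e⁻¹ * M := by positivity
    linarith
  have h2 : (g * e⁻¹ + 1) * (2 * e + M) ≤ (g * e⁻¹ + 1) * (2 ^ j * (e' / 2)) :=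
    mul_le_mul_of_nonneg_left hj (by positivity)
  linarith

namespace IsRun

variable {A : Solver n d₁ d₂} {K : ℕ → ℝ} {q : Params n d₁ d₂} {Ω : Type*} [mΩ : MeasurableSpace Ω]
  {μ : Measure Ω} {x : ℕ → Ω → Euc n} {l : ℕ → Ω → Dual d₁ d₂} {m : ℕ → Ω → ℕ}
  {xs : Euc n} {ls : Dual d₁ d₂}

theorem measurable_prev (hrun : IsRun P A K q μ x l m) (s : ℕ) : Measurable (q.prev x s) := by
  cases s with
  | zero => exact measurable_const
  | succ s => exact hrun.measurable_x s

omit mΩ in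
theorem measurable_lam_next (hP : P.Standing) {m' : MeasurableSpace Ω} {β : ℝ} (hβ : 0 < β)
    {X : Ω → Euc n} {Y : Ω → Dual d₁ d₂} (hX : Measurable[m'] X) (hY : Measurable[m'] Y) :
    Measurable[m'] fun ω => P.Lam (P.p (X ω)) (Y ω) β := by
  have h := Measurable.comp (hP.continuous_lam hβ).measurable
    ((hP.continuous_p.measurable.comp hX).prodMk hY)
  exact h

theorem measurable_gap_inner (hrun : IsRun P A K q μ x l m) (hP : P.Standing)
    (ho : P.OptimalPair xs ls) (hq : q.Valid P) (s : ℕ) {X : Ω → Euc n} (hX : Measurable X) :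
    Measurable fun ω => P.gap (q.inner x l s ω) (X ω) := by
  have h := Measurable.comp (hP.measurable_gap ho (hq.β_pos s))
    (((hrun.measurable_prev s).prodMk (hrun.measurable_l s)).prodMk hX)
  exact h

theorem inner_succ (hrun : IsRun P A K q μ x l m) (s : ℕ) (ω : Ω) : q.inner x l (s + 1) ω
    = ⟨x s ω, P.Lam (P.p (x s ω)) (q.inner x l s ω).l (q.inner x l s ω).β, q.β (s + 1)⟩ := by
  rw [Params.inner, hrun.l_succ s ω]
  rfl

/-- The quantity `M_s` along the run. -/
def Ms (P : Problem n d₁ d₂) (q : Params n d₁ d₂) (x : ℕ → Ω → Euc n) (l : ℕ → Ω → Dual d₁ d₂)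
    (s : ℕ) (ω : Ω) : ℝ :=
  Mterm P (q.β s) (q.β (s + 1)) (q.prev x s ω) (x s ω) (l s ω) (l (s + 1) ω)

omit mΩ in
theorem Ms_nonneg (hq : q.Valid P) (s : ℕ) (ω : Ω) : 0 ≤ Ms P q x l s ω :=
  Problem.Mterm_nonneg (hq.β_pos s).le (hq.β_succ_le s) (hq.β_lt_two_mul s) _ _ _ _

theorem gap_succ_le (hrun : IsRun P A K q μ x l m) (hP : P.Standing) (ho : P.OptimalPair xs ls)
    (hq : q.Valid P) (s : ℕ) (ω : Ω) (hfin : P.gap (q.inner x l s ω) (x s ω) ≠ ⊤) :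
    P.gap (q.inner x l (s + 1) ω) (x s ω)
      ≤ 2 * P.gap (q.inner x l s ω) (x s ω) + ENNReal.ofReal (Ms P q x l s ω) := by
  have hβ : 0 < (q.inner x l s ω).β := hq.β_pos s
  obtain ⟨y, hy⟩ := hP.exists_isProx ho (q.inner x l s ω) hβ
  obtain ⟨y', hy'⟩ := hP.exists_isProx ho (q.inner x l (s + 1) ω) (hq.β_pos (s + 1))
  have hx := hy.mem_of_gap_ne_top hP hβ hfin
  have hM : Ms P q x l s ω = Mterm P (q.inner x l s ω).β (q.β (s + 1)) (q.inner x l s ω).y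
      (x s ω) (q.inner x l s ω).l (P.Lam (P.p (x s ω)) (q.inner x l s ω).l (q.inner x l s ω).β) := by
    rw [Ms, hrun.l_succ s ω]; rfl
  have hfin' : P.gap (q.inner x l (s + 1) ω) (x s ω) ≠ ⊤ := by
    rw [hy'.gap_eq hP (hq.β_pos (s + 1)) hx]
    exact ENNReal.ofReal_ne_top
  have hM0 := Ms_nonneg hq s ω (x := x) (l := l)
  rw [hrun.inner_succ s ω] at hy' hfin' ⊢
  have h := hy.gap_next_le hP (hq.β_pos (s + 1)) (hq.β_succ_le s) (hq.β_lt_two_mul s) hx hy'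
  rw [← hM] at h
  rw [← ENNReal.ofReal_toReal hfin', ← ENNReal.ofReal_toReal hfin]
  refine (ENNReal.ofReal_le_ofReal h).trans ?_
  rw [ENNReal.ofReal_add (by positivity) hM0, ENNReal.ofReal_mul zero_le_two]
  simp

theorem ae_mem_of_lintegral_le (hrun : IsRun P A K q μ x l m) (hP : P.Standing)
    (ho : P.OptimalPair xs ls) (hq : q.Valid P) {s : ℕ}
    (h : ∫⁻ ω, P.gap (q.inner x l s ω) (x s ω) ∂μ ≤ ENNReal.ofReal (q.ε s)) :
    ∀ᵐ ω ∂μ, P.gap (q.inner x l s ω) (x s ω) ≠ ⊤ ∧ x s ω ∈ dom P.g := by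
  have hlt := ae_lt_top (hrun.measurable_gap_inner hP ho hq s (hrun.measurable_x s))
    (h.trans_lt ENNReal.ofReal_lt_top).ne
  filter_upwards [hlt] with ω hω
  obtain ⟨y, hy⟩ := hP.exists_isProx ho (q.inner x l s ω) (hq.β_pos s)
  exact ⟨hω.ne, hy.mem_of_gap_ne_top hP (hq.β_pos s) hω.ne⟩

variable [IsProbabilityMeasure μ]

/-- The expected optimality gap of `x^s` for the inner problem `H_s` is at most `ε_s`. -/
theorem lintegral_gap_le (hrun : IsRun P A K q μ x l m) (hP : P.Standing)
    (ho : P.OptimalPair xs ls) (hq : q.Valid P)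
    (hrate : ∀ s, ∀ᵐ ω ∂μ, LinearRate P A (q.inner x l s ω) (K s)) (s : ℕ) :
    ∫⁻ ω, P.gap (q.inner x l s ω) (x s ω) ∂μ ≤ ENNReal.ofReal (q.ε s) := by
  induction s with
  | zero => simpa [Params.ε] using hrun.init_gap
  | succ s ih =>
    have hle := past_le hrun.measurable_x hrun.measurable_l (s + 1)
    have hX : Measurable[past x l (s + 1)] (x s) := measurable_past_x (Nat.lt_succ_self s)
    -- The multiplier λ^{s+1} is a function of x^s and λ^s, hence already known before x^{s+1} is
    -- drawn.
    have hY : Measurable[past x l (s + 1)] (l (s + 1)) := by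
      rw [show l (s + 1) = fun ω => P.Lam (P.p (x s ω)) (l s ω) (q.β s) from
        funext (hrun.l_succ s)]
      exact measurable_lam_next hP (hq.β_pos s) hX (measurable_past_l (Nat.lt_succ_self s))
    have hlaw := hrun.x_law (s + 1)
    have key : ∫⁻ ω, P.gap (q.inner x l (s + 1) ω) (x (s + 1) ω) ∂μ
        = ∫⁻ ω, ∫⁻ z, P.gap (q.inner x l (s + 1) ω) z
          ∂(A (q.prev x (s + 1) ω) (m (s + 1) ω) (q.inner x l (s + 1) ω) : Measure (Euc n)) ∂μ := by
      have hXY : Measurable[past x l (s + 1)] fun ω => (x s ω, l (s + 1) ω) := hX.prodMk hY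
      -- The conditioning variable is the identity into Ω equipped with the past σ-algebra: the
      -- whole past is frozen, and the iteration count enters only through the law.
      have hT : @Measurable Ω Ω mΩ (past x l (s + 1)) id := measurable_id.mono hle le_rfl
      have hcomap : MeasurableSpace.comap (id : Ω → Ω) (past x l (s + 1)) = past x l (s + 1) :=
        MeasurableSpace.comap_id
      have hG : @Measurable (Ω × Euc n) ℝ≥0∞ (@Prod.instMeasurableSpace _ _ (past x l (s + 1)) _) _
          fun a => P.gap (q.inner x l (s + 1) a.1) a.2 := by
        let _ : MeasurableSpace Ω := past x l (s + 1)
        have h := Measurable.comp (hP.measurable_gap ho (hq.β_pos (s + 1)))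
          ((hXY.comp measurable_fst).prodMk (measurable_snd (α := Ω) (β := Euc n)))
        exact h
      exact @lintegral_eq_of_condLaw Ω Ω (Euc n) mΩ (past x l (s + 1)) _ _ _ μ _ id (x (s + 1)) hT
        (hrun.measurable_x (s + 1))
        (fun ω => A (q.prev x (s + 1) ω) (m (s + 1) ω) (q.inner x l (s + 1) ω))
        (by rw [hcomap]; exact hlaw) (fun a => P.gap (q.inner x l (s + 1) a.1) a.2) hG
    rw [key]
    have hmg := hrun.measurable_gap_inner hP ho hq s (hrun.measurable_x s)
    calc _ ≤ ∫⁻ ω, ENNReal.ofReal (q.ε (s + 1) / 2)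
          * (P.gap (q.inner x l s ω) (x s ω) * (ENNReal.ofReal (q.ε s))⁻¹ + 1) ∂μ := by
          refine lintegral_mono_ae ?_
          filter_upwards [hrate (s + 1), hrun.ae_mem_of_lintegral_le hP ho hq ih] with ω h1 h2
          refine (h1 _ h2.2 (m (s + 1) ω)).trans ?_
          exact inv_two_pow_mul_gap_le (hq.ε_pos s) (hq.ε_pos (s + 1)) (Ms_nonneg hq s ω)
            (hrun.m_succ s ω).1 (hrun.gap_succ_le hP ho hq s ω)
      _ = ENNReal.ofReal (q.ε (s + 1) / 2)
          * ((∫⁻ ω, P.gap (q.inner x l s ω) (x s ω) ∂μ) * (ENNReal.ofReal (q.ε s))⁻¹ + 1) := by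
          rw [lintegral_const_mul _ ((hmg.mul_const _).add_const _),
            lintegral_add_right _ measurable_const, lintegral_mul_const _ hmg]
          simp
      _ ≤ ENNReal.ofReal (q.ε (s + 1) / 2) * (1 + 1) := by
          gcongr
          rw [← div_eq_mul_inv]
          exact ENNReal.div_le_of_le_mul (by rwa [one_mul])
      _ = ENNReal.ofReal (q.ε (s + 1)) := by
          rw [one_add_one_eq_two, show (2 : ℝ≥0∞) = ENNReal.ofReal 2 by simp,
            ← ENNReal.ofReal_mul (half_pos (hq.ε_pos (s + 1))).le]
          congr 1; ring

end IsRun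

end IPALM

end

/-! ### L² stability of the inexact proximal iteration. -/

noncomputable section

namespace IPALM

variable {n d₁ d₂ : ℕ} {P : Problem n d₁ d₂}

namespace IsRun

variable {A : Solver n d₁ d₂} {K : ℕ → ℝ} {q : Params n d₁ d₂} {Ω : Type*} [mΩ : MeasurableSpace Ω]
  {μ : Measure Ω} {x : ℕ → Ω → Euc n} {l : ℕ → Ω → Dual d₁ d₂} {m : ℕ → Ω → ℕ}
  {xs : Euc n} {ls : Dual d₁ d₂}

/-- The primal-dual iterate `(x^{s-1}, λ^s)`. -/
def pd (q : Params n d₁ d₂) (x : ℕ → Ω → Euc n) (l : ℕ → Ω → Dual d₁ d₂) (s : ℕ) (ω : Ω) :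
    PD n d₁ d₂ := WithLp.toLp 2 (q.prev x s ω, l s ω)

/-- Bound on the distance of `(x^s, λ^{s+1})` to the exact proximal point. -/
def perr (P : Problem n d₁ d₂) (q : Params n d₁ d₂) (x : ℕ → Ω → Euc n)
    (l : ℕ → Ω → Dual d₁ d₂) (s : ℕ) (ω : Ω) : ℝ :=
  √(2 * (P.gap (q.inner x l s ω) (x s ω)).toReal / q.β s)

theorem measurable_pd (hrun : IsRun P A K q μ x l m) (s : ℕ) : Measurable (pd q x l s) := by
  have h := (WithLp.measurable_toLp 2 (Euc n × Dual d₁ d₂)).comp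
    ((hrun.measurable_prev s).prodMk (hrun.measurable_l s))
  exact h

theorem pd_zero (hrun : IsRun P A K q μ x l m) (ω : Ω) :
    pd q x l 0 ω = WithLp.toLp 2 (q.xinit, q.linit) := by
  rw [pd, hrun.l_zero]; rfl

theorem norm_pd_succ_sub_le (hrun : IsRun P A K q μ x l m) (hP : P.Standing) (hq : q.Valid P)
    {s : ℕ} {ω : Ω} (hx : x s ω ∈ dom P.g) {y : PD n d₁ d₂}
    (hy : P.IsProx (q.inner x l s ω) y) : ‖pd q x l (s + 1) ω - y‖ ≤ perr P q x l s ω := by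
  have h := hy.norm_sub_le hP (hq.β_pos s) hx
  have e : pd q x l (s + 1) ω = WithLp.toLp 2 (x s ω, P.Lam (P.p (x s ω)) (l s ω) (q.β s)) := by
    rw [pd, hrun.l_succ]; rfl
  rw [e]
  exact h

omit mΩ in
theorem prox_bounds (hP : P.Standing) (ho : P.OptimalPair xs ls) (hq : q.Valid P) {s : ℕ} {ω : Ω}
    {y : PD n d₁ d₂} (hy : P.IsProx (q.inner x l s ω) y) :
    ‖y - WithLp.toLp 2 (xs, ls)‖ ≤ ‖pd q x l s ω - WithLp.toLp 2 (xs, ls)‖ ∧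
    ‖pd q x l s ω - y‖ ≤ ‖pd q x l s ω - WithLp.toLp 2 (xs, ls)‖ := by
  have hm := hy.grad.mono (ho.saddleGrad hP)
  rw [sub_zero] at hm
  have hf := prox_firm (w := pd q x l s ω) (hq.β_pos s) hm
  constructor
  · exact abs_le_of_sq_le_sq' (by nlinarith [sq_nonneg ‖pd q x l s ω - y‖]) (norm_nonneg _) |>.2
  · refine abs_le_of_sq_le_sq' ?_ (norm_nonneg _) |>.2
    nlinarith [sq_nonneg ‖y - WithLp.toLp 2 (xs, ls)‖]

theorem dist_succ_le (hrun : IsRun P A K q μ x l m) (hP : P.Standing) (ho : P.OptimalPair xs ls)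
    (hq : q.Valid P) {s : ℕ} {ω : Ω} (hx : x s ω ∈ dom P.g) :
    ‖pd q x l (s + 1) ω - WithLp.toLp 2 (xs, ls)‖
      ≤ ‖pd q x l s ω - WithLp.toLp 2 (xs, ls)‖ + perr P q x l s ω := by
  obtain ⟨y, hy⟩ := hP.exists_isProx ho (q.inner x l s ω) (hq.β_pos s)
  have h1 := hrun.norm_pd_succ_sub_le hP hq hx hy
  have h2 := (prox_bounds hP ho hq hy).1
  have h3 := norm_sub_le_norm_sub_add_norm_sub (pd q x l (s + 1) ω) y (WithLp.toLp 2 (xs, ls))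
  linarith

theorem step_le (hrun : IsRun P A K q μ x l m) (hP : P.Standing) (ho : P.OptimalPair xs ls)
    (hq : q.Valid P) {s : ℕ} {ω : Ω} (hx : x s ω ∈ dom P.g) :
    ‖pd q x l (s + 1) ω - pd q x l s ω‖
      ≤ ‖pd q x l s ω - WithLp.toLp 2 (xs, ls)‖ + perr P q x l s ω := by
  obtain ⟨y, hy⟩ := hP.exists_isProx ho (q.inner x l s ω) (hq.β_pos s)
  have h1 := hrun.norm_pd_succ_sub_le hP hq hx hy
  have h2 := (prox_bounds hP ho hq hy).2
  have h3 := norm_sub_le_norm_sub_add_norm_sub (pd q x l (s + 1) ω) y (pd q x l s ω)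
  rw [norm_sub_rev y] at h3
  linarith

/-- The auxiliary `y₃` is an exact proximal step from the exact point `y₁`, so the two-step estimate
applies to `y₁ - y₃`. The residual map being nonexpansive, starting the second step from the inexact
iterate costs only the first error. -/
theorem two_step_le (hrun : IsRun P A K q μ x l m) (hP : P.Standing) (ho : P.OptimalPair xs ls)
    (hq : q.Valid P) {s : ℕ} {ω : Ω} (hx : x s ω ∈ dom P.g) (hx' : x (s + 1) ω ∈ dom P.g) :
    ‖pd q x l (s + 2) ω - pd q x l (s + 1) ω‖
      ≤ (1 + q.ρ)⁻¹ * ‖pd q x l s ω - WithLp.toLp 2 (xs, ls)‖ + perr P q x l s ω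
        + perr P q x l (s + 1) ω := by
  obtain ⟨y₁, hy₁⟩ := hP.exists_isProx ho (q.inner x l s ω) (hq.β_pos s)
  obtain ⟨y₂, hy₂⟩ := hP.exists_isProx ho (q.inner x l (s + 1) ω) (hq.β_pos (s + 1))
  obtain ⟨y₃, hy₃⟩ := hP.exists_isProx ho ⟨y₁.fst, y₁.snd, q.β (s + 1)⟩ (hq.β_pos (s + 1))
  have h1 := hrun.norm_pd_succ_sub_le hP hq hx hy₁
  have h2 := hrun.norm_pd_succ_sub_le hP hq hx' hy₂
  have hg₁ : P.SaddleGrad y₁ (q.β s • (pd q x l s ω - y₁)) := hy₁.grad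
  have hg₂ : P.SaddleGrad y₂ (q.β (s + 1) • (pd q x l (s + 1) ω - y₂)) := hy₂.grad
  have hg₃ : P.SaddleGrad y₃ (q.β (s + 1) • (y₁ - y₃)) := hy₃.grad
  have h3 := prox_residual_nonexpansive (hq.β_pos (s + 1)) (hg₂.mono hg₃)
  have hm₁ := hg₃.mono (ho.saddleGrad hP)
  have hm₂ := hg₁.mono hg₃
  rw [sub_zero] at hm₁
  rw [Params.β_succ, mul_comm (q.β s)] at hm₁ hm₂
  have h4 := prox_two_step (hq.β_pos s) hq.ρ_pos hm₁ hm₂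
  have hρ : 0 < 1 + q.ρ := by linarith [hq.ρ_pos]
  have h5 : ‖y₁ - y₃‖ ≤ (1 + q.ρ)⁻¹ * ‖pd q x l s ω - WithLp.toLp 2 (xs, ls)‖ := by
    rw [inv_mul_eq_div, le_div_iff₀ hρ]; linarith
  have h6 : ‖pd q x l (s + 1) ω - y₂‖
      ≤ ‖(pd q x l (s + 1) ω - y₂) - (y₁ - y₃)‖ + ‖y₁ - y₃‖ := by
    have := norm_add_le ((pd q x l (s + 1) ω - y₂) - (y₁ - y₃)) (y₁ - y₃)
    rwa [sub_add_cancel] at this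
  have h7 := norm_sub_le_norm_sub_add_norm_sub (pd q x l (s + 1 + 1) ω) y₂ (pd q x l (s + 1) ω)
  rw [norm_sub_rev y₂] at h7
  change ‖pd q x l (s + 1 + 1) ω - pd q x l (s + 1) ω‖ ≤ _
  linarith

/-- Bound on the `L²` norm of the error of the `s`-th proximal step. -/
def _root_.IPALM.Params.δ (q : Params n d₁ d₂) (s : ℕ) : ℝ := √(2 * q.ε s / q.β s)

theorem _root_.IPALM.Params.δ_nonneg (q : Params n d₁ d₂) (s : ℕ) : 0 ≤ q.δ s := Real.sqrt_nonneg _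

theorem l2Le_perr (hrun : IsRun P A K q μ x l m) (hP : P.Standing) (ho : P.OptimalPair xs ls)
    (hq : q.Valid P) {s : ℕ}
    (hgap : ∫⁻ ω, P.gap (q.inner x l s ω) (x s ω) ∂μ ≤ ENNReal.ofReal (q.ε s)) :
    L2Le μ (perr P q x l s) (q.δ s) := by
  have hm := hrun.measurable_gap_inner hP ho hq s (hrun.measurable_x s)
  have hβ := hq.β_pos s
  have hε := hq.ε_pos s
  refine L2Le.of_lintegral ?_ (q.δ_nonneg s) ?_
  · have : Measurable (perr P q x l s) := by
      unfold perr
      exact ((hm.ennreal_toReal.const_mul 2).div_const _).sqrt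
    exact this.aestronglyMeasurable
  · have e1 : ∀ ω, perr P q x l s ω ^ 2
        = 2 / q.β s * (P.gap (q.inner x l s ω) (x s ω)).toReal := by
      intro ω
      rw [perr, Real.sq_sqrt (by positivity)]; ring
    have e2 : q.δ s ^ 2 = 2 / q.β s * q.ε s := by
      rw [Params.δ, Real.sq_sqrt (by positivity)]; ring
    simp_rw [e1, e2]
    rw [ENNReal.ofReal_mul (by positivity)]
    calc _ ≤ ∫⁻ ω, ENNReal.ofReal (2 / q.β s) * P.gap (q.inner x l s ω) (x s ω) ∂μ := by
          refine lintegral_mono fun ω => ?_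
          change ENNReal.ofReal (2 / q.β s * (P.gap (q.inner x l s ω) (x s ω)).toReal) ≤ _
          rw [ENNReal.ofReal_mul (by positivity)]
          gcongr
          exact ENNReal.ofReal_toReal_le
      _ = ENNReal.ofReal (2 / q.β s) * ∫⁻ ω, P.gap (q.inner x l s ω) (x s ω) ∂μ :=
          lintegral_const_mul _ hm
      _ ≤ _ := by gcongr

section Bounds

variable [IsProbabilityMeasure μ] (hrun : IsRun P A K q μ x l m) (hP : P.Standing)
  (ho : P.OptimalPair xs ls) (hq : q.Valid P)
  (hgap : ∀ s, ∫⁻ ω, P.gap (q.inner x l s ω) (x s ω) ∂μ ≤ ENNReal.ofReal (q.ε s))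
include hrun hP ho hq hgap

/-- Minkowski's inequality summed over steps: each exact step does not move away from the saddle
point, so only the errors accumulate. -/
theorem l2Le_dist_sum (s : ℕ) : L2Le μ (fun ω => ‖pd q x l s ω - WithLp.toLp 2 (xs, ls)‖)
    (‖WithLp.toLp 2 (q.xinit, q.linit) - WithLp.toLp 2 (xs, ls)‖
      + ∑ t ∈ Finset.range s, q.δ t) := by
  induction s with
  | zero =>
    have e : (fun ω => ‖pd q x l 0 ω - WithLp.toLp 2 (xs, ls)‖)
        = fun _ => ‖WithLp.toLp 2 (q.xinit, q.linit) - WithLp.toLp 2 (xs, ls)‖ :=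
      funext fun ω => by rw [hrun.pd_zero]
    rw [e, Finset.sum_range_zero, add_zero]
    have h := L2Le.const (μ := μ) ‖WithLp.toLp 2 (q.xinit, q.linit) - WithLp.toLp 2 (xs, ls)‖
    rwa [abs_norm] at h
  | succ s ih =>
    rw [Finset.sum_range_succ, ← add_assoc]
    refine (ih.add (hrun.l2Le_perr hP ho hq (hgap s))
      (add_nonneg (norm_nonneg _) (Finset.sum_nonneg fun t _ => q.δ_nonneg t))
      (q.δ_nonneg s)).mono ?_ ?_ le_rfl
    · exact ((hrun.measurable_pd (s + 1)).sub_const _).norm.aestronglyMeasurable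
    · filter_upwards [hrun.ae_mem_of_lintegral_le hP ho hq (hgap s)] with ω hω
      rw [abs_norm]
      exact hrun.dist_succ_le hP ho hq hω.2

theorem l2Le_step_sum (s : ℕ) : L2Le μ (fun ω => ‖pd q x l (s + 1) ω - pd q x l s ω‖)
    (‖WithLp.toLp 2 (q.xinit, q.linit) - WithLp.toLp 2 (xs, ls)‖
      + ∑ t ∈ Finset.range (s + 1), q.δ t) := by
  rw [Finset.sum_range_succ, ← add_assoc]
  refine ((hrun.l2Le_dist_sum hP ho hq hgap s).add (hrun.l2Le_perr hP ho hq (hgap s))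
    (add_nonneg (norm_nonneg _) (Finset.sum_nonneg fun t _ => q.δ_nonneg t))
    (q.δ_nonneg s)).mono ?_ ?_ le_rfl
  · exact ((hrun.measurable_pd (s + 1)).sub (hrun.measurable_pd s)).norm.aestronglyMeasurable
  · filter_upwards [hrun.ae_mem_of_lintegral_le hP ho hq (hgap s)] with ω hω
    rw [abs_norm]
    exact hrun.step_le hP ho hq hω.2

theorem l2Le_two_step_sum (s : ℕ) : L2Le μ (fun ω => ‖pd q x l (s + 2) ω - pd q x l (s + 1) ω‖)
    ((1 + q.ρ)⁻¹ * ‖WithLp.toLp 2 (q.xinit, q.linit) - WithLp.toLp 2 (xs, ls)‖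
      + ∑ t ∈ Finset.range (s + 2), q.δ t) := by
  have hρ := hq.ρ_pos
  have hρ1 : (1 + q.ρ)⁻¹ ≤ 1 := inv_le_one_of_one_le₀ (by linarith)
  have hS : 0 ≤ ∑ t ∈ Finset.range s, q.δ t := Finset.sum_nonneg fun t _ => q.δ_nonneg t
  set r := ‖WithLp.toLp 2 (q.xinit, q.linit) - WithLp.toLp 2 (xs, ls)‖ with hr
  have hr0 : 0 ≤ r := norm_nonneg _
  have h0 : L2Le μ (fun ω => (1 + q.ρ)⁻¹ * ‖pd q x l s ω - WithLp.toLp 2 (xs, ls)‖)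
      ((1 + q.ρ)⁻¹ * (r + ∑ t ∈ Finset.range s, q.δ t)) := by
    have h := hrun.l2Le_dist_sum hP ho hq hgap s
    refine ⟨h.aesm.const_mul _, ?_⟩
    have e := eLpNorm_const_smul (μ := μ) (p := 2) ((1 + q.ρ)⁻¹)
      (fun ω => ‖pd q x l s ω - WithLp.toLp 2 (xs, ls)‖)
    have hnn : (0 : ℝ) ≤ (1 + q.ρ)⁻¹ := by positivity
    rw [← ofReal_norm, Real.norm_of_nonneg hnn] at e
    rw [ENNReal.ofReal_mul hnn]
    refine (le_of_eq e).trans ?_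
    gcongr
    exact h.le
  have h1 := (h0.add (hrun.l2Le_perr hP ho hq (hgap s)) (by positivity) (q.δ_nonneg s)).add
    (hrun.l2Le_perr hP ho hq (hgap (s + 1))) (add_nonneg (by positivity) (q.δ_nonneg s))
    (q.δ_nonneg (s + 1))
  refine h1.mono ?_ ?_ ?_
  · exact ((hrun.measurable_pd (s + 2)).sub (hrun.measurable_pd (s + 1))).norm.aestronglyMeasurable
  · filter_upwards [hrun.ae_mem_of_lintegral_le hP ho hq (hgap s),
      hrun.ae_mem_of_lintegral_le hP ho hq (hgap (s + 1))] with ω hω hω'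
    rw [abs_norm]
    exact hrun.two_step_le hP ho hq hω.2 hω'.2
  · rw [Finset.sum_range_succ, Finset.sum_range_succ]
    have : (1 + q.ρ)⁻¹ * ∑ t ∈ Finset.range s, q.δ t ≤ 1 * ∑ t ∈ Finset.range s, q.δ t :=
      mul_le_mul_of_nonneg_right hρ1 hS
    linarith

end Bounds

end IsRun

/-! ### The constants -/

section Constants

variable {q : Params n d₁ d₂} {xs : Euc n} {ls : Dual d₁ d₂}

/-- `√(ε₀/β₀) / (1 - √(η/ρ))` -/
def Params.serr (q : Params n d₁ d₂) : ℝ := √(q.ε₀ / q.β₀) / (1 - √(q.η / q.ρ))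

theorem Params.Valid.ratio_lt (hq : q.Valid P) (hηρ : q.η < q.ρ) : √(q.η / q.ρ) < 1 := by
  rw [Real.sqrt_lt' one_pos, one_pow, div_lt_one hq.ρ_pos]
  exact hηρ

theorem Params.Valid.sqrt_le_serr (hq : q.Valid P) (hηρ : q.η < q.ρ) :
    √(q.ε₀ / q.β₀) ≤ q.serr := by
  have h := hq.ratio_lt hηρ
  rw [Params.serr, le_div_iff₀ (by linarith)]
  have := Real.sqrt_nonneg (q.ε₀ / q.β₀)
  have := Real.sqrt_nonneg (q.η / q.ρ)
  nlinarith

theorem Params.Valid.serr_nonneg (hq : q.Valid P) (hηρ : q.η < q.ρ) : 0 ≤ q.serr :=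
  (Real.sqrt_nonneg _).trans (hq.sqrt_le_serr hηρ)

/-- The errors are geometric with ratio √(η/ρ), which is below 1 because η < ρ. -/
theorem Params.Valid.sum_δ_le (hq : q.Valid P) (hηρ : q.η < q.ρ) (s : ℕ) :
    ∑ t ∈ Finset.range s, q.δ t ≤ √2 * q.serr := by
  have h := hq.ratio_lt hηρ
  have e : ∀ t, q.δ t = √2 * √(q.ε₀ / q.β₀) * √(q.η / q.ρ) ^ t := by
    intro t
    have h1 : 2 * q.ε t / q.β t = 2 * (q.ε₀ / q.β₀) * (q.η / q.ρ) ^ t := by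
      rw [Params.ε, Params.β, div_pow]
      have := hq.β₀_pos.ne'
      have := (pow_pos hq.ρ_pos t).ne'
      field_simp
    rw [Params.δ, h1, Real.sqrt_mul (mul_nonneg zero_le_two
      (div_nonneg hq.ε₀_pos.le hq.β₀_pos.le)), Real.sqrt_mul zero_le_two]
    congr 1
    refine (Real.sqrt_eq_iff_eq_sq (pow_nonneg (div_nonneg hq.η_pos.le hq.ρ_pos.le) t)
      (by positivity)).2 ?_
    rw [← pow_mul, mul_comm t 2, pow_mul, Real.sq_sqrt (div_nonneg hq.η_pos.le hq.ρ_pos.le)]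
  simp_rw [e]
  rw [← Finset.mul_sum, Params.serr, mul_assoc]
  have h2 : ∑ t ∈ Finset.range s, √(q.η / q.ρ) ^ t ≤ 1 / (1 - √(q.η / q.ρ)) := by
    rw [le_div_iff₀ (by linarith), geom_sum_mul_neg]
    have := pow_nonneg (Real.sqrt_nonneg (q.η / q.ρ)) s
    linarith
  calc √2 * (√(q.ε₀ / q.β₀) * ∑ t ∈ Finset.range s, √(q.η / q.ρ) ^ t)
      ≤ √2 * (√(q.ε₀ / q.β₀) * (1 / (1 - √(q.η / q.ρ)))) := by gcongr
    _ = _ := by ring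

/-- Uniform bound on the `L²` distance of the iterates to the saddle point. -/
def Params.rad (q : Params n d₁ d₂) (xs : Euc n) (ls : Dual d₁ d₂) : ℝ :=
  ‖(WithLp.toLp 2 (q.xinit, q.linit) - WithLp.toLp 2 (xs, ls) : PD n d₁ d₂)‖ + √2 * q.serr

theorem Params.Valid.rad_nonneg (hq : q.Valid P) (hηρ : q.η < q.ρ) : 0 ≤ q.rad xs ls :=
  add_nonneg (norm_nonneg _) (mul_nonneg (Real.sqrt_nonneg _) (hq.serr_nonneg hηρ))

theorem c₀_eq : c₀ q xs ls
    = 2 * (‖(WithLp.toLp 2 (q.xinit, q.linit) - WithLp.toLp 2 (xs, ls) : PD n d₁ d₂)‖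
      + 2 * q.serr) ^ 2 + 2 * ‖ls‖ ^ 2 + 2 * ‖xs‖ ^ 2 := by
  have h : ‖(WithLp.toLp 2 (q.xinit, q.linit) - WithLp.toLp 2 (xs, ls) : PD n d₁ d₂)‖
      = √(‖q.xinit - xs‖ ^ 2 + ‖q.linit - ls‖ ^ 2) := by
    rw [← Real.sqrt_sq (norm_nonneg (WithLp.toLp 2 (q.xinit, q.linit)
      - WithLp.toLp 2 (xs, ls) : PD n d₁ d₂)), norm_sq_pd]
    rfl
  rw [c₀, h, Params.serr, mul_div_assoc]

theorem Params.Valid.rad_sq_le (hq : q.Valid P) (hηρ : q.η < q.ρ) :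
    q.rad xs ls ^ 2 + q.ε₀ / q.β₀ + ‖ls‖ ^ 2 ≤ c₀ q xs ls / 2 := by
  rw [c₀_eq, Params.rad]
  set r := ‖(WithLp.toLp 2 (q.xinit, q.linit) - WithLp.toLp 2 (xs, ls) : PD n d₁ d₂)‖
  have hr : 0 ≤ r := norm_nonneg _
  have h1 := hq.sqrt_le_serr hηρ
  have h2 : q.ε₀ / q.β₀ ≤ q.serr ^ 2 := by
    rw [← Real.sq_sqrt (div_nonneg hq.ε₀_pos.le hq.β₀_pos.le)]
    exact pow_le_pow_left₀ (Real.sqrt_nonneg _) h1 2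
  have h3 := hq.serr_nonneg hηρ
  have h4 : √2 ^ 2 = 2 := Real.sq_sqrt zero_le_two
  have h5 : √2 ≤ 2 := by
    rw [Real.sqrt_le_left zero_le_two]; norm_num
  have h6 : r * (√2 * q.serr) ≤ r * (2 * q.serr) := by gcongr
  have h7 : (√2 * q.serr) ^ 2 = 2 * q.serr ^ 2 := by rw [mul_pow, h4]
  nlinarith [sq_nonneg ‖xs‖, sq_nonneg q.serr]

/-- This makes `c₀` positive and `c₁` at least 2ε, which keeps the final outer index away from 0. -/
theorem Params.Valid.eight_mul_le (hq : q.Valid P) (hηρ : q.η < q.ρ) :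
    8 * q.ε₀ ≤ c₀ q xs ls * q.β₀ := by
  rw [c₀_eq]
  set r := ‖(WithLp.toLp 2 (q.xinit, q.linit) - WithLp.toLp 2 (xs, ls) : PD n d₁ d₂)‖
  have hr : 0 ≤ r := norm_nonneg _
  have h3 := hq.serr_nonneg hηρ
  have h2 : q.ε₀ / q.β₀ ≤ q.serr ^ 2 := by
    rw [← Real.sq_sqrt (div_nonneg hq.ε₀_pos.le hq.β₀_pos.le)]
    exact pow_le_pow_left₀ (Real.sqrt_nonneg _) (hq.sqrt_le_serr hηρ) 2
  rw [div_le_iff₀ hq.β₀_pos] at h2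
  have h4 : 8 * q.serr ^ 2 ≤ 2 * (r + 2 * q.serr) ^ 2 + 2 * ‖ls‖ ^ 2 + 2 * ‖xs‖ ^ 2 := by
    nlinarith [sq_nonneg ‖xs‖, sq_nonneg ‖ls‖, mul_nonneg hr h3, sq_nonneg r]
  have := mul_le_mul_of_nonneg_right h4 hq.β₀_pos.le
  linarith

theorem Params.Valid.c₀_pos (hq : q.Valid P) (hηρ : q.η < q.ρ) : 0 < c₀ q xs ls := by
  have h := hq.eight_mul_le hηρ (xs := xs) (ls := ls)
  have := hq.ε₀_pos
  by_contra hn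
  push Not at hn
  have := mul_nonpos_of_nonpos_of_nonneg hn hq.β₀_pos.le
  linarith

/-- The gain of two steps becomes a factor ρ in front of √c₀. The one-step bound has coefficient 1
on the initial distance, while √c₀ only supplies √2 ρ, which may be smaller than 1. -/
theorem Params.Valid.two_step_const_le (hq : q.Valid P) (hηρ : q.η < q.ρ) :
    (1 + q.ρ)⁻¹ * ‖(WithLp.toLp 2 (q.xinit, q.linit) - WithLp.toLp 2 (xs, ls) : PD n d₁ d₂)‖
      + √2 * q.serr ≤ q.ρ * √(c₀ q xs ls) := by
  have hρ := hq.ρ_gt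
  set r := ‖(WithLp.toLp 2 (q.xinit, q.linit) - WithLp.toLp 2 (xs, ls) : PD n d₁ d₂)‖ with hr'
  have hr : 0 ≤ r := norm_nonneg _
  have h3 := hq.serr_nonneg hηρ
  have h4 : √2 ^ 2 = 2 := Real.sq_sqrt zero_le_two
  have h0 : (0 : ℝ) ≤ √2 := Real.sqrt_nonneg 2
  have h1 : √2 * (r + 2 * q.serr) ≤ √(c₀ q xs ls) := by
    refine Real.le_sqrt_of_sq_le ?_
    rw [c₀_eq, mul_pow, h4, ← hr']
    nlinarith [sq_nonneg ‖xs‖, sq_nonneg ‖ls‖]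
  have h5 : (1 + q.ρ)⁻¹ ≤ q.ρ * √2 := by
    rw [inv_le_iff_one_le_mul₀ (by linarith)]
    -- Since ρ > 1/2 gives ρ(1 + ρ) ≥ 3/4, the bound 1.4 · 3/4 ≥ 1 suffices.
    have h6 : (1.4 : ℝ) ≤ √2 := by
      refine Real.le_sqrt_of_sq_le ?_
      norm_num
    have h7 : (3 : ℝ) / 4 ≤ (1 + q.ρ) * q.ρ := by nlinarith
    nlinarith
  have h8 : (1 + q.ρ)⁻¹ * r ≤ q.ρ * √2 * r := mul_le_mul_of_nonneg_right h5 hr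
  have h9 : q.ρ * (√2 * (r + 2 * q.serr)) ≤ q.ρ * √(c₀ q xs ls) :=
    mul_le_mul_of_nonneg_left h1 hq.ρ_pos.le
  have h10 : √2 * q.serr ≤ 2 * q.ρ * (√2 * q.serr) :=
    le_mul_of_one_le_left (mul_nonneg h0 h3) (by linarith)
  linarith

end Constants

namespace IsRun

variable {A : Solver n d₁ d₂} {K : ℕ → ℝ} {q : Params n d₁ d₂} {Ω : Type*} [mΩ : MeasurableSpace Ω]
  {μ : Measure Ω} {x : ℕ → Ω → Euc n} {l : ℕ → Ω → Dual d₁ d₂} {m : ℕ → Ω → ℕ}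
  {xs : Euc n} {ls : Dual d₁ d₂}

variable [IsProbabilityMeasure μ] (hrun : IsRun P A K q μ x l m) (hP : P.Standing)
  (ho : P.OptimalPair xs ls) (hq : q.Valid P) (hηρ : q.η < q.ρ)
  (hgap : ∀ s, ∫⁻ ω, P.gap (q.inner x l s ω) (x s ω) ∂μ ≤ ENNReal.ofReal (q.ε s))
include hrun hP ho hq hηρ hgap

theorem l2Le_dist (s : ℕ) : L2Le μ (fun ω => ‖pd q x l s ω - WithLp.toLp 2 (xs, ls)‖)
    (q.rad xs ls) := by
  have h := hrun.l2Le_dist_sum hP ho hq hgap s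
  refine h.mono h.aesm (Filter.Eventually.of_forall fun ω => (abs_norm _).le) ?_
  exact add_le_add_right (hq.sum_δ_le hηρ s) _

theorem l2Le_step (s : ℕ) : L2Le μ (fun ω => ‖pd q x l (s + 1) ω - pd q x l s ω‖)
    (q.rad xs ls) := by
  have h := hrun.l2Le_step_sum hP ho hq hgap s
  refine h.mono h.aesm (Filter.Eventually.of_forall fun ω => (abs_norm _).le) ?_
  exact add_le_add_right (hq.sum_δ_le hηρ (s + 1)) _

theorem l2Le_step_succ (s : ℕ) : L2Le μ (fun ω => ‖pd q x l (s + 2) ω - pd q x l (s + 1) ω‖)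
    (q.ρ * √(c₀ q xs ls)) := by
  have h := hrun.l2Le_two_step_sum hP ho hq hgap s
  refine h.mono h.aesm (Filter.Eventually.of_forall fun ω => (abs_norm _).le) ?_
  exact (add_le_add_right (hq.sum_δ_le hηρ (s + 2)) _).trans (hq.two_step_const_le hηρ)

theorem l2Le_multiplier (s : ℕ) : L2Le μ (fun ω => ‖l s ω‖) (q.rad xs ls + ‖ls‖) := by
  have h := (hrun.l2Le_dist hP ho hq hηρ hgap s).add (L2Le.const (μ := μ) ‖ls‖)
    (hq.rad_nonneg hηρ) (abs_nonneg _)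
  rw [abs_norm] at h
  refine h.mono (hrun.measurable_l s).norm.aestronglyMeasurable
    (Filter.Eventually.of_forall fun ω => ?_) le_rfl
  rw [abs_norm]
  have h1 : ‖l s ω - ls‖ ≤ ‖pd q x l s ω - WithLp.toLp 2 (xs, ls)‖ :=
    norm_snd_pd_le (pd q x l s ω - WithLp.toLp 2 (xs, ls))
  have h2 := norm_add_le (l s ω - ls) ls
  rw [sub_add_cancel] at h2
  linarith

end IsRun

end IPALM

end

/-! ### Expected suboptimality and infeasibility of the iterates. -/

noncomputable section

namespace IPALM

variable {n d₁ d₂ : ℕ} {P : Problem n d₁ d₂}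

theorem Problem.Standing.measurable_F (hP : P.Standing) : Measurable P.F := by
  have h1 : Measurable fun x => P.f x + P.g x := hP.lowerSemicontinuous_f_add_g.measurable
  have h2 : Measurable fun x => P.h₁ (P.p₁ x) :=
    hP.h₁_lipschitz.continuous.measurable.comp hP.p₁_diff.continuous.measurable
  have h3 := Measurable.add h1 h2.coe_real_ereal
  exact h3

namespace IsRun

variable {A : Solver n d₁ d₂} {K : ℕ → ℝ} {q : Params n d₁ d₂} {Ω : Type*} [mΩ : MeasurableSpace Ω]
  {μ : Measure Ω} {x : ℕ → Ω → Euc n} {l : ℕ → Ω → Dual d₁ d₂} {m : ℕ → Ω → ℕ}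
  {xs : Euc n} {ls : Dual d₁ d₂}

theorem norm_lam_sub_le (hrun : IsRun P A K q μ x l m) (s : ℕ) (ω : Ω) :
    ‖P.Lam (P.p (x s ω)) (l s ω) (q.β s) - l s ω‖ ≤ ‖pd q x l (s + 1) ω - pd q x l s ω‖ := by
  rw [← hrun.l_succ s ω]
  exact norm_snd_pd_le (pd q x l (s + 1) ω - pd q x l s ω)

theorem infDist_le (hrun : IsRun P A K q μ x l m) (hP : P.Standing) (hq : q.Valid P) (s : ℕ)
    (ω : Ω) : Metric.infDist (P.p₂ (x s ω)) P.𝒦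
      ≤ q.β s * ‖pd q x l (s + 1) ω - pd q x l s ω‖ :=
  (hP.infDist_le _ (l s ω) (hq.β_pos s)).trans
    (mul_le_mul_of_nonneg_left (hrun.norm_lam_sub_le s ω) (hq.β_pos s).le)

theorem value_ge (hrun : IsRun P A K q μ x l m) (hP : P.Standing) (ho : P.OptimalPair xs ls)
    (hq : q.Valid P) {s : ℕ} {ω : Ω} (hx : x s ω ∈ dom P.g) :
    -(‖ls.snd‖ * q.β s * ‖pd q x l (s + 1) ω - pd q x l s ω‖)
      ≤ (P.F (x s ω)).toReal - P.optVal.toReal := by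
  refine le_trans (neg_le_neg ?_) (ho.value_ge hP hx (l s ω) (hq.β_pos s))
  rw [mul_assoc]
  exact mul_le_mul_of_nonneg_left (mul_le_mul_of_nonneg_left (hrun.norm_lam_sub_le s ω)
    (hq.β_pos s).le) (norm_nonneg _)

theorem value_le (hrun : IsRun P A K q μ x l m) (hP : P.Standing) (ho : P.OptimalPair xs ls)
    (hq : q.Valid P) {s : ℕ} {ω : Ω} (hx : x s ω ∈ dom P.g) :
    (P.F (x s ω)).toReal - P.optVal.toReal ≤ (P.gap (q.inner x l s ω) (x s ω)).toReal
      + q.β s * (1 / 2 * ‖pd q x l s ω - WithLp.toLp 2 (xs, ls)‖ ^ 2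
        + 1 / 2 * ‖pd q x l (s + 1) ω - pd q x l s ω‖ ^ 2 + (‖ls‖ ^ 2 + P.Lh₁ ^ 2)) := by
  have h := ho.value_le hP (I := q.inner x l s ω) (hq.β_pos s) hx
  have h1 := norm_sq_pd (pd q x l s ω - WithLp.toLp 2 (xs, ls))
  change _ = ‖q.prev x s ω - xs‖ ^ 2 + ‖l s ω - ls‖ ^ 2 at h1
  rw [h1]
  have h2 := pow_le_pow_left₀ (norm_nonneg _) (hrun.norm_lam_sub_le s ω) 2
  have hβ := (hq.β_pos s).le
  refine h.trans (add_le_add_right ?_ _)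
  change q.β s * (1 / 2 * (‖q.prev x s ω - xs‖ ^ 2 + ‖l s ω - ls‖ ^ 2)
        + 1 / 2 * ‖P.Lam (P.p (x s ω)) (l s ω) (q.β s) - l s ω‖ ^ 2 + ‖ls‖ ^ 2 + P.Lh₁ ^ 2) ≤ _
  refine mul_le_mul_of_nonneg_left ?_ hβ
  linarith

theorem integrable_gap (hrun : IsRun P A K q μ x l m) (hP : P.Standing)
    (ho : P.OptimalPair xs ls) (hq : q.Valid P) {s : ℕ}
    (hgap : ∫⁻ ω, P.gap (q.inner x l s ω) (x s ω) ∂μ ≤ ENNReal.ofReal (q.ε s)) :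
    Integrable (fun ω => (P.gap (q.inner x l s ω) (x s ω)).toReal) μ ∧
      ∫ ω, (P.gap (q.inner x l s ω) (x s ω)).toReal ∂μ ≤ q.ε s := by
  have hm := hrun.measurable_gap_inner hP ho hq s (hrun.measurable_x s)
  have hlt := hgap.trans_lt ENNReal.ofReal_lt_top
  refine ⟨integrable_toReal_of_lintegral_ne_top hm.aemeasurable hlt.ne, ?_⟩
  rw [integral_toReal hm.aemeasurable (ae_lt_top hm hlt.ne)]
  exact ENNReal.toReal_le_of_le_ofReal (hq.ε_pos s).le hgap

variable [IsProbabilityMeasure μ] (hrun : IsRun P A K q μ x l m) (hP : P.Standing)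
  (ho : P.OptimalPair xs ls) (hq : q.Valid P) (hηρ : q.η < q.ρ)
  (hgap : ∀ s, ∫⁻ ω, P.gap (q.inner x l s ω) (x s ω) ∂μ ≤ ENNReal.ofReal (q.ε s))
include hrun hP ho hq hηρ hgap

theorem integrable_value (s : ℕ) :
    Integrable (fun ω => (P.F (x s ω)).toReal - P.optVal.toReal) μ := by
  have hD := hrun.l2Le_step hP ho hq hηρ hgap s
  have hR := hrun.l2Le_dist hP ho hq hηρ hgap s
  have hG := (hrun.integrable_gap hP ho hq (hgap s)).1
  have hU := hG.add ((((hR.integrable_sq.const_mul (1 / 2)).add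
    (hD.integrable_sq.const_mul (1 / 2))).add
    (integrable_const (‖ls‖ ^ 2 + (P.Lh₁ : ℝ) ^ 2))).const_mul (q.β s))
  have hL := (hD.integrable.const_mul (‖ls.snd‖ * q.β s)).neg
  have hm : Measurable fun ω => (P.F (x s ω)).toReal - P.optVal.toReal :=
    (hP.measurable_F.comp (hrun.measurable_x s)).ereal_toReal.sub_const _
  refine integrable_of_le_of_le hm.aestronglyMeasurable ?_ ?_ hL hU
  · filter_upwards [hrun.ae_mem_of_lintegral_le hP ho hq (hgap s)] with ω hω
    exact hrun.value_ge hP ho hq hω.2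
  · filter_upwards [hrun.ae_mem_of_lintegral_le hP ho hq (hgap s)] with ω hω
    exact hrun.value_le hP ho hq hω.2

theorem integral_value_le (s : ℕ) :
    ∫ ω, ((P.F (x s ω)).toReal - P.optVal.toReal) ∂μ
      ≤ q.ρ ^ (s + 1) * (q.ε₀ + 2 * (P.Lh₁ : ℝ) ^ 2 * q.β₀ + c₀ q xs ls * q.β₀) := by
  have hD := hrun.l2Le_step hP ho hq hηρ hgap s
  have hR := hrun.l2Le_dist hP ho hq hηρ hgap s
  obtain ⟨hG, hGe⟩ := hrun.integrable_gap hP ho hq (hgap s)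
  have i1 := hR.integrable_sq.const_mul (1 / 2)
  have i2 := hD.integrable_sq.const_mul (1 / 2)
  have i3 : Integrable (fun _ : Ω => ‖ls‖ ^ 2 + (P.Lh₁ : ℝ) ^ 2) μ := integrable_const _
  have h1 : ∫ ω, ((P.F (x s ω)).toReal - P.optVal.toReal) ∂μ
      ≤ ∫ ω, ((P.gap (q.inner x l s ω) (x s ω)).toReal
      + q.β s * (1 / 2 * ‖pd q x l s ω - WithLp.toLp 2 (xs, ls)‖ ^ 2
        + 1 / 2 * ‖pd q x l (s + 1) ω - pd q x l s ω‖ ^ 2 + (‖ls‖ ^ 2 + P.Lh₁ ^ 2))) ∂μ := by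
    refine integral_mono_ae (hrun.integrable_value hP ho hq hηρ hgap s)
      (hG.add (((i1.add i2).add i3).const_mul (q.β s))) ?_
    filter_upwards [hrun.ae_mem_of_lintegral_le hP ho hq (hgap s)] with ω hω
    exact hrun.value_le hP ho hq hω.2
  have i12 : Integrable (fun ω => 1 / 2 * ‖pd q x l s ω - WithLp.toLp 2 (xs, ls)‖ ^ 2
      + 1 / 2 * ‖pd q x l (s + 1) ω - pd q x l s ω‖ ^ 2) μ := i1.add i2
  have i123 : Integrable (fun ω => q.β s * (1 / 2 * ‖pd q x l s ω - WithLp.toLp 2 (xs, ls)‖ ^ 2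
      + 1 / 2 * ‖pd q x l (s + 1) ω - pd q x l s ω‖ ^ 2 + (‖ls‖ ^ 2 + (P.Lh₁ : ℝ) ^ 2))) μ :=
    (i12.add i3).const_mul _
  rw [integral_add hG i123, integral_const_mul,
    integral_add i12 i3, integral_add i1 i2, integral_const_mul, integral_const_mul,
    integral_const, probReal_univ, one_smul] at h1
  have hr := hq.rad_nonneg hηρ (xs := xs) (ls := ls)
  have h2 := hD.integral_sq_le hr
  have h3 := hR.integral_sq_le hr
  have h4 := hq.rad_sq_le hηρ (xs := xs) (ls := ls)
  have hc := hq.c₀_pos hηρ (xs := xs) (ls := ls)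
  have hβ := hq.β_pos s
  have hρs := pow_pos hq.ρ_pos s
  have h5 : q.ε s ≤ q.β s * (q.ε₀ / q.β₀) := by
    have : q.β s * (q.ε₀ / q.β₀) = q.ε₀ * q.ρ ^ s := by
      rw [Params.β]; field_simp [hq.β₀_pos.ne']
    rw [this, Params.ε]
    exact mul_le_mul_of_nonneg_left (pow_le_pow_left₀ hq.η_pos.le hηρ.le s) hq.ε₀_pos.le
  have h6 : q.ε₀ / q.β₀ + (1 / 2 * q.rad xs ls ^ 2 + 1 / 2 * q.rad xs ls ^ 2
      + (‖ls‖ ^ 2 + (P.Lh₁ : ℝ) ^ 2)) ≤ c₀ q xs ls / 2 + (P.Lh₁ : ℝ) ^ 2 := by linarith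
  have h7 := mul_le_mul_of_nonneg_left h6 hβ.le
  have h8 : q.β s * ((1 / 2 * ∫ ω, ‖pd q x l s ω - WithLp.toLp 2 (xs, ls)‖ ^ 2 ∂μ)
      + (1 / 2 * ∫ ω, ‖pd q x l (s + 1) ω - pd q x l s ω‖ ^ 2 ∂μ)
      + (‖ls‖ ^ 2 + (P.Lh₁ : ℝ) ^ 2)) ≤ q.β s * (1 / 2 * q.rad xs ls ^ 2 + 1 / 2 * q.rad xs ls ^ 2
      + (‖ls‖ ^ 2 + (P.Lh₁ : ℝ) ^ 2)) := by gcongr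
  have h9 : q.β s * (c₀ q xs ls / 2 + (P.Lh₁ : ℝ) ^ 2)
      ≤ q.ρ ^ (s + 1) * (q.ε₀ + 2 * (P.Lh₁ : ℝ) ^ 2 * q.β₀ + c₀ q xs ls * q.β₀) := by
    have h10 : 0 ≤ q.β₀ * (c₀ q xs ls / 2 + (P.Lh₁ : ℝ) ^ 2) :=
      mul_nonneg hq.β₀_pos.le (by positivity)
    -- The bound holds with c₀/2 + L² and, as ρ ≥ 1/2, this is at most ρ(c₀ + 2L²): the extra power
    -- of ρ is gained here for the upper value bound.
    have h11 : q.β₀ * (c₀ q xs ls / 2 + (P.Lh₁ : ℝ) ^ 2)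
        ≤ q.ρ * (q.ε₀ + 2 * (P.Lh₁ : ℝ) ^ 2 * q.β₀ + c₀ q xs ls * q.β₀) := by
      nlinarith [hq.ρ_gt, mul_pos hq.ρ_pos hq.ε₀_pos]
    calc _ = q.ρ ^ s * (q.β₀ * (c₀ q xs ls / 2 + (P.Lh₁ : ℝ) ^ 2)) := by rw [Params.β]; ring
      _ ≤ q.ρ ^ s * (q.ρ * (q.ε₀ + 2 * (P.Lh₁ : ℝ) ^ 2 * q.β₀ + c₀ q xs ls * q.β₀)) := by gcongr
      _ = _ := by ring
  linarith

theorem integral_step_le (s : ℕ) : q.β (s + 1) * ∫ ω, ‖pd q x l (s + 2) ω - pd q x l (s + 1) ω‖ ∂μ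
    ≤ q.ρ ^ (s + 2) * (q.β₀ * √(c₀ q xs ls)) := by
  have h := (hrun.l2Le_step_succ hP ho hq hηρ hgap s).integral_le
    (mul_nonneg hq.ρ_pos.le (Real.sqrt_nonneg _))
  refine (mul_le_mul_of_nonneg_left h (hq.β_pos _).le).trans_eq ?_
  rw [Params.β]; ring

/-- After at least one outer step, the iterates are `c₁ ρ^{s+1}`-optimal in expectation. -/
theorem epsOptimal {s : ℕ} {ε : ℝ} (hs : q.ρ ^ (s + 2) * c₁ P q xs ls ≤ ε) :
    EpsOptimal P μ (x (s + 1)) ε := by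
  have hD := hrun.l2Le_step hP ho hq hηρ hgap (s + 1)
  have hstep := hrun.integral_step_le hP ho hq hηρ hgap s
  have hint := hrun.integrable_value hP ho hq hηρ hgap (s + 1)
  have hae := hrun.ae_mem_of_lintegral_le hP ho hq (hgap (s + 1))
  have hρs := pow_pos hq.ρ_pos (s + 2)
  have hdist : Integrable (fun ω => Metric.infDist (P.p₂ (x (s + 1) ω)) P.𝒦) μ := by
    have hm : Measurable fun ω => Metric.infDist (P.p₂ (x (s + 1) ω)) P.𝒦 := by
      have h := ((Metric.continuous_infDist_pt P.𝒦).comp hP.p₂_diff.continuous).measurable.comp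
        (hrun.measurable_x (s + 1))
      exact h
    refine (hD.integrable.const_mul (q.β (s + 1))).mono' hm.aestronglyMeasurable
      (Filter.Eventually.of_forall fun ω => ?_)
    rw [Real.norm_of_nonneg Metric.infDist_nonneg]
    exact hrun.infDist_le hP hq (s + 1) ω
  refine ⟨?_, ?_, ?_, hdist, ?_⟩
  · filter_upwards [hae] with ω hω
    rw [hP.F_eq hω.2]
    exact EReal.coe_ne_top _
  · have h := hint.add (integrable_const P.optVal.toReal)
    exact h.congr (Filter.Eventually.of_forall fun ω => sub_add_cancel _ _)
  -- The three entries of the maximum `c₁` bound, in order, the value from above, the value from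
  -- below, and the infeasibility.
  · rw [abs_le]
    constructor
    · have h1 : ∫ ω, -(‖ls.snd‖ * q.β (s + 1) * ‖pd q x l (s + 2) ω - pd q x l (s + 1) ω‖) ∂μ
          ≤ ∫ ω, ((P.F (x (s + 1) ω)).toReal - P.optVal.toReal) ∂μ := by
        refine integral_mono_ae (hD.integrable.const_mul _).neg hint ?_
        filter_upwards [hae] with ω hω
        exact hrun.value_ge hP ho hq hω.2
      rw [integral_neg, integral_const_mul] at h1
      have h2 := mul_le_mul_of_nonneg_left hstep (norm_nonneg ls.snd)
      have h3 : q.ρ ^ (s + 2) * (q.β₀ * ‖ls.snd‖ * √(c₀ q xs ls)) ≤ q.ρ ^ (s + 2) * c₁ P q xs ls :=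
        mul_le_mul_of_nonneg_left ((le_max_left _ _).trans (le_max_right _ _)) hρs.le
      linarith
    · refine (hrun.integral_value_le hP ho hq hηρ hgap (s + 1)).trans (le_trans ?_ hs)
      exact mul_le_mul_of_nonneg_left (le_max_left _ _) hρs.le
  · have h1 : ∫ ω, Metric.infDist (P.p₂ (x (s + 1) ω)) P.𝒦 ∂μ
        ≤ ∫ ω, q.β (s + 1) * ‖pd q x l (s + 2) ω - pd q x l (s + 1) ω‖ ∂μ :=
      integral_mono hdist (hD.integrable.const_mul _) fun ω => hrun.infDist_le hP hq (s + 1) ω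
    rw [integral_const_mul] at h1
    refine h1.trans (hstep.trans (le_trans ?_ hs))
    exact mul_le_mul_of_nonneg_left ((le_max_right _ _).trans (le_max_right _ _)) hρs.le

end IsRun

end IPALM

end

/-! ### Expected number of inner iterations in one outer step. -/

noncomputable section

namespace IPALM

variable {n d₁ d₂ : ℕ} {P : Problem n d₁ d₂}

/-- The least `k` with `a ≤ 2^⌊k/K⌋ e / 2` is at most `K (log₂(2a/e) + 2)`. -/
theorem le_of_isLeast {K a e : ℝ} (hK : 1 ≤ K) (he : 0 < e) (ha : e ≤ 2 * a) {m : ℕ}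
    (hm : IsLeast {k : ℕ | a ≤ 2 ^ ⌊(k : ℝ) / K⌋₊ * (e / 2)} m) :
    (m : ℝ) ≤ K * (Real.logb 2 (2 * a / e) + 2) := by
  have hK0 : 0 < K := by linarith
  set Y := 2 * a / e with hY
  have hY1 : 1 ≤ Y := by rwa [hY, one_le_div he]
  have hlog : 0 ≤ Real.logb 2 Y := Real.logb_nonneg one_lt_two hY1
  -- The candidate count is ⌈jK⌉. The two roundings produce the `+ 2`, the second one thanks to K ≥
  -- 1.
  set j := ⌈Real.logb 2 Y⌉₊
  have hj := Nat.ceil_lt_add_one hlog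
  have hmem : ⌈(j : ℝ) * K⌉₊ ∈ {k : ℕ | a ≤ 2 ^ ⌊(k : ℝ) / K⌋₊ * (e / 2)} := by
    have h1 : j ≤ ⌊(⌈(j : ℝ) * K⌉₊ : ℝ) / K⌋₊ := by
      refine Nat.le_floor ?_
      rw [le_div_iff₀ hK0]
      exact Nat.le_ceil _
    have h2 : Y ≤ 2 ^ j := by
      rw [← Real.rpow_natCast, ← Real.logb_le_iff_le_rpow one_lt_two (by linarith)]
      exact Nat.le_ceil _
    have h3 : (2 : ℝ) ^ j ≤ 2 ^ ⌊(⌈(j : ℝ) * K⌉₊ : ℝ) / K⌋₊ := pow_le_pow_right₀ one_le_two h1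
    have h4 : a = Y * (e / 2) := by rw [hY]; field_simp
    change a ≤ _
    rw [h4]
    exact mul_le_mul_of_nonneg_right (h2.trans h3) (by positivity)
  have h5 : (m : ℝ) ≤ (⌈(j : ℝ) * K⌉₊ : ℝ) := Nat.cast_le.2 (hm.2 hmem)
  have h6 := Nat.ceil_lt_add_one (a := (j : ℝ) * K) (by positivity)
  have h7 : (j : ℝ) * K ≤ (Real.logb 2 Y + 1) * K := by gcongr
  linarith

/-- The tangent line of the concave logarithm at `c`, in the role of Jensen's inequality: when `c`
bounds the mean of a random `y`, the correction has nonpositive expectation. -/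
theorem logb_two_le_add_div {c y : ℝ} (hc : 0 < c) (hy : 0 < y) :
    Real.logb 2 y ≤ Real.logb 2 c + (y / c - 1) / Real.log 2 := by
  have h := Real.log_le_sub_one_of_pos (div_pos hy hc)
  rw [Real.log_div hy.ne' hc.ne'] at h
  have h2 := Real.log_pos one_lt_two
  rw [Real.logb, Real.logb, ← add_div]
  gcongr
  linarith

/-- The constant bounding `E M_s / β_s`. -/
def Params.Mconst (P : Problem n d₁ d₂) (q : Params n d₁ d₂) (xs : Euc n) (ls : Dual d₁ d₂) : ℝ :=
  (11 + 2 * (q.ρ ^ 2)⁻¹) * ((P.Lh₁ : ℝ) ^ 2 + 4 * c₀ q xs ls) + 4 * (2 * q.ρ - 1)⁻¹ * c₀ q xs ls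

/-- The argument of the logarithm in `c₂`. -/
def Params.C (P : Problem n d₁ d₂) (q : Params n d₁ d₂) (xs : Euc n) (ls : Dual d₁ d₂) : ℝ :=
  4 / q.η + 2 * q.β₀ * q.Mconst P xs ls / (q.ε₀ * q.η)

theorem c₂_eq (q : Params n d₁ d₂) (xs : Euc n) (ls : Dual d₁ d₂) :
    c₂ P q xs ls = Real.logb 2 (q.C P xs ls) + 1 := rfl

section

variable {q : Params n d₁ d₂} {xs : Euc n} {ls : Dual d₁ d₂}

theorem Params.Valid.Mconst_pos (hq : q.Valid P) (hηρ : q.η < q.ρ) : 0 < q.Mconst P xs ls := by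
  have hc := hq.c₀_pos hηρ (xs := xs) (ls := ls)
  have h1 : 0 < 2 * q.ρ - 1 := by linarith [hq.ρ_gt]
  have h2 := hq.ρ_pos
  unfold Params.Mconst
  positivity

theorem Params.Valid.four_le_C (hq : q.Valid P) (hηρ : q.η < q.ρ) : 4 ≤ q.C P xs ls := by
  have h1 := hq.Mconst_pos hηρ (xs := xs) (ls := ls)
  have h2 := hq.η_pos
  have h3 := hq.ε₀_pos
  have h4 := hq.β₀_pos
  have h5 : 4 ≤ 4 / q.η := by
    rw [le_div_iff₀ h2]; linarith [hq.η_lt]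
  have h6 : 0 ≤ 2 * q.β₀ * q.Mconst P xs ls / (q.ε₀ * q.η) := by positivity
  unfold Params.C
  linarith

/-- The mean of `M_s` decays like ρ^s but the tolerance like η^s; their ratio (ρ/η)^s makes the
iteration count grow linearly in `s`. -/
theorem Params.Valid.div_ε_succ_le (hq : q.Valid P) (hηρ : q.η < q.ρ) (s : ℕ) :
    2 * (2 * q.ε s + q.β s * q.Mconst P xs ls) / q.ε (s + 1) ≤ (q.ρ / q.η) ^ s * q.C P xs ls := by
  have h1 := hq.Mconst_pos hηρ (xs := xs) (ls := ls)
  have h2 := hq.η_pos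
  have h3 := hq.ε₀_pos
  have h4 := hq.β₀_pos
  have h5 : 1 ≤ (q.ρ / q.η) ^ s := one_le_pow₀ ((one_le_div h2).2 hηρ.le)
  have e : 2 * (2 * q.ε s + q.β s * q.Mconst P xs ls) / q.ε (s + 1)
      = 4 / q.η + (q.ρ / q.η) ^ s * (2 * q.β₀ * q.Mconst P xs ls / (q.ε₀ * q.η)) := by
    rw [Params.ε, Params.ε, Params.β, div_pow]
    have := pow_pos h2 s
    field_simp
    ring
  rw [e, Params.C, mul_add]
  have h6 : 1 * (4 / q.η) ≤ (q.ρ / q.η) ^ s * (4 / q.η) := by gcongr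
  linarith

end

namespace IsRun

variable {A : Solver n d₁ d₂} {K : ℕ → ℝ} {q : Params n d₁ d₂} {Ω : Type*} [mΩ : MeasurableSpace Ω]
  {μ : Measure Ω} {x : ℕ → Ω → Euc n} {l : ℕ → Ω → Dual d₁ d₂} {m : ℕ → Ω → ℕ}
  {xs : Euc n} {ls : Dual d₁ d₂}

theorem measurable_Ms (hrun : IsRun P A K q μ x l m) (hP : P.Standing) (hq : q.Valid P) (s : ℕ) :
    Measurable (Ms P q x l s) := by
  have h1 := hrun.measurable_l s
  have h2 := hrun.measurable_l (s + 1)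
  have h3 : Measurable fun ω => P.Lam (P.p (x s ω)) (l (s + 1) ω) (q.β (s + 1)) :=
    measurable_lam_next hP (hq.β_pos (s + 1)) (hrun.measurable_x s) h2
  have h4 := hrun.measurable_prev s
  have h5 := hrun.measurable_x s
  have f1 : Measurable fun ω => (l s ω).fst := Problem.continuous_fst_dual.measurable.comp h1
  have f2 : Measurable fun ω => (l (s + 1) ω).fst := Problem.continuous_fst_dual.measurable.comp h2
  have s1 : Measurable fun ω => (l s ω).snd := Problem.continuous_snd_dual.measurable.comp h1
  have s2 : Measurable fun ω => (l (s + 1) ω).snd := Problem.continuous_snd_dual.measurable.comp h2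
  have a1 := ((h2.sub h1).norm.pow_const 2).const_mul (q.β s)
  have a2 := ((h3.sub h2).norm.pow_const 2).const_mul ((q.β s - q.β (s + 1)) / 2)
  have a3 := ((h4.sub h5).norm.pow_const 2).const_mul (q.β s ^ 2 / (2 * q.β (s + 1) - q.β s))
  have a4 := (((f1.const_smul (q.β s)).sub (f2.const_smul (q.β (s + 1)))).norm.const_add
    ((q.β s + q.β (s + 1)) * P.Lh₁)).pow_const 2
  have a5 := ((s1.const_smul (q.β s)).sub (s2.const_smul (q.β (s + 1)))).norm.pow_const 2
  have a6 := ((a1.add a2).add a3).add ((h2.sub h1).norm.mul (a4.add a5).sqrt)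
  exact a6

theorem Ms_le (hrun : IsRun P A K q μ x l m) (hP : P.Standing) (hq : q.Valid P) (s : ℕ) (ω : Ω) :
    Ms P q x l s ω ≤ q.β s * ((2 + (q.ρ ^ 2)⁻¹ + (2 * q.ρ - 1)⁻¹)
        * ‖pd q x l (s + 1) ω - pd q x l s ω‖ ^ 2
      + 2 * ‖l s ω‖ ^ 2 + 2 * ‖l (s + 1) ω‖ ^ 2 + 6 * P.Lh₁ ^ 2) := by
  have h := hP.Mterm_le (hq.β_pos s) hq.ρ_gt hq.ρ_lt (q.prev x s ω) (x s ω) (l s ω)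
  rw [← hrun.l_succ s ω, ← Params.β_succ] at h
  have h1 := norm_sq_pd (pd q x l (s + 1) ω - pd q x l s ω)
  change _ = ‖x s ω - q.prev x s ω‖ ^ 2 + ‖l (s + 1) ω - l s ω‖ ^ 2 at h1
  rw [h1]
  refine h.trans (le_of_eq ?_)
  ring

theorem m_le_iff (hrun : IsRun P A K q μ x l m) (hq : q.Valid P) (hK : ∀ s, 1 ≤ K s) (s : ℕ)
    (ω : Ω) (k : ℕ) : m (s + 1) ω ≤ k ↔
      2 * q.ε s + Ms P q x l s ω ≤ 2 ^ ⌊(k : ℝ) / K (s + 1)⌋₊ * (q.ε (s + 1) / 2) := by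
  constructor
  · intro h
    refine (hrun.m_succ s ω).1.trans ?_
    have h1 : 0 < K (s + 1) := one_pos.trans_le (hK _)
    have h2 := hq.ε_pos (s + 1)
    have h3 : ⌊(m (s + 1) ω : ℝ) / K (s + 1)⌋₊ ≤ ⌊(k : ℝ) / K (s + 1)⌋₊ := by gcongr
    exact mul_le_mul_of_nonneg_right (pow_le_pow_right₀ one_le_two h3) (by positivity)
  · intro h
    exact (hrun.m_succ s ω).2 h

/-- Measurability of `m` is not part of `IsRun`; it follows because minimality turns each sublevel
set into a condition on `M_s`. -/
theorem measurable_m_succ (hrun : IsRun P A K q μ x l m) (hP : P.Standing) (hq : q.Valid P)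
    (hK : ∀ s, 1 ≤ K s) (s : ℕ) : Measurable (m (s + 1)) := by
  refine measurable_of_Iic fun k => ?_
  have e : m (s + 1) ⁻¹' Iic k = {ω | 2 * q.ε s + Ms P q x l s ω
      ≤ 2 ^ ⌊(k : ℝ) / K (s + 1)⌋₊ * (q.ε (s + 1) / 2)} := by
    ext ω
    exact hrun.m_le_iff hq hK s ω k
  rw [e]
  exact measurableSet_le ((hrun.measurable_Ms hP hq s).const_add _) measurable_const

theorem m_succ_le (hrun : IsRun P A K q μ x l m) (hq : q.Valid P) (hK : ∀ s, 1 ≤ K s) (s : ℕ)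
    (ω : Ω) {c : ℝ} (hc : 0 < c) : (m (s + 1) ω : ℝ) ≤ K (s + 1) * (Real.logb 2 c
      + (2 * (2 * q.ε s + Ms P q x l s ω) / q.ε (s + 1) / c - 1) / Real.log 2 + 2) := by
  have hM := Ms_nonneg hq s ω (x := x) (l := l)
  have h1 := hq.ε_pos s
  have h2 := hq.ε_pos (s + 1)
  have h3 : q.ε (s + 1) ≤ q.ε s := by
    rw [Params.ε, Params.ε, pow_succ]
    have := mul_pos hq.ε₀_pos (pow_pos hq.η_pos s)
    nlinarith [hq.η_lt]
  have h4 : q.ε (s + 1) ≤ 2 * (2 * q.ε s + Ms P q x l s ω) := by linarith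
  refine (le_of_isLeast (hK (s + 1)) h2 h4 (hrun.m_succ s ω)).trans ?_
  refine mul_le_mul_of_nonneg_left ?_ (zero_le_one.trans (hK _))
  have := logb_two_le_add_div hc (y := 2 * (2 * q.ε s + Ms P q x l s ω) / q.ε (s + 1))
    (by positivity)
  exact add_le_add_left this _

variable [IsProbabilityMeasure μ] (hrun : IsRun P A K q μ x l m) (hP : P.Standing)
  (ho : P.OptimalPair xs ls) (hq : q.Valid P) (hηρ : q.η < q.ρ)
  (hgap : ∀ s, ∫⁻ ω, P.gap (q.inner x l s ω) (x s ω) ∂μ ≤ ENNReal.ofReal (q.ε s))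
include hrun hP ho hq hηρ hgap

theorem integral_multiplier_sq_le (s : ℕ) : ∫ ω, ‖l s ω‖ ^ 2 ∂μ ≤ c₀ q xs ls := by
  have hr := hq.rad_nonneg hηρ (xs := xs) (ls := ls)
  have h1 := (hrun.l2Le_multiplier hP ho hq hηρ hgap s).integral_sq_le
    (add_nonneg hr (norm_nonneg _))
  have h2 := hq.rad_sq_le hηρ (xs := xs) (ls := ls)
  have h3 : 0 < q.ε₀ / q.β₀ := div_pos hq.ε₀_pos hq.β₀_pos
  nlinarith [sq_nonneg (q.rad xs ls - ‖ls‖)]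

theorem integrable_integral_Ms_le (s : ℕ) : Integrable (Ms P q x l s) μ ∧
    ∫ ω, Ms P q x l s ω ∂μ ≤ q.β s * q.Mconst P xs ls := by
  have hD := hrun.l2Le_step hP ho hq hηρ hgap s
  have hl := hrun.l2Le_multiplier hP ho hq hηρ hgap s
  have hl' := hrun.l2Le_multiplier hP ho hq hηρ hgap (s + 1)
  set a := 2 + (q.ρ ^ 2)⁻¹ + (2 * q.ρ - 1)⁻¹ with ha
  have i1 := hD.integrable_sq.const_mul a
  have i2 := hl.integrable_sq.const_mul 2
  have i3 := hl'.integrable_sq.const_mul 2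
  have i4 : Integrable (fun _ : Ω => 6 * (P.Lh₁ : ℝ) ^ 2) μ := integrable_const _
  have i12 : Integrable (fun ω => a * ‖pd q x l (s + 1) ω - pd q x l s ω‖ ^ 2
      + 2 * ‖l s ω‖ ^ 2) μ := i1.add i2
  have i123 : Integrable (fun ω => a * ‖pd q x l (s + 1) ω - pd q x l s ω‖ ^ 2
      + 2 * ‖l s ω‖ ^ 2 + 2 * ‖l (s + 1) ω‖ ^ 2) μ := i12.add i3
  have i : Integrable (fun ω => q.β s * (a * ‖pd q x l (s + 1) ω - pd q x l s ω‖ ^ 2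
      + 2 * ‖l s ω‖ ^ 2 + 2 * ‖l (s + 1) ω‖ ^ 2 + 6 * (P.Lh₁ : ℝ) ^ 2)) μ :=
    (i123.add i4).const_mul _
  have hM : Integrable (Ms P q x l s) μ :=
    i.mono' (hrun.measurable_Ms hP hq s).aestronglyMeasurable
      (Filter.Eventually.of_forall fun ω => by
        rw [Real.norm_of_nonneg (Ms_nonneg hq s ω)]
        exact hrun.Ms_le hP hq s ω)
  refine ⟨hM, ?_⟩
  have h := integral_mono hM i fun ω => hrun.Ms_le hP hq s ω
  rw [integral_const_mul, integral_add i123 i4, integral_add i12 i3, integral_add i1 i2,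
    integral_const_mul, integral_const_mul, integral_const_mul, integral_const, probReal_univ,
    one_smul] at h
  have hρ := hq.ρ_pos
  have hρ' : 0 < 2 * q.ρ - 1 := by linarith [hq.ρ_gt]
  have hβ := hq.β_pos s
  refine h.trans (mul_le_mul_of_nonneg_left ?_ hβ.le)
  have h1 := hD.integral_sq_le (hq.rad_nonneg hηρ)
  have h2 := hrun.integral_multiplier_sq_le hP ho hq hηρ hgap s
  have h3 := hrun.integral_multiplier_sq_le hP ho hq hηρ hgap (s + 1)
  have h4 := hq.rad_sq_le hηρ (xs := xs) (ls := ls)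
  have h5 : 0 < q.ε₀ / q.β₀ := div_pos hq.ε₀_pos hq.β₀_pos
  have h6 : ∫ ω, ‖pd q x l (s + 1) ω - pd q x l s ω‖ ^ 2 ∂μ ≤ c₀ q xs ls / 2 := by
    nlinarith [sq_nonneg ‖ls‖]
  have ha0 : 0 ≤ a := by positivity
  have h7 := mul_le_mul_of_nonneg_left h6 ha0
  have hc := hq.c₀_pos hηρ (xs := xs) (ls := ls)
  have hr2 : 0 < (q.ρ ^ 2)⁻¹ := by positivity
  have hr3 : 0 < (2 * q.ρ - 1)⁻¹ := by positivity
  rw [ha] at h7 ⊢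
  unfold Params.Mconst
  have := mul_pos hr2 hc
  have := mul_pos hr3 hc
  have := mul_nonneg hr2.le (sq_nonneg (P.Lh₁ : ℝ))
  nlinarith [sq_nonneg (P.Lh₁ : ℝ)]

/-- Bound on the expected number of inner iterations of a step. -/
theorem integrable_integral_m_succ_le (hK : ∀ s, 1 ≤ K s) (s : ℕ) :
    Integrable (fun ω => (m (s + 1) ω : ℝ)) μ ∧
    ∫ ω, (m (s + 1) ω : ℝ) ∂μ
      ≤ K (s + 1) * (s * Real.logb 2 (q.ρ / q.η) + c₂ P q xs ls + 1) := by
  obtain ⟨hM, hMle⟩ := hrun.integrable_integral_Ms_le hP ho hq hηρ hgap s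
  have hC := hq.four_le_C hηρ (xs := xs) (ls := ls)
  have hr : 0 < q.ρ / q.η := div_pos hq.ρ_pos hq.η_pos
  -- An upper bound for the mean of the argument of the logarithm, hence the point at which the
  -- tangent is taken.
  set c := (q.ρ / q.η) ^ s * q.C P xs ls with hcdef
  have hc : 0 < c := by positivity
  have hle := fun ω => hrun.m_succ_le hq hK s ω hc
  have i1 : Integrable (fun ω => 2 * (2 * q.ε s + Ms P q x l s ω) / q.ε (s + 1)) μ :=
    (((integrable_const _).add hM).const_mul 2).div_const _
  have i0 : Integrable (fun ω =>
      (2 * (2 * q.ε s + Ms P q x l s ω) / q.ε (s + 1) / c - 1) / Real.log 2) μ :=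
    ((i1.div_const _).sub (integrable_const _)).div_const _
  have i2 : Integrable (fun ω => Real.logb 2 c
      + (2 * (2 * q.ε s + Ms P q x l s ω) / q.ε (s + 1) / c - 1) / Real.log 2) μ :=
    (integrable_const _).add i0
  have i : Integrable (fun ω => K (s + 1) * (Real.logb 2 c
      + (2 * (2 * q.ε s + Ms P q x l s ω) / q.ε (s + 1) / c - 1) / Real.log 2 + 2)) μ :=
    (i2.add (integrable_const _)).const_mul _
  have hmeas : Measurable fun ω => (m (s + 1) ω : ℝ) :=
    (measurable_of_countable _).comp (hrun.measurable_m_succ hP hq hK s)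
  have hm : Integrable (fun ω => (m (s + 1) ω : ℝ)) μ :=
    i.mono' hmeas.aestronglyMeasurable (Filter.Eventually.of_forall fun ω => by
      rw [Real.norm_of_nonneg (Nat.cast_nonneg _)]
      exact hle ω)
  refine ⟨hm, (integral_mono hm i hle).trans ?_⟩
  rw [integral_const_mul]
  refine mul_le_mul_of_nonneg_left ?_ (zero_le_one.trans (hK _))
  rw [integral_add i2 (integrable_const _), integral_add (integrable_const _) i0, integral_div,
    integral_sub (i1.div_const _) (integrable_const _), integral_div, integral_div,
    integral_const_mul, integral_add (integrable_const _) hM]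
  simp only [integral_const, probReal_univ, one_smul]
  have h1 : 2 * (2 * q.ε s + ∫ ω, Ms P q x l s ω ∂μ) / q.ε (s + 1) ≤ c := by
    refine le_trans ?_ (hq.div_ε_succ_le hηρ s)
    have := hq.ε_pos (s + 1)
    gcongr
  have h2 : (2 * (2 * q.ε s + ∫ ω, Ms P q x l s ω ∂μ) / q.ε (s + 1) / c - 1) / Real.log 2 ≤ 0 := by
    refine div_nonpos_of_nonpos_of_nonneg ?_ (Real.log_pos one_lt_two).le
    rw [sub_nonpos, div_le_one hc]
    exact h1
  have h3 : Real.logb 2 c = s * Real.logb 2 (q.ρ / q.η) + Real.logb 2 (q.C P xs ls) := by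
    rw [hcdef, Real.logb_mul (pow_pos hr s).ne' (by linarith), Real.logb_pow]
  rw [c₂_eq]
  linarith

end IsRun

end IPALM

end

/-! ### Summation over outer steps and choice of the final index. -/

noncomputable section

namespace IPALM

variable {n d₁ d₂ : ℕ} {P : Problem n d₁ d₂}

theorem sum_inv_pow_le {r : ℝ} (hr : 0 < r) (hr1 : r < 1) (s : ℕ) :
    ∑ t ∈ Finset.range s, r⁻¹ ^ (t + 1) ≤ r⁻¹ ^ s / (1 - r) := by
  have h1 : 0 < 1 - r := by linarith
  induction s with
  | zero => simp [h1.le]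
  | succ s ih =>
    rw [Finset.sum_range_succ]
    refine (add_le_add_left ih _).trans_eq ?_
    have h2 : r⁻¹ ^ s = r⁻¹ ^ (s + 1) * r := by rw [pow_succ]; field_simp
    rw [h2]
    field_simp
    ring

/-- Summing the inner complexities `ϖ/β_t^ℓ + ς` over the outer iterations. -/
theorem sum_complexity_le {β₀ ρ ϖ ς ℓ c ε : ℝ} (hβ₀ : 0 < β₀) (hρ : 0 < ρ) (hρ1 : ρ < 1)
    (hϖ : 0 < ϖ) (hς : 0 ≤ ς) (hℓ : 0 < ℓ) (hc : 0 < c) (hε : 0 < ε) {s : ℕ}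
    (hs : ρ⁻¹ ^ s ≤ c / ε) :
    ∑ t ∈ Finset.range s, (ϖ / (β₀ * ρ ^ (t + 1)) ^ ℓ + ς)
      ≤ (ς * c ^ ℓ / (ρ ^ ℓ * ℓ * Real.log (1 / ρ))
        + ϖ * c ^ ℓ / (β₀ ^ ℓ * (1 - ρ ^ ℓ))) / ε ^ ℓ := by
  set r := ρ ^ ℓ with hr
  have hr0 : 0 < r := Real.rpow_pos_of_pos hρ ℓ
  have hr1 : r < 1 := Real.rpow_lt_one hρ.le hρ1 hℓ
  have hb : 0 < β₀ ^ ℓ := Real.rpow_pos_of_pos hβ₀ ℓ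
  have hεl : 0 < ε ^ ℓ := Real.rpow_pos_of_pos hε ℓ
  have hcl : 0 < c ^ ℓ := Real.rpow_pos_of_pos hc ℓ
  have hlog : 0 < Real.log (1 / ρ) := Real.log_pos ((one_lt_div hρ).2 hρ1)
  have hpow : r⁻¹ ^ s = (ρ⁻¹ ^ s) ^ ℓ := by
    rw [hr, ← Real.inv_rpow hρ.le, ← Real.rpow_natCast, ← Real.rpow_natCast,
      ← Real.rpow_mul (inv_nonneg.2 hρ.le), ← Real.rpow_mul (inv_nonneg.2 hρ.le), mul_comm]
  have hrs : r⁻¹ ^ s ≤ c ^ ℓ / ε ^ ℓ := by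
    rw [hpow, ← Real.div_rpow hc.le hε.le]
    exact Real.rpow_le_rpow (by positivity) hs hℓ.le
  have e : ∀ t : ℕ, ϖ / (β₀ * ρ ^ (t + 1)) ^ ℓ = ϖ / β₀ ^ ℓ * r⁻¹ ^ (t + 1) := by
    intro t
    rw [Real.mul_rpow hβ₀.le (pow_pos hρ _).le, hr, ← Real.rpow_natCast, ← Real.rpow_mul hρ.le,
      mul_comm _ ℓ, Real.rpow_mul hρ.le, Real.rpow_natCast, inv_pow]
    field_simp
  have h1 : ∑ t ∈ Finset.range s, ϖ / (β₀ * ρ ^ (t + 1)) ^ ℓ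
      ≤ ϖ * c ^ ℓ / (β₀ ^ ℓ * (1 - r)) / ε ^ ℓ := by
    simp_rw [e]
    rw [← Finset.mul_sum]
    have h2 : 0 < 1 - r := by linarith
    calc _ ≤ ϖ / β₀ ^ ℓ * (c ^ ℓ / ε ^ ℓ / (1 - r)) := by
          gcongr
          exact (sum_inv_pow_le hr0 hr1 s).trans (by gcongr)
      _ = _ := by field_simp
  have h2 : (s : ℝ) * (ℓ * Real.log (1 / ρ)) ≤ c ^ ℓ / ε ^ ℓ := by
    have h3 : Real.log (r⁻¹ ^ s) = s * (ℓ * Real.log (1 / ρ)) := by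
      rw [Real.log_pow, Real.log_inv, hr, Real.log_rpow hρ, one_div, Real.log_inv]
      ring
    -- The constant part ς contributes `s` terms; log y ≤ y - 1 trades this count for a power of
    -- c/ε.
    have h4 := Real.log_le_sub_one_of_pos (x := r⁻¹ ^ s) (by positivity)
    linarith
  have h3 : (s : ℝ) * ς ≤ ς * c ^ ℓ / (r * ℓ * Real.log (1 / ρ)) / ε ^ ℓ := by
    have h4 : (s : ℝ) ≤ c ^ ℓ / ε ^ ℓ / (r * (ℓ * Real.log (1 / ρ))) := by
      rw [le_div_iff₀ (by positivity)]
      have : 0 ≤ (s : ℝ) * (ℓ * Real.log (1 / ρ)) := by positivity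
      nlinarith
    refine (mul_le_mul_of_nonneg_right h4 hς).trans_eq ?_
    field_simp
  rw [Finset.sum_add_distrib, Finset.sum_const, Finset.card_range, nsmul_eq_mul, add_div]
  linarith

theorem nat_le_log_div {ρ c ε : ℝ} (hρ : 0 < ρ) (hρ1 : ρ < 1) (hc : 0 < c) (hε : 0 < ε) {s : ℕ}
    (hs : ρ⁻¹ ^ s ≤ c / ε) : (s : ℝ) ≤ Real.log (c / (ε * ρ)) / Real.log (1 / ρ) := by
  have hlog : 0 < Real.log (1 / ρ) := Real.log_pos ((one_lt_div hρ).2 hρ1)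
  rw [le_div_iff₀ hlog, one_div, ← Real.log_pow]
  refine Real.log_le_log (by positivity) (hs.trans ?_)
  have : ε * ρ ≤ ε := mul_le_of_le_one_right hε.le hρ1.le
  gcongr

/-- Take the largest exponent with ρ^{-s} ≤ c/ε. It is at least 1 because c/ε ≥ 2 > 1/ρ, as required
by the two-step bound, which is available only from the second outer step on. It is therefore
written `s + 1`. -/
theorem exists_outer_index {ρ c ε : ℝ} (hρ : 1 / 2 < ρ) (hρ1 : ρ < 1) (hε : 0 < ε)
    (hc : 2 * ε ≤ c) : ∃ s : ℕ, ρ⁻¹ ^ (s + 1) ≤ c / ε ∧ ρ ^ (s + 2) * c ≤ ε := by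
  have hρ0 : 0 < ρ := by linarith
  obtain ⟨s, h1, h2⟩ := exists_nat_pow_near (x := c / ε) (y := ρ⁻¹)
    ((one_le_div hε).2 (by linarith)) ((one_lt_inv₀ hρ0).2 hρ1)
  rw [div_lt_iff₀ hε, inv_pow, inv_mul_eq_div, lt_div_iff₀ (pow_pos hρ0 _)] at h2
  cases s with
  | zero =>
    rw [zero_add, pow_one] at h2
    nlinarith [mul_le_mul_of_nonneg_right hc hρ0.le]
  | succ s => exact ⟨s, h1, by rw [mul_comm]; exact h2.le⟩

end IPALM

end

/-! ### Assembly of the complexity bound. -/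

theorem theorem3p2 {n d₁ d₂ : ℕ} (P : IPALM.Problem n d₁ d₂) (hP : P.Standing)
    (xs : IPALM.Euc n) (ls : IPALM.Dual d₁ d₂) (hopt : P.OptimalPair xs ls)
    (A : IPALM.Solver n d₁ d₂) (K : ℕ → ℝ)
    (q : IPALM.Params n d₁ d₂) (hq : q.Valid P) (hηρ : q.η < q.ρ)
    {Ω : Type*} [MeasurableSpace Ω] (μ : Measure Ω) [IsProbabilityMeasure μ]
    (x : ℕ → Ω → IPALM.Euc n) (l : ℕ → Ω → IPALM.Dual d₁ d₂) (m : ℕ → Ω → ℕ)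
    (hrun : IPALM.IsRun P A K q μ x l m)
    (hK : ∀ s, 1 ≤ K s)
    (hrate : ∀ s, ∀ᵐ ω ∂μ, IPALM.LinearRate P A (q.inner x l s ω) (K s))
    (ϖ ς ℓ : ℝ) (hϖ : 0 < ϖ) (hς : 0 ≤ ς) (hℓ : 0 < ℓ)
    (hKs : ∀ s, 1 ≤ s → K s ≤ ϖ / q.β s ^ ℓ + ς)
    (ε : ℝ) (hε : 0 < ε) (hεε₀ : ε ≤ q.ε₀) :
    ∃ s : ℕ, IPALM.EpsOptimal P μ (x s) ε ∧
      (∀ t ≤ s, Integrable (fun ω => (m t ω : ℝ)) μ) ∧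
      ∑ t ∈ Finset.range (s + 1), ∫ ω, (m t ω : ℝ) ∂μ
        ≤ q.m₀ + IPALM.c₃ P q xs ls ϖ ς ℓ / ε ^ ℓ
            * Real.log (IPALM.c₁ P q xs ls / (ε * q.ρ)) := by
  have hgap := fun s => hrun.lintegral_gap_le hP hopt hq hrate s
  have hm := fun s => hrun.integrable_integral_m_succ_le hP hopt hq hηρ hgap hK s
  have hρ := hq.ρ_pos
  have hC := hq.four_le_C hηρ (xs := xs) (ls := ls)
  have hB : 0 ≤ Real.logb 2 (q.ρ / q.η) :=
    Real.logb_nonneg one_lt_two ((one_le_div hq.η_pos).2 hηρ.le)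
  have hc₂ : 0 ≤ IPALM.c₂ P q xs ls := by
    rw [IPALM.c₂_eq]
    have := Real.logb_nonneg one_lt_two (by linarith : 1 ≤ q.C P xs ls)
    linarith
  have hc₁ : 2 * ε ≤ IPALM.c₁ P q xs ls := by
    have h1 : q.ε₀ + 2 * (P.Lh₁ : ℝ) ^ 2 * q.β₀ + IPALM.c₀ q xs ls * q.β₀ ≤ IPALM.c₁ P q xs ls :=
      le_max_left _ _
    have h2 := hq.eight_mul_le hηρ (xs := xs) (ls := ls)
    have h3 : 0 ≤ 2 * (P.Lh₁ : ℝ) ^ 2 * q.β₀ := mul_nonneg (by positivity) hq.β₀_pos.le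
    have := hq.ε₀_pos
    linarith
  have hc₁0 : 0 < IPALM.c₁ P q xs ls := by linarith
  obtain ⟨s, hs1, hs2⟩ := IPALM.exists_outer_index hq.ρ_gt hq.ρ_lt hε hc₁
  have hm0 : (fun ω => (m 0 ω : ℝ)) = fun _ => (q.m₀ : ℝ) := funext fun ω => by rw [hrun.m_zero]
  refine ⟨s + 1, hrun.epsOptimal hP hopt hq hηρ hgap hs2, fun t _ => ?_, ?_⟩
  · cases t with
    | zero => rw [hm0]; exact integrable_const _
    | succ t => exact (hm t).1
  -- The prescribed count m₀ is split off, since the bounds on `K` and on the iteration counts start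
  -- at index 1.
  rw [Finset.sum_range_succ', hm0, integral_const, probReal_univ, one_smul, add_comm]
  refine add_le_add_right ?_ _
  set B := Real.logb 2 (q.ρ / q.η)
  set c₂ := IPALM.c₂ P q xs ls
  -- The factor linear in `t` is replaced by its common bound (s + 1)(1 + B + c₂). What remains sums
  -- to order ε^{-ℓ}, while s + 1 supplies the logarithm of c₁/(ερ).
  have h1 : ∀ t ∈ Finset.range (s + 1), ∫ ω, (m (t + 1) ω : ℝ) ∂μ
      ≤ (ϖ / (q.β₀ * q.ρ ^ (t + 1)) ^ ℓ + ς) * (((s + 1 : ℕ) : ℝ) * (1 + B + c₂)) := by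
    intro t ht
    have h2 : (t : ℝ) ≤ s := by exact_mod_cast Nat.lt_succ_iff.1 (Finset.mem_range.1 ht)
    have h3 := hKs (t + 1) (Nat.le_add_left 1 t)
    have h4 : (t : ℝ) * B + c₂ + 1 ≤ ((s + 1 : ℕ) : ℝ) * (1 + B + c₂) := by
      push_cast
      have : (t : ℝ) * B ≤ s * B := by gcongr
      have : 0 ≤ (s : ℝ) * c₂ := by positivity
      have : (0 : ℝ) ≤ s := by positivity
      linarith
    refine (hm t).2.trans (mul_le_mul h3 h4 (by positivity) ?_)
    exact (zero_le_one.trans (hK _)).trans h3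
  refine (Finset.sum_le_sum h1).trans ?_
  rw [← Finset.sum_mul]
  have h5 := IPALM.sum_complexity_le hq.β₀_pos hρ hq.ρ_lt hϖ hς hℓ hc₁0 hε hs1
  have h6 := IPALM.nat_le_log_div hρ hq.ρ_lt hc₁0 hε hs1
  have hr1 : 0 < 1 - q.ρ ^ ℓ := by linarith [Real.rpow_lt_one hρ.le hq.ρ_lt hℓ]
  have hlog : 0 < Real.log (1 / q.ρ) := Real.log_pos ((one_lt_div hρ).2 hq.ρ_lt)
  have hβ₀ := hq.β₀_pos
  refine (mul_le_mul h5 (mul_le_mul_of_nonneg_right h6 (by positivity)) (by positivity)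
    (by positivity)).trans_eq ?_
  rw [IPALM.c₃]
  ring
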